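/- **Theorem 3.1.** Let $\mathbb H$ be the real quaternions. For a quaternion matrix $A$ let $r(A)$ be its rank (dimension of the right $\mathbb H$-space spanned by its columns, equivalently of the left $\mathbb H$-space spanned by its rows), $A^\dagger$ its Moore–Penrose inverse, $L_A=I-A^\dagger A$ and $R_A=I-AA^\dagger$. Let $A_i,B_i,C_i,D_i,E_i,F_i$ $(i=1,\dots,4)$ and $C_c$ be given quaternion matrices of conformable sizes ($A_i$ has $n_i$ columns, $B_i$ has $s_i$ rows), and consider the system $$A_1U=C_1,\quad VB_1=D_1,\quad A_2X=C_2,\ XB_2=D_2,\quad A_3Y=C_3,\ YB_3=D_3,\quad A_4Z=C_4,\ ZB_4=D_4,$$ $$E_1U+VF_1+E_2XF_2+E_3YF_3+E_4ZF_4=C_c \tag{S}$$ in the unknowns $U,V,X,Y,Z$. Put $$A_{ii}=E_iL_{A_i},\ B_{ii}=R_{B_i}F_i\ (i=1,\dots,4),\quad B_{j1}=B_{jj}L_{B_{11}},\ A_{1j}=R_{A_{11}}A_{jj}\ (j=2,3,4),$$ $$T_1=C_c-E_1A_1^\dagger C_1-D_1B_1^\dagger F_1-\sum_{i=2}^4E_i\bigl(A_i^\dagger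 C_i+L_{A_i}D_iB_i^\dagger\bigr)F_i,\quad T_2=R_{A_{11}}T_1L_{B_{11}},$$ $$N_1=B_{31}L_{B_{21}},\quad M_1=R_{A_{12}}A_{13},\quad S_1=A_{13}L_{M_1},\quad G=R_{M_1}R_{A_{12}},\quad H=L_{B_{21}}L_{N_1},$$ $$G_1=GA_{14},\ G_2=R_{A_{12}}A_{14},\ G_3=R_{A_{13}}A_{14},\ G_4=A_{14},\qquad H_1=B_{41},\ H_2=B_{41}L_{B_{31}},\ H_3=B_{41}L_{B_{21}},\ H_4=B_{41}H,$$ $$L_1=GT_2,\quad L_2=R_{A_{12}}T_2L_{B_{31}},\quad L_3=R_{A_{13}}T_2L_{B_{21}},\quad L_4=T_2H,$$ $$C_{11}=(L_{G_2},\ L_{G_4}),\quad D_{11}=\begin{pmatrix}R_{H_1}\\R_{H_3}\end{pmatrix},\quad C_{22}=L_{G_1},\ D_{22}=R_{H_2},\ C_{33}=L_{G_3},\ D_{33}=R_{H_4},$$ $$E_{11}=R_{C_{11}}C_{22},\ E_{22}=R_{C_{11}}C_{33},\ E_{33}=D_{22}L_{D_{11}},\ E_{44}=D_{33}L_{D_{11}},\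 M=R_{E_{11}}E_{22},\ N=E_{44}L_{E_{33}},\ S=E_{22}L_M,$$ $$F_{33}=G_1^\dagger L_1H_1^\dagger+L_{G_1}G_2^\dagger L_2H_2^\dagger,\quad F_{44}=G_3^\dagger L_3H_3^\dagger+L_{G_3}G_4^\dagger L_4H_4^\dagger,\quad F=F_{44}-F_{33},\quad E=R_{C_{11}}FL_{D_{11}}.$$ The following statements are equivalent. (1) The system (S) has a solution. (2) $A_iD_i=C_iB_i$ for $i=2,3,4$; $R_{A_j}C_j=0$, $D_jL_{B_j}=0$, $R_{G_j}L_j=0$, $L_jL_{H_j}=0$ for $j=1,\dots,4$; and $R_{E_{22}}EL_{E_{33}}=0$. (3) $A_iD_i=C_iB_i$ for $i=2,3,4$; $r(C_i,\ A_i)=r(A_i)$ and $r\begin{pmatrix}D_i\\B_i\end{pmatrix}=r(B_i)$ for $i=1,\dots,4$; $$r\begin{pmatrix}C_c&E_1&E_2&E_3&E_4&D_1\\F_1&0&0&0&0&B_1\\C_1&A_1&0&0&0&0\\C_2F_2&0&A_2&0&0&0\\C_3F_3&0&0&A_3&0&0\\C_4F_4&0&0&0&A_4&0\end{pmatrix}=r\begin{pmatrix}E_1&E_2&E_3&E_4\\A_1&0&0&0\\0&A_2&0&0\\0&0&A_3&0\\0&0&0&A_4\end{pmatrix}+r(F_1,\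 B_1);$$ for $(i,j,l)\in\{(2,4,3),(3,4,2),(2,3,4)\}$ $$r\begin{pmatrix}C_c&E_1&E_i&E_j&E_lD_l&D_1\\C_1&A_1&0&0&0&0\\C_iF_i&0&A_i&0&0&0\\C_jF_j&0&0&A_j&0&0\\F_l&0&0&0&B_l&0\\F_1&0&0&0&0&B_1\end{pmatrix}=r\begin{pmatrix}E_1&E_i&E_j\\A_1&0&0\\0&A_i&0\\0&0&A_j\end{pmatrix}+r\begin{pmatrix}F_l&B_l&0\\F_1&0&B_1\end{pmatrix};$$ for $(i,j,l)\in\{(4,2,3),(2,3,4),(3,2,4)\}$ $$r\begin{pmatrix}C_c&E_i&E_1&E_jD_j&E_lD_l&D_1\\F_j&0&0&B_j&0&0\\F_l&0&0&0&B_l&0\\F_1&0&0&0&0&B_1\\C_iF_i&A_i&0&0&0&0\\C_1&0&A_1&0&0&0\end{pmatrix}=r\begin{pmatrix}F_j&B_j&0&0\\F_l&0&B_l&0\\F_1&0&0&B_1\end{pmatrix}+r\begin{pmatrix}E_i&E_1\\A_i&0\\0&A_1\end{pmatrix};$$ $$r\begin{pmatrix}C_c&E_1&E_4D_4&E_2D_2&E_3D_3&D_1\\F_4&0&B_4&0&0&0\\F_2&0&0&B_2&0&0\\F_3&0&0&0&B_3&0\\F_1&0&0&0&0&B_1\\C_1&A_1&0&0&0&0\end{pmatrix}=r\begin{pmatrix}F_4&B_4&0&0&0\\F_2&0&B_2&0&0\\F_3&0&0&B_3&0\\F_1&0&0&0&B_1\end{pmatrix}+r\begin{pmatrix}E_1\\A_1\end{pmatrix};$$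 and $$r\begin{pmatrix}C_c&E_2&E_1&0&0&0&E_4&E_3D_3&D_1&0&0&E_4D_4\\F_3&0&0&0&0&0&0&B_3&0&0&0&0\\F_1&0&0&0&0&0&0&0&B_1&0&0&0\\0&0&0&C_c&E_3&E_1&E_4&0&0&E_2D_2&D_1&0\\0&0&0&F_2&0&0&0&0&0&B_2&0&0\\0&0&0&F_1&0&0&0&0&0&0&B_1&0\\F_4&0&0&-F_4&0&0&0&0&0&0&0&B_4\\C_2F_2&A_2&0&0&0&0&0&0&0&0&0&0\\C_1&0&A_1&0&0&0&0&0&0&0&0&0\\0&0&0&C_3F_3&A_3&0&0&0&0&0&0&0\\0&0&0&C_1&0&A_1&0&0&0&0&0&0\\0&0&0&C_4F_4&0&0&A_4&0&0&0&0&0\end{pmatrix}$$ $$=r\begin{pmatrix}F_3&0&B_3&0&0&0&0\\F_1&0&0&B_1&0&0&0\\0&F_2&0&0&B_2&0&0\\0&F_1&0&0&0&B_1&0\\F_4&F_4&0&0&0&0&B_4\end{pmatrix}+r\begin{pmatrix}E_2&E_1&0&0&E_4\\0&0&E_3&E_1&E_4\\A_2&0&0&0&0\\0&A_1&0&0&0\\0&0&A_3&0&0\\0&0&0&A_1&0\\0&0&0&0&A_4\end{pmatrix}.$$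 If these hold, the general solution of (S) is $$U=A_1^\dagger C_1+L_{A_1}\widehat S_1,\quad V=D_1B_1^\dagger+\widehat S_2R_{B_1},\quad X=A_2^\dagger C_2+L_{A_2}D_2B_2^\dagger+L_{A_2}U_1R_{B_2},$$ $$Y=A_3^\dagger C_3+L_{A_3}D_3B_3^\dagger+L_{A_3}U_2R_{B_3},\quad Z=A_4^\dagger C_4+L_{A_4}D_4B_4^\dagger+L_{A_4}U_3R_{B_4},$$ where $$\widehat S_1=A_{11}^\dagger(T_1-A_{22}XB_{22}-A_{33}YB_{33}-A_{44}ZB_{44})-A_{11}^\dagger W_{11}B_{11}+L_{A_{11}}W_{12},$$ $$\widehat S_2=R_{A_{11}}(T_1-A_{22}XB_{22}-A_{33}YB_{33}-A_{44}ZB_{44})B_{11}^\dagger+A_{11}A_{11}^\dagger W_{11}+W_{13}R_{B_{11}},$$ $$U_1=A_{12}^\dagger TB_{21}^\dagger-A_{12}^\dagger A_{13}M_1^\dagger TB_{21}^\dagger-A_{12}^\dagger S_1A_{13}^\dagger TN_1^\dagger B_{31}B_{21}^\dagger-A_{12}^\dagger S_1U_4R_{N_1}B_{31}B_{21}^\dagger+L_{A_{12}}U_5+U_6R_{B_{21}},$$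 $$U_2=M_1^\dagger TB_{31}^\dagger+S_1^\dagger S_1A_{13}^\dagger TN_1^\dagger+L_{M_1}L_{S_1}U_7+U_8R_{B_{31}}+L_{M_1}U_4R_{N_1},\qquad T=T_2-A_{14}U_3B_{41},$$ $$U_3=F_{33}+L_{G_2}V_1+V_2R_{H_1}+L_{G_1}V_3R_{H_2}\quad\text{or}\quad U_3=F_{44}-L_{G_4}W_1-W_2R_{H_3}-L_{G_3}W_3R_{H_4},$$ and, with $m=n_4$, $n=s_4$ and $Q=F-C_{22}V_3D_{22}-C_{33}W_3D_{33}$, $$V_1=(I_m,0)\,C_{11}^\dagger Q-(I_m,0)\bigl[C_{11}^\dagger U_{11}D_{11}-L_{C_{11}}U_{12}\bigr],\quad W_1=(0,I_m)\,C_{11}^\dagger Q-(0,I_m)\bigl[C_{11}^\dagger U_{11}D_{11}-L_{C_{11}}U_{12}\bigr],$$ $$V_2=\bigl[R_{C_{11}}QD_{11}^\dagger+C_{11}C_{11}^\dagger U_{11}+U_{21}R_{D_{11}}\bigr]\begin{pmatrix}I_n\\0\end{pmatrix},\quad W_2=\bigl[R_{C_{11}}QD_{11}^\dagger+C_{11}C_{11}^\dagger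 U_{11}+U_{21}R_{D_{11}}\bigr]\begin{pmatrix}0\\I_n\end{pmatrix},$$ $$V_3=E_{11}^\dagger FE_{33}^\dagger-E_{11}^\dagger E_{22}M^\dagger FE_{33}^\dagger-E_{11}^\dagger SE_{22}^\dagger FN^\dagger E_{44}E_{33}^\dagger-E_{11}^\dagger SU_{31}R_NE_{44}E_{33}^\dagger+L_{E_{11}}U_{32}+U_{33}R_{E_{33}},$$ $$W_3=M^\dagger FE_{44}^\dagger+S^\dagger SE_{22}^\dagger FN^\dagger+L_ML_SU_{41}+L_MU_{31}R_N+U_{42}R_{E_{44}},$$ with $W_{11},W_{12},W_{13},U_4,\dots,U_8,U_{11},U_{12},U_{21},U_{31},U_{32},U_{33},U_{41},U_{42}$ arbitrary quaternion matrices of conformable sizes. That is: for every choice of these matrices the two expressions for $U_3$ coincide, and $(U,V,X,Y,Z)$ solves (S) if and only if it is given by these formulas for some choice of them. -/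

import Mathlib

open Matrix Quaternion

/-! ### Moore–Penrose inverse, the two projectors, and rank of a quaternion matrix -/

/-- `Y` is the Moore–Penrose inverse of the quaternion matrix `A` (the four Penrose equations). -/
structure IsMoorePenrose {m n : Type*} [Fintype m] [Fintype n]
    (A : Matrix m n ℍ[ℝ]) (Y : Matrix n m ℍ[ℝ]) : Prop where
  mul_mul_self : A * Y * A = A
  self_mul_mul : Y * A * Y = Y
  left_star : (A * Y)ᴴ = A * Y
  right_star : (Y * A)ᴴ = Y * A

theorem quaternion_conjTranspose_mul_self_eq_zero {m n : Type*} [Fintype m]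
    (A : Matrix m n ℍ[ℝ]) (h : Aᴴ * A = 0) : A = 0 := by
  ext1 i j
  have h1 : ∑ k, star (A k j) * A k j = 0 := by
    have := congrFun (congrFun h j) j
    simpa [Matrix.mul_apply, Matrix.conjTranspose_apply] using this
  have h2 : ∑ k, Quaternion.normSq (A k j) = 0 := by
    have h3 : ((∑ k, Quaternion.normSq (A k j) : ℝ) : ℍ[ℝ]) = 0 := by
      rw [← h1]
      have : ∀ s : Finset m, ((∑ k ∈ s, Quaternion.normSq (A k j) : ℝ) : ℍ[ℝ])
          = ∑ k ∈ s, star (A k j) * A k j := by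
        classical
        intro s
        induction s using Finset.induction_on with
        | empty => simp
        | insert a s ha ih =>
          rw [Finset.sum_insert ha, Finset.sum_insert ha, Quaternion.coe_add, ih,
            Quaternion.star_mul_self]
      exact this Finset.univ
    exact Quaternion.coe_injective (by rw [h3, Quaternion.coe_zero])
  have h4 := (Finset.sum_eq_zero_iff_of_nonneg
    (fun k _ => Quaternion.normSq_nonneg (a := A k j))).1 h2 i (Finset.mem_univ i)
  simpa using h4

theorem quaternion_left_cancel {m n k : Type*} [Fintype m] [Fintype n]
    (A : Matrix m n ℍ[ℝ]) (X : Matrix n k ℍ[ℝ]) (h : Aᴴ * A * X = 0) : A * X = 0 := by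
  apply quaternion_conjTranspose_mul_self_eq_zero
  rw [Matrix.conjTranspose_mul, Matrix.mul_assoc, ← Matrix.mul_assoc Aᴴ, h, Matrix.mul_zero]

/-- A Hermitian quaternion matrix has a commuting inner inverse. -/
theorem quaternion_exists_commuting_inverse {n : Type*} [Fintype n] [DecidableEq n]
    (B : Matrix n n ℍ[ℝ]) (hB : Bᴴ = B) : ∃ Y, B * Y * B = B ∧ B * Y = Y * B := by
  have hcancel : ∀ X : Matrix n n ℍ[ℝ], B * (B * X) = 0 → B * X = 0 := fun X hX =>
    quaternion_left_cancel B X (by rw [hB, Matrix.mul_assoc, hX])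
  obtain ⟨p, hp0, hp⟩ : ∃ p : Polynomial ℝ, p ≠ 0 ∧ Polynomial.aeval B p = 0 := by
    obtain ⟨p, hp, h⟩ := Algebra.IsIntegral.isIntegral (R := ℝ) B
    exact ⟨p, hp.ne_zero, h⟩
  obtain ⟨g, hpg, hg⟩ := Polynomial.exists_eq_pow_rootMultiplicity_mul_and_not_dvd p hp0 0
  rw [Polynomial.C_0, sub_zero] at hpg hg
  have hg0 : g.coeff 0 ≠ 0 := fun h => hg (Polynomial.X_dvd_iff.2 h)
  have key : B * Polynomial.aeval B g = 0 := by
    have : ∀ k : ℕ, B ^ k * Polynomial.aeval B g = 0 → B * Polynomial.aeval B g = 0 := by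
      intro k
      induction k with
      | zero => intro h; rw [pow_zero, one_mul] at h; rw [h, mul_zero]
      | succ k ih =>
        intro h
        rcases k with _ | k
        · simpa using h
        · apply ih
          have := hcancel (B ^ k * Polynomial.aeval B g)
            (by rw [← h, pow_succ', pow_succ', mul_assoc, mul_assoc])
          rw [pow_succ', mul_assoc]; exact this
    apply this (p.rootMultiplicity 0)
    have h := hp
    rw [hpg, map_mul, map_pow, Polynomial.aeval_X] at h
    exact h
  have hdec := Polynomial.divX_mul_X_add g
  set c := g.coeff 0
  set Z := Polynomial.aeval B g.divX
  have hcomm : Z * B = B * Z := by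
    have h1 : Z * B = Polynomial.aeval B (g.divX * Polynomial.X) := by
      rw [map_mul, Polynomial.aeval_X]
    rw [h1, mul_comm, map_mul, Polynomial.aeval_X]
  have h2 : Polynomial.aeval B g = Z * B + c • (1 : Matrix n n ℍ[ℝ]) := by
    conv_lhs => rw [← hdec]
    rw [map_add, map_mul, Polynomial.aeval_X, Polynomial.aeval_C, Algebra.algebraMap_eq_smul_one]
  rw [h2, mul_add, mul_smul_comm, mul_one] at key
  refine ⟨(-c⁻¹) • Z, ?_, ?_⟩
  · rw [mul_smul_comm, smul_mul_assoc, mul_assoc, eq_neg_of_add_eq_zero_left key, smul_neg,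
      neg_smul, neg_neg, smul_smul, inv_mul_cancel₀ hg0, one_smul]
  · rw [mul_smul_comm, smul_mul_assoc, hcomm]

theorem exists_selfAdjoint_group_inverse {R : Type*} [Ring R] [StarRing R] (B Y : R)
    (hB : star B = B) (h1 : B * Y * B = B) (h2 : B * Y = Y * B) :
    ∃ Z, star Z = Z ∧ B * Z = Z * B ∧ B * Z * B = B ∧ Z * B * Z = Z := by
  have hP : star (B * Y) = B * Y := by
    have h3 : star (B * Y) * (B * Y) = star (B * Y) := by
      rw [star_mul, hB, mul_assoc, h2, ← mul_assoc B, h1]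
    have h4 := congrArg star h3
    rw [star_mul, star_star] at h4
    exact h3.symm.trans h4
  have hP' : star Y * B = B * Y := by rw [← hP, star_mul, hB]
  have hP'' : B * star Y = B * Y := by
    have h3 := hP
    rw [h2, star_mul, hB] at h3
    rw [h3, h2]
  have hZ : B * (Y * B * Y) = B * Y := by rw [← mul_assoc, ← mul_assoc, h1]
  have hZ' : (Y * B * Y) * B = B * Y := by
    rw [mul_assoc, mul_assoc, ← mul_assoc B, h1, h2]
  refine ⟨Y * B * Y, ?_, hZ.trans hZ'.symm, by rw [hZ, h1], ?_⟩
  · rw [star_mul, star_mul, hB, ← mul_assoc, hP', mul_assoc]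
    calc B * (Y * star Y) = Y * (B * star Y) := by rw [← mul_assoc, h2, mul_assoc]
      _ = Y * B * Y := by rw [hP'', mul_assoc]
  · rw [hZ', h2]
    calc Y * B * (Y * B * Y) = Y * (B * Y * B) * Y := by simp only [mul_assoc]
      _ = Y * B * Y := by rw [h1]

theorem exists_isMoorePenrose {m n : Type*} [Fintype m] [Fintype n]
    (A : Matrix m n ℍ[ℝ]) : ∃ Y, IsMoorePenrose A Y := by
  classical
  have hB : (Aᴴ * A)ᴴ = Aᴴ * A := by rw [conjTranspose_mul, conjTranspose_conjTranspose]
  obtain ⟨Y, h1, h2⟩ := quaternion_exists_commuting_inverse (Aᴴ * A) hB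
  obtain ⟨Z, hZ, hc, hi, ho⟩ := exists_selfAdjoint_group_inverse (Aᴴ * A) Y hB h1 h2
  rw [star_eq_conjTranspose] at hZ
  refine ⟨Z * Aᴴ, ?_, ?_, ?_, ?_⟩
  · have h3 : A * (Z * (Aᴴ * A) - 1) = 0 := by
      apply quaternion_left_cancel
      rw [Matrix.mul_sub, Matrix.mul_one, ← Matrix.mul_assoc, hi, sub_self]
    rw [Matrix.mul_sub, Matrix.mul_one, sub_eq_zero] at h3
    rw [Matrix.mul_assoc, Matrix.mul_assoc, h3]
  · rw [Matrix.mul_assoc Z Aᴴ A, ← Matrix.mul_assoc, ho]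
  · rw [conjTranspose_mul, conjTranspose_mul, conjTranspose_conjTranspose, hZ, Matrix.mul_assoc]
  · rw [Matrix.mul_assoc, conjTranspose_mul, hZ, hB, hc]

theorem IsMoorePenrose.unique {m n : Type*} [Fintype m] [Fintype n] {A : Matrix m n ℍ[ℝ]}
    {Y Z : Matrix n m ℍ[ℝ]} (hY : IsMoorePenrose A Y) (hZ : IsMoorePenrose A Z) : Y = Z := by
  have h1 : A * Y = A * Z := by
    have h : (A * Z) * (A * Y) = A * Y := by rw [← Matrix.mul_assoc, hZ.mul_mul_self]
    have h' := congrArg conjTranspose h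
    rw [conjTranspose_mul, hY.left_star, hZ.left_star, ← Matrix.mul_assoc, hY.mul_mul_self] at h'
    exact h'.symm
  have h2 : Y * A = Z * A := by
    have h : (Y * A) * (Z * A) = Y * A := by
      rw [Matrix.mul_assoc, ← Matrix.mul_assoc A, hZ.mul_mul_self]
    have h' := congrArg conjTranspose h
    rw [conjTranspose_mul, hY.right_star, hZ.right_star, Matrix.mul_assoc, ← Matrix.mul_assoc A,
      hY.mul_mul_self] at h'
    exact h'.symm
  rw [← hY.self_mul_mul, ← hZ.self_mul_mul, h2, Matrix.mul_assoc, h1, ← Matrix.mul_assoc]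

/-- The Moore–Penrose inverse `A†`. -/
noncomputable def pinv {m n : Type*} [Fintype m] [Fintype n] (A : Matrix m n ℍ[ℝ]) :
    Matrix n m ℍ[ℝ] :=
  Classical.choose (exists_isMoorePenrose A)

theorem pinv_isMoorePenrose {m n : Type*} [Fintype m] [Fintype n] (A : Matrix m n ℍ[ℝ]) :
    IsMoorePenrose A (pinv A) :=
  Classical.choose_spec (exists_isMoorePenrose A)

/-- The projector `L_A = I - A† A`. -/
noncomputable def projL {m n : Type*} [Fintype m] [Fintype n] [DecidableEq n]
    (A : Matrix m n ℍ[ℝ]) : Matrix n n ℍ[ℝ] :=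
  1 - pinv A * A

/-- The projector `R_A = I - A A†`. -/
noncomputable def projR {m n : Type*} [Fintype m] [Fintype n] [DecidableEq m]
    (A : Matrix m n ℍ[ℝ]) : Matrix m m ℍ[ℝ] :=
  1 - A * pinv A

/-- The rank of a quaternion matrix: the dimension of the left `ℍ`-space spanned by its rows
(equivalently, of the right `ℍ`-space spanned by its columns). -/
noncomputable def qrank {m n : Type*} (A : Matrix m n ℍ[ℝ]) : ℕ :=
  Module.finrank ℍ[ℝ] (Submodule.span ℍ[ℝ] (Set.range A.row))

/-- Blocks side by side: `A ◫ B` is the block row `(A, B)`. -/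
infixr:63 " ◫ " => Matrix.fromCols

/-- Blocks on top of each other: `A ⊟ B` is the block column with `A` above `B`. -/
infixr:62 " ⊟ " => Matrix.fromRows

/-! ### The system -/

/-- The sizes of the matrices in the system. -/
structure Sizes where
  (p q m₁ m₂ m₃ m₄ n₁ n₂ n₃ n₄ s₁ s₂ s₃ s₄ t₁ t₂ t₃ t₄ : ℕ)

/-- The given matrices of the system (of conformable sizes, and otherwise arbitrary). -/
structure Coeffs (d : Sizes) where
  A₁ : Matrix (Fin d.m₁) (Fin d.n₁) ℍ[ℝ]
  A₂ : Matrix (Fin d.m₂) (Fin d.n₂) ℍ[ℝ]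
  A₃ : Matrix (Fin d.m₃) (Fin d.n₃) ℍ[ℝ]
  A₄ : Matrix (Fin d.m₄) (Fin d.n₄) ℍ[ℝ]
  B₁ : Matrix (Fin d.s₁) (Fin d.t₁) ℍ[ℝ]
  B₂ : Matrix (Fin d.s₂) (Fin d.t₂) ℍ[ℝ]
  B₃ : Matrix (Fin d.s₃) (Fin d.t₃) ℍ[ℝ]
  B₄ : Matrix (Fin d.s₄) (Fin d.t₄) ℍ[ℝ]
  C₁ : Matrix (Fin d.m₁) (Fin d.q) ℍ[ℝ]
  C₂ : Matrix (Fin d.m₂) (Fin d.s₂) ℍ[ℝ]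
  C₃ : Matrix (Fin d.m₃) (Fin d.s₃) ℍ[ℝ]
  C₄ : Matrix (Fin d.m₄) (Fin d.s₄) ℍ[ℝ]
  D₁ : Matrix (Fin d.p) (Fin d.t₁) ℍ[ℝ]
  D₂ : Matrix (Fin d.n₂) (Fin d.t₂) ℍ[ℝ]
  D₃ : Matrix (Fin d.n₃) (Fin d.t₃) ℍ[ℝ]
  D₄ : Matrix (Fin d.n₄) (Fin d.t₄) ℍ[ℝ]
  E₁ : Matrix (Fin d.p) (Fin d.n₁) ℍ[ℝ]
  E₂ : Matrix (Fin d.p) (Fin d.n₂) ℍ[ℝ]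
  E₃ : Matrix (Fin d.p) (Fin d.n₃) ℍ[ℝ]
  E₄ : Matrix (Fin d.p) (Fin d.n₄) ℍ[ℝ]
  F₁ : Matrix (Fin d.s₁) (Fin d.q) ℍ[ℝ]
  F₂ : Matrix (Fin d.s₂) (Fin d.q) ℍ[ℝ]
  F₃ : Matrix (Fin d.s₃) (Fin d.q) ℍ[ℝ]
  F₄ : Matrix (Fin d.s₄) (Fin d.q) ℍ[ℝ]
  Cc : Matrix (Fin d.p) (Fin d.q) ℍ[ℝ]

namespace Coeffs

variable {d : Sizes} (K : Coeffs d)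

/-- `(U, V, X, Y, Z)` solves the system. -/
structure IsSolution (U : Matrix (Fin d.n₁) (Fin d.q) ℍ[ℝ]) (V : Matrix (Fin d.p) (Fin d.s₁) ℍ[ℝ])
    (X : Matrix (Fin d.n₂) (Fin d.s₂) ℍ[ℝ]) (Y : Matrix (Fin d.n₃) (Fin d.s₃) ℍ[ℝ])
    (Z : Matrix (Fin d.n₄) (Fin d.s₄) ℍ[ℝ]) : Prop where
  eqU : K.A₁ * U = K.C₁
  eqV : V * K.B₁ = K.D₁
  eqX : K.A₂ * X = K.C₂
  eqX' : X * K.B₂ = K.D₂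
  eqY : K.A₃ * Y = K.C₃
  eqY' : Y * K.B₃ = K.D₃
  eqZ : K.A₄ * Z = K.C₄
  eqZ' : Z * K.B₄ = K.D₄
  eqMain : K.E₁ * U + V * K.F₁ + K.E₂ * X * K.F₂ + K.E₃ * Y * K.F₃ + K.E₄ * Z * K.F₄ = K.Cc

/-- The system has a solution. -/
def Solvable : Prop := ∃ U V X Y Z, K.IsSolution U V X Y Z

/-! ### The auxiliary matrices -/

noncomputable def A₁₁ : Matrix (Fin d.p) (Fin d.n₁) ℍ[ℝ] :=
  K.E₁ * projL K.A₁

noncomputable def A₂₂ : Matrix (Fin d.p) (Fin d.n₂) ℍ[ℝ] :=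
  K.E₂ * projL K.A₂

noncomputable def A₃₃ : Matrix (Fin d.p) (Fin d.n₃) ℍ[ℝ] :=
  K.E₃ * projL K.A₃

noncomputable def A₄₄ : Matrix (Fin d.p) (Fin d.n₄) ℍ[ℝ] :=
  K.E₄ * projL K.A₄

noncomputable def B₁₁ : Matrix (Fin d.s₁) (Fin d.q) ℍ[ℝ] :=
  projR K.B₁ * K.F₁

noncomputable def B₂₂ : Matrix (Fin d.s₂) (Fin d.q) ℍ[ℝ] :=
  projR K.B₂ * K.F₂

noncomputable def B₃₃ : Matrix (Fin d.s₃) (Fin d.q) ℍ[ℝ] :=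
  projR K.B₃ * K.F₃

noncomputable def B₄₄ : Matrix (Fin d.s₄) (Fin d.q) ℍ[ℝ] :=
  projR K.B₄ * K.F₄

noncomputable def B₂₁ : Matrix (Fin d.s₂) (Fin d.q) ℍ[ℝ] :=
  K.B₂₂ * projL K.B₁₁

noncomputable def B₃₁ : Matrix (Fin d.s₃) (Fin d.q) ℍ[ℝ] :=
  K.B₃₃ * projL K.B₁₁

noncomputable def B₄₁ : Matrix (Fin d.s₄) (Fin d.q) ℍ[ℝ] :=
  K.B₄₄ * projL K.B₁₁

noncomputable def A₁₂ : Matrix (Fin d.p) (Fin d.n₂) ℍ[ℝ] :=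
  projR K.A₁₁ * K.A₂₂

noncomputable def A₁₃ : Matrix (Fin d.p) (Fin d.n₃) ℍ[ℝ] :=
  projR K.A₁₁ * K.A₃₃

noncomputable def A₁₄ : Matrix (Fin d.p) (Fin d.n₄) ℍ[ℝ] :=
  projR K.A₁₁ * K.A₄₄

noncomputable def T₁ : Matrix (Fin d.p) (Fin d.q) ℍ[ℝ] :=
  K.Cc - K.E₁ * pinv K.A₁ * K.C₁ - K.D₁ * pinv K.B₁ * K.F₁
    - (K.E₂ * (pinv K.A₂ * K.C₂ + projL K.A₂ * K.D₂ * pinv K.B₂) * K.F₂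
      + K.E₃ * (pinv K.A₃ * K.C₃ + projL K.A₃ * K.D₃ * pinv K.B₃) * K.F₃
      + K.E₄ * (pinv K.A₄ * K.C₄ + projL K.A₄ * K.D₄ * pinv K.B₄) * K.F₄)

noncomputable def N₁ : Matrix (Fin d.s₃) (Fin d.q) ℍ[ℝ] :=
  K.B₃₁ * projL K.B₂₁

noncomputable def M₁ : Matrix (Fin d.p) (Fin d.n₃) ℍ[ℝ] :=
  projR K.A₁₂ * K.A₁₃

noncomputable def S₁ : Matrix (Fin d.p) (Fin d.n₃) ℍ[ℝ] :=
  K.A₁₃ * projL K.M₁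

noncomputable def T₂ : Matrix (Fin d.p) (Fin d.q) ℍ[ℝ] :=
  projR K.A₁₁ * K.T₁ * projL K.B₁₁

noncomputable def G : Matrix (Fin d.p) (Fin d.p) ℍ[ℝ] :=
  projR K.M₁ * projR K.A₁₂

noncomputable def G₁ : Matrix (Fin d.p) (Fin d.n₄) ℍ[ℝ] :=
  K.G * K.A₁₄

noncomputable def G₂ : Matrix (Fin d.p) (Fin d.n₄) ℍ[ℝ] :=
  projR K.A₁₂ * K.A₁₄

noncomputable def G₃ : Matrix (Fin d.p) (Fin d.n₄) ℍ[ℝ] :=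
  projR K.A₁₃ * K.A₁₄

noncomputable def G₄ : Matrix (Fin d.p) (Fin d.n₄) ℍ[ℝ] :=
  K.A₁₄

noncomputable def H : Matrix (Fin d.q) (Fin d.q) ℍ[ℝ] :=
  projL K.B₂₁ * projL K.N₁

noncomputable def H₁ : Matrix (Fin d.s₄) (Fin d.q) ℍ[ℝ] :=
  K.B₄₁

noncomputable def H₂ : Matrix (Fin d.s₄) (Fin d.q) ℍ[ℝ] :=
  K.B₄₁ * projL K.B₃₁

noncomputable def H₃ : Matrix (Fin d.s₄) (Fin d.q) ℍ[ℝ] :=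
  K.B₄₁ * projL K.B₂₁

noncomputable def H₄ : Matrix (Fin d.s₄) (Fin d.q) ℍ[ℝ] :=
  K.B₄₁ * K.H

noncomputable def L₁ : Matrix (Fin d.p) (Fin d.q) ℍ[ℝ] :=
  K.G * K.T₂

noncomputable def L₂ : Matrix (Fin d.p) (Fin d.q) ℍ[ℝ] :=
  projR K.A₁₂ * K.T₂ * projL K.B₃₁

noncomputable def L₃ : Matrix (Fin d.p) (Fin d.q) ℍ[ℝ] :=
  projR K.A₁₃ * K.T₂ * projL K.B₂₁

noncomputable def L₄ : Matrix (Fin d.p) (Fin d.q) ℍ[ℝ] :=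
  K.T₂ * K.H

noncomputable def C₁₁ : Matrix (Fin d.n₄) (Fin d.n₄ ⊕ Fin d.n₄) ℍ[ℝ] :=
  projL K.G₂ ◫ projL K.G₄

noncomputable def D₁₁ : Matrix (Fin d.s₄ ⊕ Fin d.s₄) (Fin d.s₄) ℍ[ℝ] :=
  projR K.H₁ ⊟ projR K.H₃

noncomputable def C₂₂ : Matrix (Fin d.n₄) (Fin d.n₄) ℍ[ℝ] :=
  projL K.G₁

noncomputable def D₂₂ : Matrix (Fin d.s₄) (Fin d.s₄) ℍ[ℝ] :=
  projR K.H₂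

noncomputable def C₃₃ : Matrix (Fin d.n₄) (Fin d.n₄) ℍ[ℝ] :=
  projL K.G₃

noncomputable def D₃₃ : Matrix (Fin d.s₄) (Fin d.s₄) ℍ[ℝ] :=
  projR K.H₄

noncomputable def E₁₁ : Matrix (Fin d.n₄) (Fin d.n₄) ℍ[ℝ] :=
  projR K.C₁₁ * K.C₂₂

noncomputable def E₂₂ : Matrix (Fin d.n₄) (Fin d.n₄) ℍ[ℝ] :=
  projR K.C₁₁ * K.C₃₃

noncomputable def E₃₃ : Matrix (Fin d.s₄) (Fin d.s₄) ℍ[ℝ] :=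
  K.D₂₂ * projL K.D₁₁

noncomputable def E₄₄ : Matrix (Fin d.s₄) (Fin d.s₄) ℍ[ℝ] :=
  K.D₃₃ * projL K.D₁₁

noncomputable def M : Matrix (Fin d.n₄) (Fin d.n₄) ℍ[ℝ] :=
  projR K.E₁₁ * K.E₂₂

noncomputable def N : Matrix (Fin d.s₄) (Fin d.s₄) ℍ[ℝ] :=
  K.E₄₄ * projL K.E₃₃

noncomputable def F₃₃ : Matrix (Fin d.n₄) (Fin d.s₄) ℍ[ℝ] :=
  pinv K.G₁ * K.L₁ * pinv K.H₁ + projL K.G₁ * pinv K.G₂ * K.L₂ * pinv K.H₂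

noncomputable def F₄₄ : Matrix (Fin d.n₄) (Fin d.s₄) ℍ[ℝ] :=
  pinv K.G₃ * K.L₃ * pinv K.H₃ + projL K.G₃ * pinv K.G₄ * K.L₄ * pinv K.H₄

noncomputable def F : Matrix (Fin d.n₄) (Fin d.s₄) ℍ[ℝ] :=
  K.F₄₄ - K.F₃₃

noncomputable def E : Matrix (Fin d.n₄) (Fin d.s₄) ℍ[ℝ] :=
  projR K.C₁₁ * K.F * projL K.D₁₁

noncomputable def S : Matrix (Fin d.n₄) (Fin d.n₄) ℍ[ℝ] :=
  K.E₂₂ * projL K.M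

/-! ### The solvability conditions -/

/-- `A_i D_i = C_i B_i` for `i = 2, 3, 4`. -/
def Compatible : Prop :=
  K.A₂ * K.D₂ = K.C₂ * K.B₂ ∧ K.A₃ * K.D₃ = K.C₃ * K.B₃ ∧ K.A₄ * K.D₄ = K.C₄ * K.B₄

/-- The conditions in terms of Moore–Penrose inverses. -/
structure ProjectorConditions : Prop where
  compatible : K.Compatible
  RC₁ : projR K.A₁ * K.C₁ = 0
  RC₂ : projR K.A₂ * K.C₂ = 0
  RC₃ : projR K.A₃ * K.C₃ = 0
  RC₄ : projR K.A₄ * K.C₄ = 0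
  DL₁ : K.D₁ * projL K.B₁ = 0
  DL₂ : K.D₂ * projL K.B₂ = 0
  DL₃ : K.D₃ * projL K.B₃ = 0
  DL₄ : K.D₄ * projL K.B₄ = 0
  RL₁ : projR K.G₁ * K.L₁ = 0
  RL₂ : projR K.G₂ * K.L₂ = 0
  RL₃ : projR K.G₃ * K.L₃ = 0
  RL₄ : projR K.G₄ * K.L₄ = 0
  LL₁ : K.L₁ * projL K.H₁ = 0
  LL₂ : K.L₂ * projL K.H₂ = 0
  LL₃ : K.L₃ * projL K.H₃ = 0
  LL₄ : K.L₄ * projL K.H₄ = 0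
  final : projR K.E₂₂ * K.E * projL K.E₃₃ = 0

/-- The conditions in terms of ranks of block matrices. -/
structure RankConditions : Prop where
  compatible : K.Compatible
  rank_CA₁ : qrank (K.C₁ ◫ K.A₁) = qrank K.A₁
  rank_CA₂ : qrank (K.C₂ ◫ K.A₂) = qrank K.A₂
  rank_CA₃ : qrank (K.C₃ ◫ K.A₃) = qrank K.A₃
  rank_CA₄ : qrank (K.C₄ ◫ K.A₄) = qrank K.A₄
  rank_DB₁ : qrank (K.D₁ ⊟ K.B₁) = qrank K.B₁
  rank_DB₂ : qrank (K.D₂ ⊟ K.B₂) = qrank K.B₂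
  rank_DB₃ : qrank (K.D₃ ⊟ K.B₃) = qrank K.B₃
  rank_DB₄ : qrank (K.D₄ ⊟ K.B₄) = qrank K.B₄
  rank_main :
    qrank (K.Cc          ◫ K.E₁ ◫ K.E₂ ◫ K.E₃ ◫ K.E₄ ◫ K.D₁ ⊟
           K.F₁          ◫ 0    ◫ 0    ◫ 0    ◫ 0    ◫ K.B₁ ⊟
           K.C₁          ◫ K.A₁ ◫ 0    ◫ 0    ◫ 0    ◫ 0 ⊟
           (K.C₂ * K.F₂) ◫ 0    ◫ K.A₂ ◫ 0    ◫ 0    ◫ 0 ⊟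
           (K.C₃ * K.F₃) ◫ 0    ◫ 0    ◫ K.A₃ ◫ 0    ◫ 0 ⊟
           (K.C₄ * K.F₄) ◫ 0    ◫ 0    ◫ 0    ◫ K.A₄ ◫ 0) =
    qrank (K.E₁ ◫ K.E₂ ◫ K.E₃ ◫ K.E₄ ⊟
           K.A₁ ◫ 0    ◫ 0    ◫ 0 ⊟
           0    ◫ K.A₂ ◫ 0    ◫ 0 ⊟
           0    ◫ 0    ◫ K.A₃ ◫ 0 ⊟
           0    ◫ 0    ◫ 0    ◫ K.A₄) +
    qrank (K.F₁ ◫ K.B₁)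
  rank_24 :
    qrank (K.Cc          ◫ K.E₁ ◫ K.E₂ ◫ K.E₄ ◫ (K.E₃ * K.D₃) ◫ K.D₁ ⊟
           K.C₁          ◫ K.A₁ ◫ 0    ◫ 0    ◫ 0             ◫ 0 ⊟
           (K.C₂ * K.F₂) ◫ 0    ◫ K.A₂ ◫ 0    ◫ 0             ◫ 0 ⊟
           (K.C₄ * K.F₄) ◫ 0    ◫ 0    ◫ K.A₄ ◫ 0             ◫ 0 ⊟
           K.F₃          ◫ 0    ◫ 0    ◫ 0    ◫ K.B₃          ◫ 0 ⊟
           K.F₁          ◫ 0    ◫ 0    ◫ 0    ◫ 0             ◫ K.B₁) =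
    qrank (K.E₁ ◫ K.E₂ ◫ K.E₄ ⊟
           K.A₁ ◫ 0    ◫ 0 ⊟
           0    ◫ K.A₂ ◫ 0 ⊟
           0    ◫ 0    ◫ K.A₄) +
    qrank (K.F₃ ◫ K.B₃ ◫ 0 ⊟
           K.F₁ ◫ 0    ◫ K.B₁)
  rank_34 :
    qrank (K.Cc          ◫ K.E₁ ◫ K.E₃ ◫ K.E₄ ◫ (K.E₂ * K.D₂) ◫ K.D₁ ⊟
           K.C₁          ◫ K.A₁ ◫ 0    ◫ 0    ◫ 0             ◫ 0 ⊟
           (K.C₃ * K.F₃) ◫ 0    ◫ K.A₃ ◫ 0    ◫ 0             ◫ 0 ⊟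
           (K.C₄ * K.F₄) ◫ 0    ◫ 0    ◫ K.A₄ ◫ 0             ◫ 0 ⊟
           K.F₂          ◫ 0    ◫ 0    ◫ 0    ◫ K.B₂          ◫ 0 ⊟
           K.F₁          ◫ 0    ◫ 0    ◫ 0    ◫ 0             ◫ K.B₁) =
    qrank (K.E₁ ◫ K.E₃ ◫ K.E₄ ⊟
           K.A₁ ◫ 0    ◫ 0 ⊟
           0    ◫ K.A₃ ◫ 0 ⊟
           0    ◫ 0    ◫ K.A₄) +
    qrank (K.F₂ ◫ K.B₂ ◫ 0 ⊟
           K.F₁ ◫ 0    ◫ K.B₁)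
  rank_4 :
    qrank (K.Cc          ◫ K.E₄ ◫ K.E₁ ◫ (K.E₂ * K.D₂) ◫ (K.E₃ * K.D₃) ◫ K.D₁ ⊟
           K.F₂          ◫ 0    ◫ 0    ◫ K.B₂          ◫ 0             ◫ 0 ⊟
           K.F₃          ◫ 0    ◫ 0    ◫ 0             ◫ K.B₃          ◫ 0 ⊟
           K.F₁          ◫ 0    ◫ 0    ◫ 0             ◫ 0             ◫ K.B₁ ⊟
           (K.C₄ * K.F₄) ◫ K.A₄ ◫ 0    ◫ 0             ◫ 0             ◫ 0 ⊟
           K.C₁          ◫ 0    ◫ K.A₁ ◫ 0             ◫ 0             ◫ 0) =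
    qrank (K.F₂ ◫ K.B₂ ◫ 0    ◫ 0 ⊟
           K.F₃ ◫ 0    ◫ K.B₃ ◫ 0 ⊟
           K.F₁ ◫ 0    ◫ 0    ◫ K.B₁) +
    qrank (K.E₄ ◫ K.E₁ ⊟
           K.A₄ ◫ 0 ⊟
           0    ◫ K.A₁)
  rank_23 :
    qrank (K.Cc          ◫ K.E₁ ◫ K.E₂ ◫ K.E₃ ◫ (K.E₄ * K.D₄) ◫ K.D₁ ⊟
           K.C₁          ◫ K.A₁ ◫ 0    ◫ 0    ◫ 0             ◫ 0 ⊟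
           (K.C₂ * K.F₂) ◫ 0    ◫ K.A₂ ◫ 0    ◫ 0             ◫ 0 ⊟
           (K.C₃ * K.F₃) ◫ 0    ◫ 0    ◫ K.A₃ ◫ 0             ◫ 0 ⊟
           K.F₄          ◫ 0    ◫ 0    ◫ 0    ◫ K.B₄          ◫ 0 ⊟
           K.F₁          ◫ 0    ◫ 0    ◫ 0    ◫ 0             ◫ K.B₁) =
    qrank (K.E₁ ◫ K.E₂ ◫ K.E₃ ⊟
           K.A₁ ◫ 0    ◫ 0 ⊟
           0    ◫ K.A₂ ◫ 0 ⊟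
           0    ◫ 0    ◫ K.A₃) +
    qrank (K.F₄ ◫ K.B₄ ◫ 0 ⊟
           K.F₁ ◫ 0    ◫ K.B₁)
  rank_2 :
    qrank (K.Cc          ◫ K.E₂ ◫ K.E₁ ◫ (K.E₃ * K.D₃) ◫ (K.E₄ * K.D₄) ◫ K.D₁ ⊟
           K.F₃          ◫ 0    ◫ 0    ◫ K.B₃          ◫ 0             ◫ 0 ⊟
           K.F₄          ◫ 0    ◫ 0    ◫ 0             ◫ K.B₄          ◫ 0 ⊟
           K.F₁          ◫ 0    ◫ 0    ◫ 0             ◫ 0             ◫ K.B₁ ⊟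
           (K.C₂ * K.F₂) ◫ K.A₂ ◫ 0    ◫ 0             ◫ 0             ◫ 0 ⊟
           K.C₁          ◫ 0    ◫ K.A₁ ◫ 0             ◫ 0             ◫ 0) =
    qrank (K.F₃ ◫ K.B₃ ◫ 0    ◫ 0 ⊟
           K.F₄ ◫ 0    ◫ K.B₄ ◫ 0 ⊟
           K.F₁ ◫ 0    ◫ 0    ◫ K.B₁) +
    qrank (K.E₂ ◫ K.E₁ ⊟
           K.A₂ ◫ 0 ⊟
           0    ◫ K.A₁)
  rank_3 :
    qrank (K.Cc          ◫ K.E₃ ◫ K.E₁ ◫ (K.E₂ * K.D₂) ◫ (K.E₄ * K.D₄) ◫ K.D₁ ⊟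
           K.F₂          ◫ 0    ◫ 0    ◫ K.B₂          ◫ 0             ◫ 0 ⊟
           K.F₄          ◫ 0    ◫ 0    ◫ 0             ◫ K.B₄          ◫ 0 ⊟
           K.F₁          ◫ 0    ◫ 0    ◫ 0             ◫ 0             ◫ K.B₁ ⊟
           (K.C₃ * K.F₃) ◫ K.A₃ ◫ 0    ◫ 0             ◫ 0             ◫ 0 ⊟
           K.C₁          ◫ 0    ◫ K.A₁ ◫ 0             ◫ 0             ◫ 0) =
    qrank (K.F₂ ◫ K.B₂ ◫ 0    ◫ 0 ⊟
           K.F₄ ◫ 0    ◫ K.B₄ ◫ 0 ⊟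
           K.F₁ ◫ 0    ◫ 0    ◫ K.B₁) +
    qrank (K.E₃ ◫ K.E₁ ⊟
           K.A₃ ◫ 0 ⊟
           0    ◫ K.A₁)
  rank_none :
    qrank (K.Cc ◫ K.E₁ ◫ (K.E₄ * K.D₄) ◫ (K.E₂ * K.D₂) ◫ (K.E₃ * K.D₃) ◫ K.D₁ ⊟
           K.F₄ ◫ 0    ◫ K.B₄          ◫ 0             ◫ 0             ◫ 0 ⊟
           K.F₂ ◫ 0    ◫ 0             ◫ K.B₂          ◫ 0             ◫ 0 ⊟
           K.F₃ ◫ 0    ◫ 0             ◫ 0             ◫ K.B₃          ◫ 0 ⊟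
           K.F₁ ◫ 0    ◫ 0             ◫ 0             ◫ 0             ◫ K.B₁ ⊟
           K.C₁ ◫ K.A₁ ◫ 0             ◫ 0             ◫ 0             ◫ 0) =
    qrank (K.F₄ ◫ K.B₄ ◫ 0    ◫ 0    ◫ 0 ⊟
           K.F₂ ◫ 0    ◫ K.B₂ ◫ 0    ◫ 0 ⊟
           K.F₃ ◫ 0    ◫ 0    ◫ K.B₃ ◫ 0 ⊟
           K.F₁ ◫ 0    ◫ 0    ◫ 0    ◫ K.B₁) +
    qrank (K.E₁ ⊟
           K.A₁)
  rank_double :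
    qrank (K.Cc          ◫ K.E₂ ◫ K.E₁ ◫ 0             ◫ 0    ◫ 0    ◫ K.E₄ ◫ (K.E₃ * K.D₃) ◫ K.D₁ ◫ 0             ◫ 0    ◫ (K.E₄ * K.D₄) ⊟
           K.F₃          ◫ 0    ◫ 0    ◫ 0             ◫ 0    ◫ 0    ◫ 0    ◫ K.B₃          ◫ 0    ◫ 0             ◫ 0    ◫ 0 ⊟
           K.F₁          ◫ 0    ◫ 0    ◫ 0             ◫ 0    ◫ 0    ◫ 0    ◫ 0             ◫ K.B₁ ◫ 0             ◫ 0    ◫ 0 ⊟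
           0             ◫ 0    ◫ 0    ◫ K.Cc          ◫ K.E₃ ◫ K.E₁ ◫ K.E₄ ◫ 0             ◫ 0    ◫ (K.E₂ * K.D₂) ◫ K.D₁ ◫ 0 ⊟
           0             ◫ 0    ◫ 0    ◫ K.F₂          ◫ 0    ◫ 0    ◫ 0    ◫ 0             ◫ 0    ◫ K.B₂          ◫ 0    ◫ 0 ⊟
           0             ◫ 0    ◫ 0    ◫ K.F₁          ◫ 0    ◫ 0    ◫ 0    ◫ 0             ◫ 0    ◫ 0             ◫ K.B₁ ◫ 0 ⊟
           K.F₄          ◫ 0    ◫ 0    ◫ (-K.F₄)       ◫ 0    ◫ 0    ◫ 0    ◫ 0             ◫ 0    ◫ 0             ◫ 0    ◫ K.B₄ ⊟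
           (K.C₂ * K.F₂) ◫ K.A₂ ◫ 0    ◫ 0             ◫ 0    ◫ 0    ◫ 0    ◫ 0             ◫ 0    ◫ 0             ◫ 0    ◫ 0 ⊟
           K.C₁          ◫ 0    ◫ K.A₁ ◫ 0             ◫ 0    ◫ 0    ◫ 0    ◫ 0             ◫ 0    ◫ 0             ◫ 0    ◫ 0 ⊟
           0             ◫ 0    ◫ 0    ◫ (K.C₃ * K.F₃) ◫ K.A₃ ◫ 0    ◫ 0    ◫ 0             ◫ 0    ◫ 0             ◫ 0    ◫ 0 ⊟
           0             ◫ 0    ◫ 0    ◫ K.C₁          ◫ 0    ◫ K.A₁ ◫ 0    ◫ 0             ◫ 0    ◫ 0             ◫ 0    ◫ 0 ⊟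
           0             ◫ 0    ◫ 0    ◫ (K.C₄ * K.F₄) ◫ 0    ◫ 0    ◫ K.A₄ ◫ 0             ◫ 0    ◫ 0             ◫ 0    ◫ 0) =
    qrank (K.F₃ ◫ 0    ◫ K.B₃ ◫ 0    ◫ 0    ◫ 0    ◫ 0 ⊟
           K.F₁ ◫ 0    ◫ 0    ◫ K.B₁ ◫ 0    ◫ 0    ◫ 0 ⊟
           0    ◫ K.F₂ ◫ 0    ◫ 0    ◫ K.B₂ ◫ 0    ◫ 0 ⊟
           0    ◫ K.F₁ ◫ 0    ◫ 0    ◫ 0    ◫ K.B₁ ◫ 0 ⊟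
           K.F₄ ◫ K.F₄ ◫ 0    ◫ 0    ◫ 0    ◫ 0    ◫ K.B₄) +
    qrank (K.E₂ ◫ K.E₁ ◫ 0    ◫ 0    ◫ K.E₄ ⊟
           0    ◫ 0    ◫ K.E₃ ◫ K.E₁ ◫ K.E₄ ⊟
           K.A₂ ◫ 0    ◫ 0    ◫ 0    ◫ 0 ⊟
           0    ◫ K.A₁ ◫ 0    ◫ 0    ◫ 0 ⊟
           0    ◫ 0    ◫ K.A₃ ◫ 0    ◫ 0 ⊟
           0    ◫ 0    ◫ 0    ◫ K.A₁ ◫ 0 ⊟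
           0    ◫ 0    ◫ 0    ◫ 0    ◫ K.A₄)

/-! ### The general solution -/

end Coeffs

/-- The arbitrary matrices in the general solution. -/
structure Params (d : Sizes) where
  W₁₁ : Matrix (Fin d.p) (Fin d.s₁) ℍ[ℝ]
  W₁₂ : Matrix (Fin d.n₁) (Fin d.q) ℍ[ℝ]
  W₁₃ : Matrix (Fin d.p) (Fin d.s₁) ℍ[ℝ]
  U₄ : Matrix (Fin d.n₃) (Fin d.s₃) ℍ[ℝ]
  U₅ : Matrix (Fin d.n₂) (Fin d.s₂) ℍ[ℝ]
  U₆ : Matrix (Fin d.n₂) (Fin d.s₂) ℍ[ℝ]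
  U₇ : Matrix (Fin d.n₃) (Fin d.s₃) ℍ[ℝ]
  U₈ : Matrix (Fin d.n₃) (Fin d.s₃) ℍ[ℝ]
  U₁₁ : Matrix (Fin d.n₄) (Fin d.s₄ ⊕ Fin d.s₄) ℍ[ℝ]
  U₁₂ : Matrix (Fin d.n₄ ⊕ Fin d.n₄) (Fin d.s₄) ℍ[ℝ]
  U₂₁ : Matrix (Fin d.n₄) (Fin d.s₄ ⊕ Fin d.s₄) ℍ[ℝ]
  U₃₁ : Matrix (Fin d.n₄) (Fin d.s₄) ℍ[ℝ]
  U₃₂ : Matrix (Fin d.n₄) (Fin d.s₄) ℍ[ℝ]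
  U₃₃ : Matrix (Fin d.n₄) (Fin d.s₄) ℍ[ℝ]
  U₄₁ : Matrix (Fin d.n₄) (Fin d.s₄) ℍ[ℝ]
  U₄₂ : Matrix (Fin d.n₄) (Fin d.s₄) ℍ[ℝ]

namespace Coeffs

variable {d : Sizes} (K : Coeffs d) (P : Params d)

noncomputable def V₃ : Matrix (Fin d.n₄) (Fin d.s₄) ℍ[ℝ] :=
  pinv K.E₁₁ * K.F * pinv K.E₃₃ - pinv K.E₁₁ * K.E₂₂ * pinv K.M * K.F * pinv K.E₃₃
    - pinv K.E₁₁ * K.S * pinv K.E₂₂ * K.F * pinv K.N * K.E₄₄ * pinv K.E₃₃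
    - pinv K.E₁₁ * K.S * P.U₃₁ * projR K.N * K.E₄₄ * pinv K.E₃₃
    + projL K.E₁₁ * P.U₃₂ + P.U₃₃ * projR K.E₃₃

noncomputable def W₃ : Matrix (Fin d.n₄) (Fin d.s₄) ℍ[ℝ] :=
  pinv K.M * K.F * pinv K.E₄₄ + pinv K.S * K.S * pinv K.E₂₂ * K.F * pinv K.N
    + projL K.M * projL K.S * P.U₄₁ + projL K.M * P.U₃₁ * projR K.N + P.U₄₂ * projR K.E₄₄

/-- The common factor `F - C₂₂ V₃ D₂₂ - C₃₃ W₃ D₃₃`. -/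
noncomputable def Q : Matrix (Fin d.n₄) (Fin d.s₄) ℍ[ℝ] :=
  K.F - K.C₂₂ * K.V₃ P * K.D₂₂ - K.C₃₃ * K.W₃ P * K.D₃₃

noncomputable def V₁ : Matrix (Fin d.n₄) (Fin d.s₄) ℍ[ℝ] :=
  (1 ◫ 0 : Matrix (Fin d.n₄) (Fin d.n₄ ⊕ Fin d.n₄) ℍ[ℝ]) * (pinv K.C₁₁ * K.Q P)
    - (1 ◫ 0 : Matrix (Fin d.n₄) (Fin d.n₄ ⊕ Fin d.n₄) ℍ[ℝ])
      * (pinv K.C₁₁ * P.U₁₁ * K.D₁₁ - projL K.C₁₁ * P.U₁₂)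

noncomputable def W₁ : Matrix (Fin d.n₄) (Fin d.s₄) ℍ[ℝ] :=
  (0 ◫ 1 : Matrix (Fin d.n₄) (Fin d.n₄ ⊕ Fin d.n₄) ℍ[ℝ]) * (pinv K.C₁₁ * K.Q P)
    - (0 ◫ 1 : Matrix (Fin d.n₄) (Fin d.n₄ ⊕ Fin d.n₄) ℍ[ℝ])
      * (pinv K.C₁₁ * P.U₁₁ * K.D₁₁ - projL K.C₁₁ * P.U₁₂)

noncomputable def W₂ : Matrix (Fin d.n₄) (Fin d.s₄) ℍ[ℝ] :=
  (projR K.C₁₁ * K.Q P * pinv K.D₁₁)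
      * (0 ⊟ 1 : Matrix (Fin d.s₄ ⊕ Fin d.s₄) (Fin d.s₄) ℍ[ℝ])
    + (K.C₁₁ * pinv K.C₁₁ * P.U₁₁ + P.U₂₁ * projR K.D₁₁)
      * (0 ⊟ 1 : Matrix (Fin d.s₄ ⊕ Fin d.s₄) (Fin d.s₄) ℍ[ℝ])

noncomputable def V₂ : Matrix (Fin d.n₄) (Fin d.s₄) ℍ[ℝ] :=
  (projR K.C₁₁ * K.Q P * pinv K.D₁₁)
      * (1 ⊟ 0 : Matrix (Fin d.s₄ ⊕ Fin d.s₄) (Fin d.s₄) ℍ[ℝ])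
    + (K.C₁₁ * pinv K.C₁₁ * P.U₁₁ + P.U₂₁ * projR K.D₁₁)
      * (1 ⊟ 0 : Matrix (Fin d.s₄ ⊕ Fin d.s₄) (Fin d.s₄) ℍ[ℝ])

/-- The first expression for `U₃`. -/
noncomputable def U₃ : Matrix (Fin d.n₄) (Fin d.s₄) ℍ[ℝ] :=
  K.F₃₃ + projL K.G₂ * K.V₁ P + K.V₂ P * projR K.H₁ + projL K.G₁ * K.V₃ P * projR K.H₂

/-- The second expression for `U₃`. -/
noncomputable def U₃' : Matrix (Fin d.n₄) (Fin d.s₄) ℍ[ℝ] :=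
  K.F₄₄ - projL K.G₄ * K.W₁ P - K.W₂ P * projR K.H₃ - projL K.G₃ * K.W₃ P * projR K.H₄

/-! Below, `u` stands for the chosen expression for `U₃`. -/

variable (u : Matrix (Fin d.n₄) (Fin d.s₄) ℍ[ℝ])

noncomputable def T : Matrix (Fin d.p) (Fin d.q) ℍ[ℝ] :=
  K.T₂ - K.A₁₄ * u * K.B₄₁

noncomputable def U₁ : Matrix (Fin d.n₂) (Fin d.s₂) ℍ[ℝ] :=
  pinv K.A₁₂ * K.T u * pinv K.B₂₁ - pinv K.A₁₂ * K.A₁₃ * pinv K.M₁ * K.T u * pinv K.B₂₁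
    - pinv K.A₁₂ * K.S₁ * pinv K.A₁₃ * K.T u * pinv K.N₁ * K.B₃₁ * pinv K.B₂₁
    - pinv K.A₁₂ * K.S₁ * P.U₄ * projR K.N₁ * K.B₃₁ * pinv K.B₂₁
    + projL K.A₁₂ * P.U₅ + P.U₆ * projR K.B₂₁

noncomputable def U₂ : Matrix (Fin d.n₃) (Fin d.s₃) ℍ[ℝ] :=
  pinv K.M₁ * K.T u * pinv K.B₃₁ + pinv K.S₁ * K.S₁ * pinv K.A₁₃ * K.T u * pinv K.N₁
    + projL K.M₁ * projL K.S₁ * P.U₇ + P.U₈ * projR K.B₃₁ + projL K.M₁ * P.U₄ * projR K.N₁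

noncomputable def solX : Matrix (Fin d.n₂) (Fin d.s₂) ℍ[ℝ] :=
  pinv K.A₂ * K.C₂ + projL K.A₂ * K.D₂ * pinv K.B₂ + projL K.A₂ * K.U₁ P u * projR K.B₂

noncomputable def solY : Matrix (Fin d.n₃) (Fin d.s₃) ℍ[ℝ] :=
  pinv K.A₃ * K.C₃ + projL K.A₃ * K.D₃ * pinv K.B₃ + projL K.A₃ * K.U₂ P u * projR K.B₃

noncomputable def solZ : Matrix (Fin d.n₄) (Fin d.s₄) ℍ[ℝ] :=
  pinv K.A₄ * K.C₄ + projL K.A₄ * K.D₄ * pinv K.B₄ + projL K.A₄ * u * projR K.B₄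

/-- The common factor `T₁ - A₂₂ X B₂₂ - A₃₃ Y B₃₃ - A₄₄ Z B₄₄`. -/
noncomputable def rem : Matrix (Fin d.p) (Fin d.q) ℍ[ℝ] :=
  K.T₁ - K.A₂₂ * K.solX P u * K.B₂₂ - K.A₃₃ * K.solY P u * K.B₃₃ - K.A₄₄ * K.solZ u * K.B₄₄

/-- The matrix entering `U` through `L_{A₁}`. -/
noncomputable def freeU : Matrix (Fin d.n₁) (Fin d.q) ℍ[ℝ] :=
  pinv K.A₁₁ * K.rem P u - pinv K.A₁₁ * P.W₁₁ * K.B₁₁ + projL K.A₁₁ * P.W₁₂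

/-- The matrix entering `V` through `R_{B₁}`. -/
noncomputable def freeV : Matrix (Fin d.p) (Fin d.s₁) ℍ[ℝ] :=
  projR K.A₁₁ * K.rem P u * pinv K.B₁₁ + K.A₁₁ * pinv K.A₁₁ * P.W₁₁ + P.W₁₃ * projR K.B₁₁

noncomputable def solU : Matrix (Fin d.n₁) (Fin d.q) ℍ[ℝ] :=
  pinv K.A₁ * K.C₁ + projL K.A₁ * K.freeU P u

noncomputable def solV : Matrix (Fin d.p) (Fin d.s₁) ℍ[ℝ] :=
  K.D₁ * pinv K.B₁ + K.freeV P u * projR K.B₁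

/-- `(U, V, X, Y, Z)` is given by the general formula with parameters `P` and `U₃ = u`. -/
structure IsGiven (U : Matrix (Fin d.n₁) (Fin d.q) ℍ[ℝ]) (V : Matrix (Fin d.p) (Fin d.s₁) ℍ[ℝ])
    (X : Matrix (Fin d.n₂) (Fin d.s₂) ℍ[ℝ]) (Y : Matrix (Fin d.n₃) (Fin d.s₃) ℍ[ℝ])
    (Z : Matrix (Fin d.n₄) (Fin d.s₄) ℍ[ℝ]) : Prop where
  eqU : U = K.solU P u
  eqV : V = K.solV P u
  eqX : X = K.solX P u
  eqY : Y = K.solY P u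
  eqZ : Z = K.solZ u

end Coeffs

/-! The system is solved by eliminating unknowns through two model equations.

The equation `A X + Y B = T` is solvable exactly when `R_A T L_B = 0`. After the one-sided and
two-sided constraints are absorbed into particular solutions, the main equation reads `A₁₁ U + V B₁₁
= T₁ - A₂₂ X B₂₂ - A₃₃ Y B₃₃ - A₄₄ Z B₄₄`, so eliminating `U` and `V` leaves `A₁₂ X B₂₁ + A₁₃ Y B₃₁
+ A₁₄ Z B₄₁ = T₂`. For fixed `Z` this is an instance of `A X B + C Y D = T`, whose solvability
amounts to four projector identities (`two_term_solution`,
`projector_conditions_of_two_term_solution`). Each of them is a linear equation `G_i Z H_i = L_i`.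

These four equations form two nested pairs, and `common_solution` describes the solutions of each
pair: the families around `F₃₃` and around `F₄₄`. The matrix `Z` must lie in both. Equating the
families gives a one-term equation with coefficients `C₁₁` and `D₁₁`, whose condition is the
two-term equation `E₁₁ V₃ E₃₃ + E₂₂ W₃ E₄₄ = E`. Three of its four conditions hold automatically
(`E_conditions`); the fourth is the last projector condition. At every stage the parametric family
is shown to be complete, so unwinding the stages yields the general solution.

The rank conditions rest on one fact: `r(M A; B 0) = r(A) + r(B)` holds iff every row vector killing
`A` is sent by `M` into the row space of `B`. This follows from `M = A P + Q B`, and it implies `X M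
Y = 0` whenever `X A = 0` and `B Y = 0`. A solution of the system supplies `P` and `Q`, which gives
the rank conditions. Conversely, suitable `X` and `Y` turn each rank equality into the vanishing of
a product with `T₁` in the middle, which is a projector condition; the doubled rank equality links
two such products and gives the last one. The cycle is solvable, rank, projector, solvable. -/

set_option linter.unusedSectionVars false

/-! ### Identities for the Moore–Penrose inverse and its projectors -/

section MoorePenrose

variable {k l m n : Type*} [Fintype m] [Fintype n]

theorem mul_pinv_mul (A : Matrix m n ℍ[ℝ]) : A * (pinv A * A) = A := by
  rw [← Matrix.mul_assoc, (pinv_isMoorePenrose A).mul_mul_self]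

theorem mul_pinv_mul_assoc (A : Matrix m n ℍ[ℝ]) (X : Matrix n k ℍ[ℝ]) :
    A * (pinv A * (A * X)) = A * X := by
  rw [← Matrix.mul_assoc, ← Matrix.mul_assoc, (pinv_isMoorePenrose A).mul_mul_self]

theorem pinv_mul_pinv (A : Matrix m n ℍ[ℝ]) : pinv A * (A * pinv A) = pinv A := by
  rw [← Matrix.mul_assoc, (pinv_isMoorePenrose A).self_mul_mul]

theorem pinv_mul_pinv_assoc (A : Matrix m n ℍ[ℝ]) (X : Matrix m k ℍ[ℝ]) :
    pinv A * (A * (pinv A * X)) = pinv A * X := by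
  rw [← Matrix.mul_assoc, ← Matrix.mul_assoc, (pinv_isMoorePenrose A).self_mul_mul]

theorem mul_projL [DecidableEq n] (A : Matrix m n ℍ[ℝ]) : A * projL A = 0 := by
  rw [projL, Matrix.mul_sub, Matrix.mul_one, mul_pinv_mul, sub_self]

theorem mul_projL_assoc [DecidableEq n] (A : Matrix m n ℍ[ℝ]) (X : Matrix n k ℍ[ℝ]) :
    A * (projL A * X) = 0 := by
  rw [← Matrix.mul_assoc, mul_projL, Matrix.zero_mul]

theorem projR_mul [DecidableEq m] (A : Matrix m n ℍ[ℝ]) : projR A * A = 0 := by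
  rw [projR, Matrix.sub_mul, Matrix.one_mul, (pinv_isMoorePenrose A).mul_mul_self, sub_self]

theorem projR_mul_assoc [DecidableEq m] (A : Matrix m n ℍ[ℝ]) (X : Matrix n k ℍ[ℝ]) :
    projR A * (A * X) = 0 := by
  rw [← Matrix.mul_assoc, projR_mul, Matrix.zero_mul]

theorem pinv_mul_projR [DecidableEq m] (A : Matrix m n ℍ[ℝ]) : pinv A * projR A = 0 := by
  rw [projR, Matrix.mul_sub, Matrix.mul_one, pinv_mul_pinv, sub_self]

theorem pinv_mul_projR_assoc [DecidableEq m] (A : Matrix m n ℍ[ℝ]) (X : Matrix m k ℍ[ℝ]) :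
    pinv A * (projR A * X) = 0 := by
  rw [← Matrix.mul_assoc, pinv_mul_projR, Matrix.zero_mul]

theorem projL_mul_pinv [DecidableEq n] (A : Matrix m n ℍ[ℝ]) : projL A * pinv A = 0 := by
  rw [projL, Matrix.sub_mul, Matrix.one_mul, (pinv_isMoorePenrose A).self_mul_mul, sub_self]

theorem projL_mul_pinv_assoc [DecidableEq n] (A : Matrix m n ℍ[ℝ]) (X : Matrix m k ℍ[ℝ]) :
    projL A * (pinv A * X) = 0 := by
  rw [← Matrix.mul_assoc, projL_mul_pinv, Matrix.zero_mul]

theorem projL_mul_projL [DecidableEq n] (A : Matrix m n ℍ[ℝ]) :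
    projL A * projL A = projL A := by
  conv_lhs => rw [projL.eq_def A, Matrix.sub_mul, Matrix.one_mul]
  rw [← projL, Matrix.mul_assoc, mul_projL, Matrix.mul_zero, sub_zero]

theorem projR_mul_projR [DecidableEq m] (A : Matrix m n ℍ[ℝ]) :
    projR A * projR A = projR A := by
  conv_lhs => rw [projR.eq_def A, Matrix.sub_mul, Matrix.one_mul]
  rw [← projR, Matrix.mul_assoc, pinv_mul_projR, Matrix.mul_zero, sub_zero]

theorem mul_projR_of_mul_eq_zero [DecidableEq m] {A : Matrix m n ℍ[ℝ]} {X : Matrix k m ℍ[ℝ]}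
    (h : X * A = 0) : X * projR A = X := by
  rw [projR, Matrix.mul_sub, ← Matrix.mul_assoc, h, Matrix.zero_mul, Matrix.mul_one, sub_zero]

theorem projL_mul_of_mul_eq_zero [DecidableEq n] {A : Matrix m n ℍ[ℝ]} {Y : Matrix n k ℍ[ℝ]}
    (h : A * Y = 0) : projL A * Y = Y := by
  rw [projL, Matrix.sub_mul, Matrix.mul_assoc, h, Matrix.mul_zero, Matrix.one_mul, sub_zero]

theorem mul_pinv_mul_of_mul_projL_eq_zero [DecidableEq n] {A : Matrix m n ℍ[ℝ]}
    {X : Matrix k n ℍ[ℝ]} (h : X * projL A = 0) : X * (pinv A * A) = X := by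
  rw [projL, Matrix.mul_sub, Matrix.mul_one, sub_eq_zero] at h
  exact h.symm

theorem mul_pinv_mul_of_projR_mul_eq_zero [DecidableEq m] {A : Matrix m n ℍ[ℝ]}
    {Y : Matrix m k ℍ[ℝ]} (h : projR A * Y = 0) : A * (pinv A * Y) = Y := by
  rw [projR, Matrix.sub_mul, Matrix.one_mul, sub_eq_zero, Matrix.mul_assoc] at h
  exact h.symm

theorem conjTranspose_projL [DecidableEq n] (A : Matrix m n ℍ[ℝ]) : (projL A)ᴴ = projL A := by
  rw [projL, conjTranspose_sub, conjTranspose_one, (pinv_isMoorePenrose A).right_star]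

theorem conjTranspose_projR [DecidableEq m] (A : Matrix m n ℍ[ℝ]) : (projR A)ᴴ = projR A := by
  rw [projR, conjTranspose_sub, conjTranspose_one, (pinv_isMoorePenrose A).left_star]

/-- Both `A A†` and `P` are Hermitian, so the adjoint of `P (A A†) = A A†` is `(A A†) P = A A†`.
Consequently `A†` absorbs any orthogonal projector that fixes `A`; this lets `T` and `R_A T` be
interchanged behind a pseudoinverse. -/
theorem pinv_mul_of_mul_eq {A : Matrix m n ℍ[ℝ]} {P : Matrix m m ℍ[ℝ]} (hP : Pᴴ = P)
    (h : P * A = A) : pinv A * P = pinv A := by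
  have h1 : A * pinv A * P = A * pinv A := by
    rw [← (pinv_isMoorePenrose A).left_star, conjTranspose_mul]
    conv_lhs => rw [← hP]
    rw [Matrix.mul_assoc, ← conjTranspose_mul, h]
  rw [← (pinv_isMoorePenrose A).self_mul_mul, Matrix.mul_assoc (pinv A), Matrix.mul_assoc, h1]

theorem mul_pinv_of_mul_eq {A : Matrix m n ℍ[ℝ]} {P : Matrix n n ℍ[ℝ]} (hP : Pᴴ = P)
    (h : A * P = A) : P * pinv A = pinv A := by
  have h1 : P * (pinv A * A) = pinv A * A := by
    rw [← (pinv_isMoorePenrose A).right_star, conjTranspose_mul]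
    conv_lhs => rw [← hP]
    rw [← Matrix.mul_assoc, ← conjTranspose_mul, h]
  rw [← (pinv_isMoorePenrose A).self_mul_mul, ← Matrix.mul_assoc, h1]

theorem mul_mul_assoc_of_eq {j : Type*} [Fintype j] {A : Matrix k m ℍ[ℝ]} {B : Matrix m j ℍ[ℝ]}
    {C : Matrix k j ℍ[ℝ]} (h : A * B = C) (X : Matrix j l ℍ[ℝ]) : A * (B * X) = C * X := by
  rw [← Matrix.mul_assoc, h]

end MoorePenrose

section OneTerm

/-! ### The equation `A X + Y B = T` -/

variable {k l m n : Type*} [Fintype m] [Fintype n] [Fintype k] [Fintype l]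
  [DecidableEq m] [DecidableEq n] [DecidableEq k] [DecidableEq l]

/-- The general solution of `A X + Y B = T`. -/
theorem mul_add_mul_eq_of_projR_mul_projL {A : Matrix m n ℍ[ℝ]} {B : Matrix k l ℍ[ℝ]}
    {T : Matrix m l ℍ[ℝ]} (h : projR A * T * projL B = 0) (W : Matrix m k ℍ[ℝ])
    (W' : Matrix n l ℍ[ℝ]) (W'' : Matrix m k ℍ[ℝ]) :
    A * (pinv A * T - pinv A * W * B + projL A * W')
      + (projR A * T * pinv B + A * pinv A * W + W'' * projR B) * B = T := by
  simp only [projR, projL, Matrix.mul_sub, Matrix.sub_mul, Matrix.mul_add, Matrix.add_mul,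
    Matrix.mul_one, Matrix.one_mul, Matrix.mul_assoc, mul_pinv_mul, mul_pinv_mul_assoc] at h ⊢
  -- The terms in `W` cancel, and the two sides differ exactly by `R_A T L_B`.
  linear_combination (norm := abel) -h

/-- Completeness of the family: the solution itself provides the parameters, since `A† T - A† Y B =
A† A X`. -/
theorem exists_params_of_mul_add_mul_eq {A : Matrix m n ℍ[ℝ]} {B : Matrix k l ℍ[ℝ]}
    {T : Matrix m l ℍ[ℝ]} {X : Matrix n l ℍ[ℝ]} {Y : Matrix m k ℍ[ℝ]} (h : A * X + Y * B = T) :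
    ∃ (W : Matrix m k ℍ[ℝ]) (W' : Matrix n l ℍ[ℝ]) (W'' : Matrix m k ℍ[ℝ]),
      X = pinv A * T - pinv A * W * B + projL A * W' ∧
      Y = projR A * T * pinv B + A * pinv A * W + W'' * projR B := by
  refine ⟨Y, X, projR A * Y, ?_, ?_⟩ <;> subst h
  · simp only [projL, Matrix.sub_mul, Matrix.mul_add, Matrix.one_mul, Matrix.mul_assoc]
    abel
  · simp only [projR, Matrix.mul_sub, Matrix.sub_mul, Matrix.mul_add, Matrix.add_mul,
      Matrix.mul_one, Matrix.one_mul, Matrix.mul_assoc, mul_pinv_mul_assoc]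
    abel

end OneTerm

/-! ### Common solutions of two nested equations -/

section CommonSolution

variable {k l m n p q : Type*} [Fintype m] [Fintype n] [Fintype k] [Fintype l]
  [Fintype p] [Fintype q]
  [DecidableEq m] [DecidableEq n] [DecidableEq k] [DecidableEq l] [DecidableEq p] [DecidableEq q]

/-- The common solutions of `G X H = L` and `G' X H' = L'` when `G = P G'` and `H' = H Q`. -/
theorem common_solution {G : Matrix m n ℍ[ℝ]} {H : Matrix k l ℍ[ℝ]} {L : Matrix m l ℍ[ℝ]}
    {G' : Matrix p n ℍ[ℝ]} {H' : Matrix k q ℍ[ℝ]} {L' : Matrix p q ℍ[ℝ]}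
    {P : Matrix m p ℍ[ℝ]} {Q : Matrix l q ℍ[ℝ]} (hG : P * G' = G) (hH : H * Q = H')
    (hL : P * L' = L * Q) (h1 : projR G * L = 0) (h2 : projR G' * L' = 0) (h3 : L * projL H = 0)
    (h4 : L' * projL H' = 0) (V₁ V₂ V₃ : Matrix n k ℍ[ℝ]) {X : Matrix n k ℍ[ℝ]}
    (hX : X = pinv G * L * pinv H + projL G * pinv G' * L' * pinv H' + projL G' * V₁
      + V₂ * projR H + projL G * V₃ * projR H') :
    G * X * H = L ∧ G' * X * H' = L' := by
  have h1' := mul_pinv_mul_of_projR_mul_eq_zero h1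
  have h2' := mul_pinv_mul_of_projR_mul_eq_zero h2
  have h3' := mul_pinv_mul_of_mul_projL_eq_zero h3
  have h4' := mul_pinv_mul_of_mul_projL_eq_zero h4
  have h5 : G * projL G' = 0 := by rw [← hG, Matrix.mul_assoc, mul_projL, Matrix.mul_zero]
  have h6 : projR H * H' = 0 := by rw [← hH, projR_mul_assoc]
  constructor
  · simp only [hX, Matrix.mul_add, Matrix.add_mul, Matrix.mul_assoc, mul_projL_assoc, projR_mul,
      mul_mul_assoc_of_eq h5, Matrix.zero_mul, Matrix.mul_zero, add_zero, h3', h1']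
  -- The first particular term contributes `G' G† L Q` to the second equation; the factor `L_G`
  -- makes the second term supply exactly what is missing without disturbing the first equation.
  · have h7 : G' * (projL G * (pinv G' * L')) = L' - G' * (pinv G * (L * Q)) := by
      rw [projL, ← hL]
      simp only [Matrix.mul_sub, Matrix.sub_mul, Matrix.one_mul, Matrix.mul_assoc, h2']
      rw [← mul_mul_assoc_of_eq hG, h2']
    have h8 : L * (pinv H * H') = L * Q := by
      rw [← hH, ← Matrix.mul_assoc (pinv H), mul_mul_assoc_of_eq h3']
    have h9 : G' * (projL G * (pinv G' * (L' * (pinv H' * H')))) =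
        L' - G' * (pinv G * (L * Q)) := by rw [h4', h7]
    simp only [hX, Matrix.mul_add, Matrix.add_mul, Matrix.mul_assoc, mul_projL_assoc, projR_mul,
      h6, Matrix.mul_zero, add_zero, h8, h9, add_sub_cancel]

/-- Completeness: the difference from a given solution satisfies both homogeneous equations, and it
splits along the projectors of `G'` on the left and `H` on the right. -/
theorem exists_params_of_common_solution {G : Matrix m n ℍ[ℝ]} {H : Matrix k l ℍ[ℝ]}
    {G' : Matrix p n ℍ[ℝ]} {H' : Matrix k q ℍ[ℝ]} {P : Matrix m p ℍ[ℝ]} {Q : Matrix l q ℍ[ℝ]}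
    (hG : P * G' = G) (hH : H * Q = H') {X X₀ : Matrix n k ℍ[ℝ]}
    (h1 : G * X * H = G * X₀ * H) (h2 : G' * X * H' = G' * X₀ * H') :
    ∃ V₁ V₂ V₃ : Matrix n k ℍ[ℝ],
      X = X₀ + projL G' * V₁ + V₂ * projR H + projL G * V₃ * projR H' := by
  obtain ⟨Z, rfl⟩ : ∃ Z, X = X₀ + Z := ⟨X - X₀, by abel⟩
  simp only [Matrix.mul_add, Matrix.add_mul, add_eq_left] at h1 h2
  -- Successive splitting: `Z = L_{G'} Z + G'† G' Z`, and then the second summand is split by `R_H`.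
  -- The last piece is killed by `G` on the left (`h3`) and by `H'` on the right (`h5`), because `G`
  -- factors through `G'` and `H'` through `H`; hence it equals its own `L_G · R_{H'}` part.
  refine ⟨Z, pinv G' * G' * Z, pinv G' * G' * Z * (H * pinv H), ?_⟩
  have h3 : pinv G * (G * (pinv G' * (G' * (Z * (H * pinv H))))) = 0 := by
    rw [← hG, Matrix.mul_assoc P, mul_pinv_mul_assoc, ← Matrix.mul_assoc Z,
      ← Matrix.mul_assoc G', ← Matrix.mul_assoc P, ← Matrix.mul_assoc G', ← Matrix.mul_assoc P,
      ← Matrix.mul_assoc P, hG, h1, Matrix.zero_mul, Matrix.mul_zero]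
  have h4 : H * (pinv H * H') = H' := by
    rw [← hH, mul_pinv_mul_assoc]
  have h5 : pinv G' * (G' * (Z * (H * (pinv H * (H' * pinv H'))))) = 0 := by
    rw [mul_mul_assoc_of_eq rfl (H' * pinv H'), ← Matrix.mul_assoc (H * pinv H),
      Matrix.mul_assoc H, h4, ← Matrix.mul_assoc Z, ← Matrix.mul_assoc G', ← Matrix.mul_assoc G', h2,
      Matrix.zero_mul, Matrix.mul_zero]
  simp only [projL, projR, Matrix.mul_sub, Matrix.sub_mul, Matrix.mul_one, Matrix.one_mul,
    Matrix.mul_assoc, h3, h5, Matrix.zero_mul]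
  abel

end CommonSolution

/-! ### The equation `A X B + C Y D = T` -/

section TwoTerms

variable {k l m n n' k' : Type*} [Fintype m] [Fintype n] [Fintype k] [Fintype l]
  [Fintype n'] [Fintype k'] [DecidableEq m] [DecidableEq n] [DecidableEq k] [DecidableEq l]
  [DecidableEq n'] [DecidableEq k']

/-- Every member of the parametric family solves `A X B + C Y D = T` when the four projector
conditions hold. -/
theorem two_term_solution {A : Matrix m n ℍ[ℝ]} {B : Matrix k l ℍ[ℝ]} {C : Matrix m n' ℍ[ℝ]}
    {D : Matrix k' l ℍ[ℝ]} {T : Matrix m l ℍ[ℝ]} {M : Matrix m n' ℍ[ℝ]} {N : Matrix k' l ℍ[ℝ]}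
    {S : Matrix m n' ℍ[ℝ]} (hM : M = projR A * C) (hN : N = D * projL B) (hS : S = C * projL M)
    (h1 : projR M * (projR A * T) = 0) (h2 : T * projL B * projL N = 0)
    (h3 : projR A * T * projL D = 0) (h4 : projR C * (T * projL B) = 0)
    (U Z : Matrix n k ℍ[ℝ]) (V W Z' : Matrix n' k' ℍ[ℝ]) {X : Matrix n k ℍ[ℝ]}
    {Y : Matrix n' k' ℍ[ℝ]}
    (hX : X = pinv A * T * pinv B - pinv A * C * pinv M * T * pinv B
      - pinv A * S * pinv C * T * pinv N * D * pinv B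
      - pinv A * S * V * projR N * D * pinv B + projL A * U + Z * projR B)
    (hY : Y = pinv M * T * pinv D + pinv S * S * pinv C * T * pinv N + projL M * projL S * W
      + Z' * projR D + projL M * V * projR N) :
    A * X * B + C * Y * D = T := by
  -- The absorption rules come from `M = R_A C`, `N = D L_B`, `S = C L_M`: the range of `M` lies in
  -- that of `R_A`, the row space of `N` in that of `L_B`, and `R_A S = M L_M = 0`, `R_N D L_B = R_N
  -- N = 0`.
  have hMA : pinv M * projR A = pinv M := pinv_mul_of_mul_eq (conjTranspose_projR A) (by
    rw [hM, ← Matrix.mul_assoc, projR_mul_projR])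
  have hNB : projL B * pinv N = pinv N := mul_pinv_of_mul_eq (conjTranspose_projL B) (by
    rw [hN, Matrix.mul_assoc, projL_mul_projL])
  have hAS : A * (pinv A * S) = S := mul_pinv_mul_of_projR_mul_eq_zero (by
    rw [hS, ← Matrix.mul_assoc, ← hM, mul_projL])
  have hCS : C * (pinv S * S) = S := by
    have : projL M * (pinv S * S) = pinv S * S := by
      rw [← Matrix.mul_assoc, mul_pinv_of_mul_eq (conjTranspose_projL M)
        (by rw [hS, Matrix.mul_assoc, projL_mul_projL])]
    rw [← this, ← Matrix.mul_assoc, ← hS, mul_pinv_mul]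
  have hND : projR N * (D * (pinv B * B)) = projR N * D :=
    mul_pinv_mul_of_mul_projL_eq_zero (A := B) (X := projR N * D)
      (by rw [Matrix.mul_assoc, ← hN, projR_mul]) ▸ by simp only [Matrix.mul_assoc]
  have f1 : M * (pinv M * T) = projR A * T := by
    rw [← hMA, Matrix.mul_assoc, mul_pinv_mul_of_projR_mul_eq_zero h1]
  have f2 : T * (pinv N * N) = T * projL B := by
    rw [← hNB, Matrix.mul_assoc, ← Matrix.mul_assoc T, mul_pinv_mul_of_mul_projL_eq_zero h2]
  have f3 : pinv M * (T * (pinv D * D)) = pinv M * T := by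
    rw [← hMA, Matrix.mul_assoc, ← Matrix.mul_assoc (projR A) T,
      mul_pinv_mul_of_mul_projL_eq_zero h3, Matrix.mul_assoc]
  have f4 := mul_pinv_mul_of_projR_mul_eq_zero h4
  have hSL : ∀ X : Matrix n' k' ℍ[ℝ], C * (projL M * (projL S * X)) = 0 := fun X => by
    rw [← Matrix.mul_assoc, ← hS, mul_projL_assoc]
  have hCL : ∀ X : Matrix n' l ℍ[ℝ], C * (projL M * X) = S * X := fun X => by
    rw [← Matrix.mul_assoc, ← hS]
  have hSS : ∀ X : Matrix n' l ℍ[ℝ], C * (pinv S * (S * X)) = S * X := fun X => by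
    rw [← Matrix.mul_assoc (pinv S), ← Matrix.mul_assoc, hCS]
  -- After simplification the free terms in `V` cancel between `gX` and `gY`. What remains is `T B†
  -- B` plus terms that combine, by `g1` to `g5`, to `T L_B`.
  have gY : C * Y * D = C * (pinv M * T) + S * (pinv C * (T * (pinv N * D)))
      + S * (V * (projR N * D)) := by
    simp only [hY, Matrix.mul_add, Matrix.add_mul, Matrix.mul_assoc, f3, projR_mul,
      Matrix.mul_zero, add_zero, hSL, hCL, hSS]
  have gX : A * X * B = A * (pinv A * (T * (pinv B * B)))
      - A * (pinv A * (C * (pinv M * (T * (pinv B * B)))))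
      - S * (pinv C * (T * (pinv N * (D * (pinv B * B))))) - S * (V * (projR N * D)) := by
    have hAS' : ∀ X : Matrix n' l ℍ[ℝ], A * (pinv A * (S * X)) = S * X := fun X => by
      rw [← Matrix.mul_assoc (pinv A), ← Matrix.mul_assoc, hAS]
    simp only [hX, Matrix.mul_add, Matrix.add_mul, Matrix.mul_sub, Matrix.sub_mul,
      Matrix.mul_assoc, projR_mul, Matrix.mul_zero, add_zero, mul_projL_assoc, hND, hAS']
  have g1 : A * (pinv A * (T * (pinv B * B))) - A * (pinv A * (C * (pinv M * (T * (pinv B * B)))))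
      = T * (pinv B * B) - C * (pinv M * (T * (pinv B * B))) := by
    have e1 : (C - A * (pinv A * C)) * (pinv M * (T * (pinv B * B)))
        = projR A * (T * (pinv B * B)) := by
      have hM' : C - A * (pinv A * C) = M := by
        rw [hM, projR, Matrix.sub_mul, Matrix.one_mul, Matrix.mul_assoc]
      rw [hM', ← Matrix.mul_assoc (pinv M), ← Matrix.mul_assoc M, f1, Matrix.mul_assoc]
    simp only [projR, Matrix.sub_mul, Matrix.one_mul, Matrix.mul_assoc] at e1
    linear_combination (norm := abel) e1
  have g2 : S * (pinv C * (T * (pinv N * D))) - S * (pinv C * (T * (pinv N * (D * (pinv B * B)))))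
      = S * (pinv C * (T * projL B)) := by
    rw [← f2, hN]
    simp only [projL, Matrix.mul_sub, Matrix.mul_one]
  have g3 : S * (pinv C * (T * projL B)) = T * projL B - C * (pinv M * (T * projL B)) := by
    have : M * (pinv C * (T * projL B)) = projR A * (T * projL B) := by
      rw [hM, Matrix.mul_assoc, f4]
    rw [hS, projL]
    simp only [Matrix.mul_sub, Matrix.sub_mul, Matrix.mul_one, Matrix.mul_assoc]
    rw [this, f4, mul_mul_assoc_of_eq hMA]
  have g4 : T * (pinv B * B) = T - T * projL B := by
    rw [projL, Matrix.mul_sub, Matrix.mul_one, sub_sub_cancel]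
  have g5 : C * (pinv M * (T * (pinv B * B))) = C * (pinv M * T) - C * (pinv M * (T * projL B)) := by
    rw [g4, Matrix.mul_sub, Matrix.mul_sub]
  rw [gX, gY]
  linear_combination (norm := abel) g1 + g2 + g3 + g4 - g5

/-- Completeness of the two-term family: the parameters are `X`, `Y` and their projections. -/
theorem exists_params_of_two_term_solution {A : Matrix m n ℍ[ℝ]} {B : Matrix k l ℍ[ℝ]}
    {C : Matrix m n' ℍ[ℝ]} {D : Matrix k' l ℍ[ℝ]} {T : Matrix m l ℍ[ℝ]} {M : Matrix m n' ℍ[ℝ]}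
    {N : Matrix k' l ℍ[ℝ]} {S : Matrix m n' ℍ[ℝ]} (hM : M = projR A * C) (hN : N = D * projL B)
    (hS : S = C * projL M) {X : Matrix n k ℍ[ℝ]} {Y : Matrix n' k' ℍ[ℝ]}
    (h : A * X * B + C * Y * D = T) :
    ∃ (U Z : Matrix n k ℍ[ℝ]) (V W Z' : Matrix n' k' ℍ[ℝ]),
      X = pinv A * T * pinv B - pinv A * C * pinv M * T * pinv B
        - pinv A * S * pinv C * T * pinv N * D * pinv B
        - pinv A * S * V * projR N * D * pinv B + projL A * U + Z * projR B ∧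
      Y = pinv M * T * pinv D + pinv S * S * pinv C * T * pinv N + projL M * projL S * W
        + Z' * projR D + projL M * V * projR N := by
  have hMA : pinv M * projR A = pinv M := pinv_mul_of_mul_eq (conjTranspose_projR A) (by
    rw [hM, ← Matrix.mul_assoc, projR_mul_projR])
  have hNB : projL B * pinv N = pinv N := mul_pinv_of_mul_eq (conjTranspose_projL B) (by
    rw [hN, Matrix.mul_assoc, projL_mul_projL])
  have hSLM : S * projL M = S := by rw [hS, Matrix.mul_assoc, projL_mul_projL]
  have hLS : projL M * pinv S = pinv S :=
    mul_pinv_of_mul_eq (conjTranspose_projL M) hSLM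
  have hSC : S * (pinv C * C) = S := by
    have hC : C * projL C = 0 := mul_projL C
    have h5 : M * projL C = 0 := by rw [hM, Matrix.mul_assoc, hC, Matrix.mul_zero]
    apply mul_pinv_mul_of_mul_projL_eq_zero
    rw [hS, Matrix.mul_assoc, projL_mul_of_mul_eq_zero h5, hC]
  -- In `M† T` and `T N†` the absorbed projectors `R_A` and `L_B` annihilate `A X B`, so both depend
  -- on `Y` alone.
  have f1 : pinv M * T = pinv M * (M * (Y * D)) := by
    rw [← hMA, Matrix.mul_assoc, Matrix.mul_assoc, ← h, Matrix.mul_add, Matrix.mul_assoc A,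
      projR_mul_assoc, zero_add, Matrix.mul_assoc C, mul_mul_assoc_of_eq hM.symm, hM,
      ← Matrix.mul_assoc (projR A), ← Matrix.mul_assoc (projR A) (projR A), projR_mul_projR]
  have f2 : T * pinv N = C * (Y * (N * pinv N)) := by
    rw [← hNB, ← Matrix.mul_assoc T, ← h, Matrix.add_mul, Matrix.mul_assoc _ B, mul_projL,
      Matrix.mul_zero, zero_add, Matrix.mul_assoc _ D, ← hN, hNB]
    simp only [Matrix.mul_assoc]
  have f3 : S * (pinv C * (T * pinv N)) = S * (Y * (N * pinv N)) := by
    rw [f2, ← Matrix.mul_assoc (pinv C), ← Matrix.mul_assoc S, hSC]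
  have hLS' : ∀ X : Matrix n' k' ℍ[ℝ], projL M * (projL S * X) =
      projL M * X - pinv S * (S * X) := fun X => by
    conv_lhs => rw [projL.eq_def S]
    rw [Matrix.sub_mul, Matrix.one_mul, Matrix.mul_sub, Matrix.mul_assoc, mul_mul_assoc_of_eq hLS]
  refine ⟨X, pinv A * A * X, Y, Y * (N * pinv N), pinv M * M * Y, ?_, ?_⟩
  -- The splitting `C = C M† M + S` separates the part of `C Y D` determined by `T`; subtracting it
  -- in `f6` isolates `A X B B†`.
  · have f4 : C * (Y * D) = C * (pinv M * T) + S * (Y * D) := by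
      rw [f1, hS, projL]
      simp only [Matrix.mul_sub, Matrix.sub_mul, Matrix.mul_one, Matrix.mul_assoc]
      abel
    have f5 : S * (pinv C * (T * (pinv N * (D * pinv B)))) =
        S * (Y * (N * (pinv N * (D * pinv B)))) := by
      have := congrArg (· * (D * pinv B)) f3
      simpa only [Matrix.mul_assoc] using this
    have f6 : A * (X * (B * pinv B)) = T * pinv B - C * (pinv M * (T * pinv B))
        - S * (Y * (D * pinv B)) := by
      have e1 := congrArg (· * pinv B) f4
      have e2 := congrArg (· * pinv B) h
      simp only [Matrix.mul_assoc, Matrix.add_mul] at e1 e2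
      linear_combination (norm := abel) e2 - e1
    have f7 := congrArg (pinv A * ·) f6
    simp only [Matrix.mul_sub] at f7
    simp only [Matrix.mul_assoc, f5]
    simp only [projL, projR, Matrix.mul_sub, Matrix.sub_mul, Matrix.mul_one, Matrix.one_mul,
      Matrix.mul_assoc, f7]
    abel
  · have f4 : pinv M * (T * pinv D) = pinv M * (M * (Y * (D * pinv D))) := by
      rw [← Matrix.mul_assoc, f1]
      simp only [Matrix.mul_assoc]
    simp only [Matrix.mul_assoc, f3, f4, hLS']
    simp only [projL, projR, Matrix.mul_sub, Matrix.sub_mul, Matrix.mul_one, Matrix.one_mul,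
      Matrix.mul_assoc]
    abel

/-- The projector conditions are necessary for `A X B + C Y D = T`. -/
theorem projector_conditions_of_two_term_solution {A : Matrix m n ℍ[ℝ]} {B : Matrix k l ℍ[ℝ]}
    {C : Matrix m n' ℍ[ℝ]} {D : Matrix k' l ℍ[ℝ]} {X : Matrix n k ℍ[ℝ]} {Y : Matrix n' k' ℍ[ℝ]}
    {T : Matrix m l ℍ[ℝ]} {M : Matrix m n' ℍ[ℝ]} {N : Matrix k' l ℍ[ℝ]}
    (hM : M = projR A * C) (hN : N = D * projL B) (h : A * X * B + C * Y * D = T) :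
    projR M * (projR A * T) = 0 ∧ T * projL B * projL N = 0 ∧
      projR A * T * projL D = 0 ∧ projR C * (T * projL B) = 0 := by
  subst h hM hN
  refine ⟨?_, ?_, ?_, ?_⟩
  · simp only [Matrix.mul_add, Matrix.mul_assoc, projR_mul_assoc, zero_add]
    rw [← Matrix.mul_assoc (projR A), projR_mul_assoc]
  · simp only [Matrix.add_mul, Matrix.mul_assoc, mul_projL_assoc, Matrix.mul_zero, zero_add]
    rw [← Matrix.mul_assoc D, mul_projL, Matrix.mul_zero, Matrix.mul_zero]
  · simp only [Matrix.mul_add, Matrix.mul_assoc, projR_mul_assoc, mul_projL,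
      Matrix.mul_zero, zero_add]
  · simp only [Matrix.add_mul, Matrix.mul_assoc, projR_mul_assoc, mul_projL,
      Matrix.mul_zero, zero_add]

end TwoTerms

/-! ### The pair of equations `A X = C`, `X B = D`, and block products -/

section LeftRight

variable {k l m n : Type*} [Fintype m] [Fintype n] [Fintype k] [Fintype l]
  [DecidableEq m] [DecidableEq n] [DecidableEq k] [DecidableEq l]

/-- The family of common solutions of `A X = C` and `X B = D`. -/
theorem left_right_solution {A : Matrix m n ℍ[ℝ]} {B : Matrix k l ℍ[ℝ]} {C : Matrix m k ℍ[ℝ]}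
    {D : Matrix n l ℍ[ℝ]} (h : A * D = C * B) (hC : projR A * C = 0) (hD : D * projL B = 0)
    (U : Matrix n k ℍ[ℝ]) {X : Matrix n k ℍ[ℝ]}
    (hX : X = pinv A * C + projL A * D * pinv B + projL A * U * projR B) :
    A * X = C ∧ X * B = D := by
  constructor
  · simp only [hX, Matrix.mul_add, Matrix.mul_assoc, mul_projL_assoc, add_zero,
      mul_pinv_mul_of_projR_mul_eq_zero hC]
  · simp only [hX, Matrix.add_mul, Matrix.mul_assoc, projR_mul, Matrix.mul_zero, add_zero, ← h,
      mul_pinv_mul_of_mul_projL_eq_zero hD]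
    simp only [projL, Matrix.sub_mul, Matrix.one_mul, Matrix.mul_assoc]
    abel

/-- A solution can serve as its own free parameter, which is why the parameters `U₁`, `U₂`, `U₃` may
later be taken equal to `X`, `Y`, `Z`. -/
theorem eq_add_of_left_right_solution {A : Matrix m n ℍ[ℝ]} {B : Matrix k l ℍ[ℝ]}
    {C : Matrix m k ℍ[ℝ]} {D : Matrix n l ℍ[ℝ]} {X : Matrix n k ℍ[ℝ]} (hC : A * X = C)
    (hD : X * B = D) : X = pinv A * C + projL A * D * pinv B + projL A * X * projR B := by
  subst hC hD
  simp only [projL, projR, Matrix.sub_mul, Matrix.one_mul, Matrix.mul_assoc, Matrix.mul_sub,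
    Matrix.mul_one]
  abel

end LeftRight

section Blocks

variable {k m n n' : Type*} [Fintype m] [Fintype n] [Fintype n'] [DecidableEq n] [DecidableEq n']

theorem fromCols_mul_eq (A : Matrix m n ℍ[ℝ]) (B : Matrix m n' ℍ[ℝ])
    (X : Matrix (n ⊕ n') k ℍ[ℝ]) :
    (A ◫ B) * X = A * ((1 ◫ 0 : Matrix n (n ⊕ n') ℍ[ℝ]) * X)
      + B * ((0 ◫ 1 : Matrix n' (n ⊕ n') ℍ[ℝ]) * X) := by
  rw [← Matrix.mul_assoc, ← Matrix.mul_assoc, ← Matrix.add_mul]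
  congr 1
  ext i (j | j) <;> simp [Matrix.mul_fromCols]

theorem mul_fromRows_eq (A : Matrix n m ℍ[ℝ]) (B : Matrix n' m ℍ[ℝ])
    (Y : Matrix k (n ⊕ n') ℍ[ℝ]) :
    Y * (A ⊟ B) = Y * (1 ⊟ 0 : Matrix (n ⊕ n') n ℍ[ℝ]) * A
      + Y * (0 ⊟ 1 : Matrix (n ⊕ n') n' ℍ[ℝ]) * B := by
  rw [Matrix.mul_assoc, Matrix.mul_assoc, ← Matrix.mul_add]
  congr 1
  ext (i | i) j <;> simp [Matrix.fromRows_mul]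

end Blocks

/-! ### Reduction of the system and its general solution -/

namespace Coeffs

variable {d : Sizes} {K : Coeffs d}

/-- This and the next five identities are the nesting hypotheses of `common_solution` for the index
pairs (1, 2) and (3, 4). -/
theorem projR_M₁_mul_G₂ : projR K.M₁ * K.G₂ = K.G₁ := by
  simp only [G₁, G₂, G, Matrix.mul_assoc]

theorem H₁_mul_projL : K.H₁ * projL K.B₃₁ = K.H₂ := rfl

theorem projR_M₁_mul_L₂ : projR K.M₁ * K.L₂ = K.L₁ * projL K.B₃₁ := by
  simp only [L₁, L₂, G, Matrix.mul_assoc]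

theorem projR_A₁₃_mul_G₄ : projR K.A₁₃ * K.G₄ = K.G₃ := rfl

theorem H₃_mul_projL : K.H₃ * projL K.N₁ = K.H₄ := by
  simp only [H₃, H₄, H, Matrix.mul_assoc]

theorem projR_A₁₃_mul_L₄ : projR K.A₁₃ * K.L₄ = K.L₃ * projL K.N₁ := by
  simp only [L₃, L₄, H, Matrix.mul_assoc]

theorem G_mul_A₁₃ : K.G * K.A₁₃ = 0 := by
  rw [G, Matrix.mul_assoc, ← M₁, projR_mul]

theorem B₃₁_mul_H : K.B₃₁ * K.H = 0 := by
  rw [H, ← Matrix.mul_assoc, ← N₁, mul_projL]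

theorem G_mul_projR : K.G * projR K.A₁₃ = K.G := mul_projR_of_mul_eq_zero G_mul_A₁₃

theorem projL_mul_H : projL K.B₃₁ * K.H = K.H := projL_mul_of_mul_eq_zero B₃₁_mul_H

/-- Only four of the projector conditions are assumed, because this fact is also needed to derive
the final condition from the rank conditions. -/
theorem F₃₃_spec (hR₁ : projR K.G₁ * K.L₁ = 0) (hR₂ : projR K.G₂ * K.L₂ = 0)
    (hL₁ : K.L₁ * projL K.H₁ = 0) (hL₂ : K.L₂ * projL K.H₂ = 0) :
    K.G₁ * K.F₃₃ * K.H₁ = K.L₁ ∧ K.G₂ * K.F₃₃ * K.H₂ = K.L₂ :=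
  common_solution projR_M₁_mul_G₂ H₁_mul_projL projR_M₁_mul_L₂ hR₁ hR₂ hL₁ hL₂ 0 0 0
    (by simp [F₃₃])

theorem F₄₄_spec (hR₃ : projR K.G₃ * K.L₃ = 0) (hR₄ : projR K.G₄ * K.L₄ = 0)
    (hL₃ : K.L₃ * projL K.H₃ = 0) (hL₄ : K.L₄ * projL K.H₄ = 0) :
    K.G₃ * K.F₄₄ * K.H₃ = K.L₃ ∧ K.G₄ * K.F₄₄ * K.H₄ = K.L₄ :=
  common_solution projR_A₁₃_mul_G₄ H₃_mul_projL projR_A₁₃_mul_L₄ hR₃ hR₄ hL₃ hL₄ 0 0 0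
    (by simp [F₄₄])

theorem ProjectorConditions.F₃₃_spec (hK : K.ProjectorConditions) :
    K.G₁ * K.F₃₃ * K.H₁ = K.L₁ ∧ K.G₂ * K.F₃₃ * K.H₂ = K.L₂ :=
  Coeffs.F₃₃_spec hK.RL₁ hK.RL₂ hK.LL₁ hK.LL₂

theorem ProjectorConditions.F₄₄_spec (hK : K.ProjectorConditions) :
    K.G₃ * K.F₄₄ * K.H₃ = K.L₃ ∧ K.G₄ * K.F₄₄ * K.H₄ = K.L₄ :=
  Coeffs.F₄₄_spec hK.RL₃ hK.RL₄ hK.LL₃ hK.LL₄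

theorem U₃_spec (hK : K.ProjectorConditions) (P : Params d) :
    K.G₁ * K.U₃ P * K.H₁ = K.L₁ ∧ K.G₂ * K.U₃ P * K.H₂ = K.L₂ :=
  common_solution projR_M₁_mul_G₂ H₁_mul_projL projR_M₁_mul_L₂ hK.RL₁ hK.RL₂ hK.LL₁ hK.LL₂
    _ _ _ rfl

theorem U₃'_spec (hK : K.ProjectorConditions) (P : Params d) :
    K.G₃ * K.U₃' P * K.H₃ = K.L₃ ∧ K.G₄ * K.U₃' P * K.H₄ = K.L₄ :=
  common_solution projR_A₁₃_mul_G₄ H₃_mul_projL projR_A₁₃_mul_L₄ hK.RL₃ hK.RL₄ hK.LL₃ hK.LL₄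
    (-K.W₁ P) (-K.W₂ P) (-K.W₃ P)
    (by simp only [U₃', F₄₄, Matrix.mul_neg, Matrix.neg_mul, sub_eq_add_neg])

theorem mul_projL_of_mul_C₁₁ {k : Type*} {X : Matrix k (Fin d.n₄) ℍ[ℝ]} (h : X * K.C₁₁ = 0) :
    X * projL K.G₂ = 0 ∧ X * projL K.G₄ = 0 := by
  rw [C₁₁, Matrix.mul_fromCols, ← Matrix.fromCols_zero, Matrix.fromCols_inj.eq_iff] at h
  exact h

theorem projR_mul_of_D₁₁_mul {k : Type*} {Y : Matrix (Fin d.s₄) k ℍ[ℝ]} (h : K.D₁₁ * Y = 0) :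
    projR K.H₁ * Y = 0 ∧ projR K.H₃ * Y = 0 := by
  rw [D₁₁, Matrix.fromRows_mul, ← Matrix.fromRows_zero, Matrix.fromRows_inj.eq_iff] at h
  exact h

/-- `G₁ · H₃` factors through both `G₁ · H₁` and `G₃ · H₃`, so `F₃₃` and `F₄₄` produce the same
value `G T₂ L_{B₂₁}`. The next lemma does the same for `G₂ · H₄`. -/
theorem G₁_mul_F_mul_H₃ (hK : K.ProjectorConditions) : K.G₁ * K.F * K.H₃ = 0 := by
  have h1 : K.G₁ * K.F₃₃ * K.H₃ = K.G * K.T₂ * projL K.B₂₁ := by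
    rw [H₃, ← H₁, ← Matrix.mul_assoc, hK.F₃₃_spec.1, L₁]
  have h2 : K.G₁ * K.F₄₄ * K.H₃ = K.G * K.T₂ * projL K.B₂₁ := by
    have : K.G₁ = K.G * K.G₃ := by rw [G₃, ← Matrix.mul_assoc, G_mul_projR, G₁]
    rw [this, Matrix.mul_assoc, Matrix.mul_assoc, ← Matrix.mul_assoc K.G₃, hK.F₄₄_spec.1, L₃,
      Matrix.mul_assoc (projR _), ← Matrix.mul_assoc, G_mul_projR, Matrix.mul_assoc]
  rw [F, Matrix.mul_sub, Matrix.sub_mul, h1, h2, sub_self]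

theorem G₂_mul_F_mul_H₄ (hK : K.ProjectorConditions) : K.G₂ * K.F * K.H₄ = 0 := by
  have h1 : K.G₂ * K.F₃₃ * K.H₄ = projR K.A₁₂ * K.T₂ * K.H := by
    have : K.H₄ = K.H₂ * K.H := by rw [H₂, Matrix.mul_assoc, projL_mul_H, H₄]
    rw [this, ← Matrix.mul_assoc, hK.F₃₃_spec.2, L₂, Matrix.mul_assoc, projL_mul_H]
  have h2 : K.G₂ * K.F₄₄ * K.H₄ = projR K.A₁₂ * K.T₂ * K.H := by
    rw [G₂, ← G₄, Matrix.mul_assoc, Matrix.mul_assoc, ← Matrix.mul_assoc K.G₄, hK.F₄₄_spec.2, L₄,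
      Matrix.mul_assoc]
  rw [F, Matrix.mul_sub, Matrix.sub_mul, h1, h2, sub_self]

/-- `X L_G = 0` means that `X` factors through `G` on the right, and `R_H Y = 0` that `Y` factors
through `H` on the left, so `G F H` appears inside `X F Y`. -/
theorem mul_mul_eq_zero_of_projections {k l m n p q : Type*} [Fintype m] [Fintype n] [Fintype p]
    [Fintype q] [DecidableEq n] [DecidableEq p] {G : Matrix m n ℍ[ℝ]} {F : Matrix n p ℍ[ℝ]}
    {H : Matrix p q ℍ[ℝ]} (h : G * F * H = 0) {X : Matrix k n ℍ[ℝ]} {Y : Matrix p l ℍ[ℝ]}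
    (hX : X * projL G = 0) (hY : projR H * Y = 0) : X * F * Y = 0 := by
  rw [← mul_pinv_mul_of_mul_projL_eq_zero hX, ← mul_pinv_mul_of_projR_mul_eq_zero hY,
    ← Matrix.mul_assoc X, Matrix.mul_assoc (X * pinv G), Matrix.mul_assoc (X * pinv G),
    ← Matrix.mul_assoc (G * F), h, Matrix.zero_mul, Matrix.mul_zero]

/-- Three of the four solvability conditions for `E₁₁ V₃ E₃₃ + E₂₂ W₃ E₄₄ = E` are automatic: the
first and third follow from `G₁ F H₃ = 0`, the second from `G₂ F H₄ = 0`. The projectors built from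
`C₁₁` and `D₁₁` supply the required factorizations. -/
theorem E_conditions (hK : K.ProjectorConditions) :
    projR K.M * (projR K.E₁₁ * K.E) = 0 ∧ K.E * projL K.E₃₃ * projL K.N = 0 ∧
      projR K.E₁₁ * K.E * projL K.E₄₄ = 0 := by
  have hR : projR K.E₁₁ * projR K.C₁₁ * projL K.G₁ = 0 := by
    rw [Matrix.mul_assoc, ← C₂₂, ← E₁₁, projR_mul]
  have hY : K.D₁₁ * projL K.D₁₁ = 0 := mul_projL _
  have hY' : K.D₁₁ * (projL K.D₁₁ * projL K.E₄₄) = 0 := mul_projL_assoc _ _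
  have hX : projR K.C₁₁ * K.C₁₁ = 0 := projR_mul _
  have hN : projR K.H₄ * (projL K.D₁₁ * projL K.E₃₃ * projL K.N) = 0 := by
    rw [← D₃₃, ← Matrix.mul_assoc, ← Matrix.mul_assoc, ← E₄₄, ← N, mul_projL]
  refine ⟨?_, ?_, ?_⟩
  · have := mul_mul_eq_zero_of_projections (G₁_mul_F_mul_H₃ hK)
      (X := projR K.M * (projR K.E₁₁ * projR K.C₁₁)) (by rw [Matrix.mul_assoc, hR, Matrix.mul_zero])
      (projR_mul_of_D₁₁_mul hY).2
    simpa only [E, Matrix.mul_assoc] using this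
  · have := mul_mul_eq_zero_of_projections (G₂_mul_F_mul_H₄ hK) (mul_projL_of_mul_C₁₁ hX).1 hN
    simpa only [E, Matrix.mul_assoc] using this
  · have := mul_mul_eq_zero_of_projections (G₁_mul_F_mul_H₃ hK) hR (projR_mul_of_D₁₁_mul hY').2
    simpa only [E, Matrix.mul_assoc] using this

theorem projR_C₁₁_mul_E₁₁ : projR K.C₁₁ * K.E₁₁ = K.E₁₁ := by
  rw [E₁₁, ← Matrix.mul_assoc, projR_mul_projR]

theorem projR_C₁₁_mul_E₂₂ : projR K.C₁₁ * K.E₂₂ = K.E₂₂ := by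
  rw [E₂₂, ← Matrix.mul_assoc, projR_mul_projR]

theorem projR_C₁₁_mul_M : projR K.C₁₁ * K.M = K.M := by
  rw [M, projR.eq_def K.E₁₁, Matrix.sub_mul, Matrix.mul_sub, Matrix.one_mul, projR_C₁₁_mul_E₂₂,
    Matrix.mul_assoc, ← Matrix.mul_assoc (projR K.C₁₁), projR_C₁₁_mul_E₁₁]

theorem E₃₃_mul_projL_D₁₁ : K.E₃₃ * projL K.D₁₁ = K.E₃₃ := by
  rw [E₃₃, Matrix.mul_assoc, projL_mul_projL]

theorem E₄₄_mul_projL_D₁₁ : K.E₄₄ * projL K.D₁₁ = K.E₄₄ := by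
  rw [E₄₄, Matrix.mul_assoc, projL_mul_projL]

theorem N_mul_projL_D₁₁ : K.N * projL K.D₁₁ = K.N := by
  rw [N, projL.eq_def K.E₃₃, Matrix.mul_sub K.E₄₄, Matrix.sub_mul, Matrix.mul_one, E₄₄_mul_projL_D₁₁,
    ← Matrix.mul_assoc, Matrix.mul_assoc _ K.E₃₃, E₃₃_mul_projL_D₁₁]

/-- The formulas for `V₃` and `W₃` contain `F`, whereas the two-term equation has right side `E =
R_{C₁₁} F L_{D₁₁}`; the adjacent pseudoinverses absorb both projectors. -/
theorem pinv_mul_F_mul_pinv {A : Matrix (Fin d.n₄) (Fin d.n₄) ℍ[ℝ]}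
    {B : Matrix (Fin d.s₄) (Fin d.s₄) ℍ[ℝ]} (hA : projR K.C₁₁ * A = A)
    (hB : B * projL K.D₁₁ = B) : pinv A * K.F * pinv B = pinv A * K.E * pinv B := by
  conv_lhs => rw [← pinv_mul_of_mul_eq (conjTranspose_projR K.C₁₁) hA,
    ← mul_pinv_of_mul_eq (conjTranspose_projL K.D₁₁) hB]
  simp only [E, Matrix.mul_assoc]

theorem V₃_eq (P : Params d) : K.V₃ P =
    pinv K.E₁₁ * K.E * pinv K.E₃₃ - pinv K.E₁₁ * K.E₂₂ * pinv K.M * K.E * pinv K.E₃₃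
    - pinv K.E₁₁ * K.S * pinv K.E₂₂ * K.E * pinv K.N * K.E₄₄ * pinv K.E₃₃
    - pinv K.E₁₁ * K.S * P.U₃₁ * projR K.N * K.E₄₄ * pinv K.E₃₃
    + projL K.E₁₁ * P.U₃₂ + P.U₃₃ * projR K.E₃₃ := by
  have h1 := pinv_mul_F_mul_pinv projR_C₁₁_mul_E₁₁ (K := K) E₃₃_mul_projL_D₁₁
  have h2 := pinv_mul_F_mul_pinv projR_C₁₁_mul_M (K := K) E₃₃_mul_projL_D₁₁
  have h3 := pinv_mul_F_mul_pinv projR_C₁₁_mul_E₂₂ (K := K) N_mul_projL_D₁₁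
  rw [V₃, h1, Matrix.mul_assoc _ (pinv K.M) K.F, Matrix.mul_assoc _ (pinv K.M * K.F), h2,
    Matrix.mul_assoc _ (pinv K.E₂₂) K.F, Matrix.mul_assoc _ (pinv K.E₂₂ * K.F), h3]
  simp only [Matrix.mul_assoc]

theorem W₃_eq (P : Params d) : K.W₃ P =
    pinv K.M * K.E * pinv K.E₄₄ + pinv K.S * K.S * pinv K.E₂₂ * K.E * pinv K.N
    + projL K.M * projL K.S * P.U₄₁ + P.U₄₂ * projR K.E₄₄ + projL K.M * P.U₃₁ * projR K.N := by
  have h2 := pinv_mul_F_mul_pinv projR_C₁₁_mul_M (K := K) E₄₄_mul_projL_D₁₁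
  have h3 := pinv_mul_F_mul_pinv projR_C₁₁_mul_E₂₂ (K := K) N_mul_projL_D₁₁
  rw [W₃, h2, Matrix.mul_assoc _ (pinv K.E₂₂) K.F, Matrix.mul_assoc _ (pinv K.E₂₂ * K.F), h3,
    add_right_comm _ (projL K.M * P.U₃₁ * projR K.N)]
  simp only [Matrix.mul_assoc]

/-- This turns the solvability condition of the one-term equation with coefficients `C₁₁`, `D₁₁`
into the two-term equation for `V₃` and `W₃`. -/
theorem projR_C₁₁_mul_Q_mul_projL (X Y : Matrix (Fin d.n₄) (Fin d.s₄) ℍ[ℝ]) :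
    projR K.C₁₁ * (K.F - K.C₂₂ * X * K.D₂₂ - K.C₃₃ * Y * K.D₃₃) * projL K.D₁₁ =
      K.E - (K.E₁₁ * X * K.E₃₃ + K.E₂₂ * Y * K.E₄₄) := by
  simp only [E, E₁₁, E₂₂, E₃₃, E₄₄, Matrix.mul_sub, Matrix.sub_mul, Matrix.mul_assoc,
    Matrix.add_mul, Matrix.mul_add, sub_sub]

/-- Equality of the two expressions is the equation `C₁₁ (V₁; W₁) + (V₂, W₂) D₁₁ = Q` written in
blocks. Its condition is the two-term equation `hE`, solved by the chosen `V₃` and `W₃`. -/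
theorem U₃_eq_U₃' (hK : K.ProjectorConditions) (P : Params d) : K.U₃ P = K.U₃' P := by
  obtain ⟨h1, h2, h3⟩ := E_conditions hK
  have hE : K.E₁₁ * K.V₃ P * K.E₃₃ + K.E₂₂ * K.W₃ P * K.E₄₄ = K.E :=
    two_term_solution rfl rfl rfl h1 h2 h3 (by rw [← Matrix.mul_assoc]; exact hK.final) _ _ _ _ _
      (V₃_eq P) (W₃_eq P)
  have hQ := mul_add_mul_eq_of_projR_mul_projL (A := K.C₁₁) (B := K.D₁₁) (T := K.Q P)
    (by rw [Q, projR_C₁₁_mul_Q_mul_projL, hE, sub_self]) P.U₁₁ P.U₁₂ P.U₂₁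
  have e1 := fromCols_mul_eq (projL K.G₂) (projL K.G₄)
    (pinv K.C₁₁ * K.Q P - pinv K.C₁₁ * P.U₁₁ * K.D₁₁ + projL K.C₁₁ * P.U₁₂)
  have e2 := mul_fromRows_eq (projR K.H₁) (projR K.H₃)
    (projR K.C₁₁ * K.Q P * pinv K.D₁₁ + K.C₁₁ * pinv K.C₁₁ * P.U₁₁ + P.U₂₁ * projR K.D₁₁)
  have hQ' : projL K.G₂ * K.V₁ P + projL K.G₄ * K.W₁ P
      + (K.V₂ P * projR K.H₁ + K.W₂ P * projR K.H₃) = K.Q P := by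
    refine Eq.trans ?_ ((congrArg₂ (· + ·) e1 e2).symm.trans hQ)
    simp only [V₁, W₁, V₂, W₂, ← Matrix.mul_sub, ← Matrix.add_mul, ← sub_add, ← add_assoc]
  rw [Q, F, C₂₂, C₃₃, D₂₂, D₃₃] at hQ'
  rw [U₃, U₃']
  linear_combination (norm := abel) hQ'

theorem blocks_of_fromRows_eq {k m n : Type*} [Fintype m] [Fintype n] [DecidableEq m]
    [DecidableEq n] {A : Matrix m k ℍ[ℝ]} {B : Matrix n k ℍ[ℝ]} {X : Matrix (m ⊕ n) k ℍ[ℝ]}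
    (h : A ⊟ B = X) :
    A = (1 ◫ 0 : Matrix m (m ⊕ n) ℍ[ℝ]) * X ∧ B = (0 ◫ 1 : Matrix n (m ⊕ n) ℍ[ℝ]) * X := by
  subst h
  simp [Matrix.fromCols_mul_fromRows]

theorem blocks_of_fromCols_eq {k m n : Type*} [Fintype m] [Fintype n] [DecidableEq m]
    [DecidableEq n] {A : Matrix k m ℍ[ℝ]} {B : Matrix k n ℍ[ℝ]} {X : Matrix k (m ⊕ n) ℍ[ℝ]}
    (h : A ◫ B = X) :
    A = X * (1 ⊟ 0 : Matrix (m ⊕ n) m ℍ[ℝ]) ∧ B = X * (0 ⊟ 1 : Matrix (m ⊕ n) n ℍ[ℝ]) := by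
  subst h
  simp [Matrix.fromCols_mul_fromRows]

variable {U : Matrix (Fin d.n₁) (Fin d.q) ℍ[ℝ]} {V : Matrix (Fin d.p) (Fin d.s₁) ℍ[ℝ]}
  {X : Matrix (Fin d.n₂) (Fin d.s₂) ℍ[ℝ]} {Y : Matrix (Fin d.n₃) (Fin d.s₃) ℍ[ℝ]}
  {Z : Matrix (Fin d.n₄) (Fin d.s₄) ℍ[ℝ]}

theorem mul_mul_eq_add {p m n k l q : Type*} [Fintype m] [Fintype n] [Fintype k] [Fintype l]
    [DecidableEq m] [DecidableEq n] [DecidableEq k] [DecidableEq l] (E : Matrix p n ℍ[ℝ]) (F : Matrix k q ℍ[ℝ])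
    {A : Matrix m n ℍ[ℝ]} {B : Matrix k l ℍ[ℝ]} {C : Matrix m k ℍ[ℝ]} {D : Matrix n l ℍ[ℝ]}
    {X : Matrix n k ℍ[ℝ]} (hC : A * X = C) (hD : X * B = D) :
    E * X * F = E * (pinv A * C + projL A * D * pinv B) * F
      + E * projL A * X * (projR B * F) := by
  conv_lhs => rw [eq_add_of_left_right_solution hC hD]
  simp only [Matrix.mul_add, Matrix.add_mul, Matrix.mul_assoc]

theorem eq_pinv_mul_add {m n k : Type*} [Fintype m] [Fintype n] [DecidableEq n]
    {A : Matrix m n ℍ[ℝ]} {C : Matrix m k ℍ[ℝ]} {U : Matrix n k ℍ[ℝ]} (h : A * U = C) :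
    U = pinv A * C + projL A * U := by
  subst h
  simp only [projL, Matrix.sub_mul, Matrix.one_mul, Matrix.mul_assoc, add_sub_cancel]

theorem eq_mul_pinv_add {k n m : Type*} [Fintype m] [Fintype n] [DecidableEq n]
    {B : Matrix n m ℍ[ℝ]} {D : Matrix k m ℍ[ℝ]} {V : Matrix k n ℍ[ℝ]} (h : V * B = D) :
    V = D * pinv B + V * projR B := by
  subst h
  simp only [projR, Matrix.mul_sub, Matrix.mul_one, Matrix.mul_assoc, add_sub_cancel]

/-- Each unknown is its particular solution plus its own projection; the particular parts go into
`T₁` and the projectors into the coefficients `A_ii`, `B_ii`. -/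
theorem main_equation_iff (hU : K.A₁ * U = K.C₁) (hV : V * K.B₁ = K.D₁)
    (hX : K.A₂ * X = K.C₂) (hX' : X * K.B₂ = K.D₂) (hY : K.A₃ * Y = K.C₃)
    (hY' : Y * K.B₃ = K.D₃) (hZ : K.A₄ * Z = K.C₄) (hZ' : Z * K.B₄ = K.D₄) :
    K.E₁ * U + V * K.F₁ + K.E₂ * X * K.F₂ + K.E₃ * Y * K.F₃ + K.E₄ * Z * K.F₄ = K.Cc ↔
      K.A₁₁ * U + V * K.B₁₁ =
        K.T₁ - K.A₂₂ * X * K.B₂₂ - K.A₃₃ * Y * K.B₃₃ - K.A₄₄ * Z * K.B₄₄ := by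
  have e1 : K.E₁ * U = K.E₁ * pinv K.A₁ * K.C₁ + K.A₁₁ * U := by
    conv_lhs => rw [eq_pinv_mul_add hU]
    simp only [A₁₁, Matrix.mul_add, Matrix.mul_assoc]
  have e2 : V * K.F₁ = K.D₁ * pinv K.B₁ * K.F₁ + V * K.B₁₁ := by
    conv_lhs => rw [eq_mul_pinv_add hV]
    simp only [B₁₁, Matrix.add_mul, Matrix.mul_assoc]
  rw [mul_mul_eq_add K.E₂ K.F₂ hX hX', mul_mul_eq_add K.E₃ K.F₃ hY hY',
    mul_mul_eq_add K.E₄ K.F₄ hZ hZ', e1, e2, T₁, A₂₂, A₃₃, A₄₄, B₂₂, B₃₃, B₄₄]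
  constructor <;> intro h <;> linear_combination (norm := abel) h

/-- Multiplication by `R_{A₁₁}` on the left and `L_{B₁₁}` on the right eliminates `U` and `V`. -/
theorem T₂_eq (h : K.A₁₁ * U + V * K.B₁₁ =
    K.T₁ - K.A₂₂ * X * K.B₂₂ - K.A₃₃ * Y * K.B₃₃ - K.A₄₄ * Z * K.B₄₄) :
    K.A₁₂ * X * K.B₂₁ + K.A₁₃ * Y * K.B₃₁ + K.A₁₄ * Z * K.B₄₁ = K.T₂ := by
  have h1 := congrArg (fun W => projR K.A₁₁ * W * projL K.B₁₁) h
  simp only [Matrix.mul_add, Matrix.add_mul, Matrix.mul_sub, Matrix.sub_mul, Matrix.mul_assoc,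
    projR_mul_assoc, mul_projL, Matrix.mul_zero, Matrix.zero_mul, add_zero] at h1
  simp only [T₂, A₁₂, A₁₃, A₁₄, B₂₁, B₃₁, B₄₁, Matrix.mul_assoc]
  linear_combination (norm := abel) h1

/-- This and the next three lemmas translate the two-term conditions for `T = T₂ - A₁₄ u B₄₁` into
the four equations on `u`; this is the origin of the `G_i`, `H_i`, `L_i`. -/
theorem projR_M₁_mul_T_iff {u : Matrix (Fin d.n₄) (Fin d.s₄) ℍ[ℝ]} :
    projR K.M₁ * (projR K.A₁₂ * K.T u) = 0 ↔ K.G₁ * u * K.H₁ = K.L₁ := by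
  rw [T, G₁, H₁, L₁, G, Matrix.mul_sub, Matrix.mul_sub, sub_eq_zero, eq_comm]
  simp only [Matrix.mul_assoc]

theorem projR_A₁₂_mul_T_mul_projL_iff {u : Matrix (Fin d.n₄) (Fin d.s₄) ℍ[ℝ]} :
    projR K.A₁₂ * K.T u * projL K.B₃₁ = 0 ↔ K.G₂ * u * K.H₂ = K.L₂ := by
  rw [T, G₂, H₂, L₂, Matrix.mul_sub, Matrix.sub_mul, sub_eq_zero, eq_comm]
  simp only [Matrix.mul_assoc]

theorem projR_A₁₃_mul_T_mul_projL_iff {u : Matrix (Fin d.n₄) (Fin d.s₄) ℍ[ℝ]} :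
    projR K.A₁₃ * (K.T u * projL K.B₂₁) = 0 ↔ K.G₃ * u * K.H₃ = K.L₃ := by
  rw [T, G₃, H₃, L₃, Matrix.sub_mul, Matrix.mul_sub, sub_eq_zero, eq_comm]
  simp only [Matrix.mul_assoc]

theorem T_mul_projL_iff {u : Matrix (Fin d.n₄) (Fin d.s₄) ℍ[ℝ]} :
    K.T u * projL K.B₂₁ * projL K.N₁ = 0 ↔ K.G₄ * u * K.H₄ = K.L₄ := by
  rw [T, G₄, H₄, L₄, H, Matrix.sub_mul, Matrix.sub_mul, sub_eq_zero, eq_comm]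
  simp only [Matrix.mul_assoc]

theorem G_mul_mul_H_eq (h : K.A₁₂ * X * K.B₂₁ + K.A₁₃ * Y * K.B₃₁ + K.A₁₄ * Z * K.B₄₁ = K.T₂) :
    (K.G₁ * Z * K.H₁ = K.L₁ ∧ K.G₂ * Z * K.H₂ = K.L₂) ∧
      K.G₃ * Z * K.H₃ = K.L₃ ∧ K.G₄ * Z * K.H₄ = K.L₄ := by
  have hT : K.A₁₂ * X * K.B₂₁ + K.A₁₃ * Y * K.B₃₁ = K.T Z := by
    rw [T, ← h]; abel
  obtain ⟨h1, h2, h3, h4⟩ :=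
    projector_conditions_of_two_term_solution (M := K.M₁) (N := K.N₁) rfl rfl hT
  exact ⟨⟨projR_M₁_mul_T_iff.1 h1, projR_A₁₂_mul_T_mul_projL_iff.1 h3⟩,
    projR_A₁₃_mul_T_mul_projL_iff.1 h4, T_mul_projL_iff.1 h2⟩

/-- A `Z` satisfying all four equations lies in both common-solution families, and comparing the two
representations recovers the parameters. The conclusion fixes only the parameters that enter `U₃`,
so that the others remain free for `U`, `V`, `X`, `Y`. -/
theorem exists_params_U₃ (hK : K.ProjectorConditions)
    (h : (K.G₁ * Z * K.H₁ = K.L₁ ∧ K.G₂ * Z * K.H₂ = K.L₂) ∧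
      K.G₃ * Z * K.H₃ = K.L₃ ∧ K.G₄ * Z * K.H₄ = K.L₄) :
    ∃ U₁₁ U₁₂ U₂₁ U₃₁ U₃₂ U₃₃ U₄₁ U₄₂, ∀ P : Params d, P.U₁₁ = U₁₁ → P.U₁₂ = U₁₂ → P.U₂₁ = U₂₁ →
      P.U₃₁ = U₃₁ → P.U₃₂ = U₃₂ → P.U₃₃ = U₃₃ → P.U₄₁ = U₄₁ → P.U₄₂ = U₄₂ → K.U₃ P = Z := by
  obtain ⟨⟨h₁, h₂⟩, h₃, h₄⟩ := h
  obtain ⟨V₁, V₂, V₃, hV⟩ := exists_params_of_common_solution projR_M₁_mul_G₂ H₁_mul_projL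
    (h₁.trans hK.F₃₃_spec.1.symm) (h₂.trans hK.F₃₃_spec.2.symm)
  obtain ⟨W₁, W₂, W₃, hW⟩ := exists_params_of_common_solution projR_A₁₃_mul_G₄ H₃_mul_projL
    (h₃.trans hK.F₄₄_spec.1.symm) (h₄.trans hK.F₄₄_spec.2.symm)
  -- The second expression for `U₃` carries minus signs, so the parameters `W₁`, `W₂`, `W₃` of the
  -- family around `F₄₄` enter negated.
  have hQ : K.C₁₁ * (V₁ ⊟ -W₁) + (V₂ ◫ -W₂) * K.D₁₁ =
      K.F - K.C₂₂ * V₃ * K.D₂₂ - K.C₃₃ * (-W₃) * K.D₃₃ := by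
    rw [C₁₁, D₁₁, fromCols_mul_fromRows, fromCols_mul_fromRows, C₂₂, C₃₃, D₂₂, D₃₃, F]
    simp only [Matrix.mul_neg, Matrix.neg_mul]
    linear_combination (norm := abel) hW - hV
  have hE : K.E₁₁ * V₃ * K.E₃₃ + K.E₂₂ * (-W₃) * K.E₄₄ = K.E := by
    have h0 := congrArg (fun W => projR K.C₁₁ * W * projL K.D₁₁) hQ
    simp only [projR_C₁₁_mul_Q_mul_projL] at h0
    simp only [Matrix.mul_add, Matrix.add_mul, Matrix.mul_assoc, mul_projL, projR_mul_assoc,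
      Matrix.mul_zero, Matrix.zero_mul, add_zero] at h0
    simpa only [Matrix.mul_assoc] using (sub_eq_zero.1 h0.symm).symm
  obtain ⟨U₃₂, U₃₃, U₃₁, U₄₁, U₄₂, hV₃, hW₃⟩ :=
    exists_params_of_two_term_solution (M := K.M) (N := K.N) (S := K.S) rfl rfl rfl hE
  obtain ⟨U₁₁, U₁₂, U₂₁, hL, hR⟩ := exists_params_of_mul_add_mul_eq hQ
  refine ⟨U₁₁, U₁₂, U₂₁, U₃₁, U₃₂, U₃₃, U₄₁, U₄₂, ?_⟩
  rintro P rfl rfl rfl rfl rfl rfl rfl rfl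
  rw [← V₃_eq] at hV₃
  rw [← W₃_eq] at hW₃
  rw [hV₃, hW₃, ← Q] at hL hR
  rw [hV, U₃, hV₃, (blocks_of_fromRows_eq hL).1, (blocks_of_fromCols_eq hR).1, Coeffs.V₁,
    Coeffs.V₂]
  simp only [← Matrix.mul_sub, ← Matrix.add_mul, ← sub_add, ← add_assoc]

/-- The projectors kill the particular part, so the remainder `rem` depends on `X`, `Y`, `Z` only
through `U₁`, `U₂`, `U₃`. -/
theorem projL_mul_sol_mul_projR {p m n k l q : Type*} [Fintype m] [Fintype n] [Fintype k]
    [Fintype l] [DecidableEq n] [DecidableEq k] (E : Matrix p n ℍ[ℝ]) (F : Matrix k q ℍ[ℝ])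
    (A : Matrix m n ℍ[ℝ]) (B : Matrix k l ℍ[ℝ]) (C : Matrix m k ℍ[ℝ]) (D : Matrix n l ℍ[ℝ])
    (U : Matrix n k ℍ[ℝ]) :
    E * projL A * (pinv A * C + projL A * D * pinv B + projL A * U * projR B) * (projR B * F)
      = E * projL A * U * (projR B * F) := by
  have h1 (X : Matrix n q ℍ[ℝ]) : projL A * (projL A * X) = projL A * X := by
    rw [← Matrix.mul_assoc, projL_mul_projL]
  have h2 : projR B * (projR B * F) = projR B * F := by
    rw [← Matrix.mul_assoc, projR_mul_projR]
  simp only [Matrix.mul_add, Matrix.add_mul, Matrix.mul_assoc, projL_mul_pinv_assoc,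
    pinv_mul_projR_assoc, Matrix.mul_zero, zero_add, h1, h2]

/-- Parameters are chosen so that `U₃`, `U₁`, `U₂`, `freeU` and `freeV` are the given `Z`, `X`, `Y`,
`U` and `V` themselves. -/
theorem IsSolution.exists_params (hK : K.ProjectorConditions) (h : K.IsSolution U V X Y Z) :
    ∃ P : Params d, K.IsGiven P (K.U₃ P) U V X Y Z := by
  have hmain := (main_equation_iff h.eqU h.eqV h.eqX h.eqX' h.eqY h.eqY' h.eqZ h.eqZ').1 h.eqMain
  have hT₂ := T₂_eq hmain
  have hT : K.A₁₂ * X * K.B₂₁ + K.A₁₃ * Y * K.B₃₁ = K.T Z := by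
    rw [T, ← hT₂]; abel
  obtain ⟨U₁₁, U₁₂, U₂₁, U₃₁, U₃₂, U₃₃, U₄₁, U₄₂, hZ⟩ := exists_params_U₃ hK (G_mul_mul_H_eq hT₂)
  obtain ⟨U₅, U₆, U₄, U₇, U₈, hX, hY⟩ :=
    exists_params_of_two_term_solution (M := K.M₁) (N := K.N₁) (S := K.S₁) rfl rfl rfl hT
  obtain ⟨W₁₁, W₁₂, W₁₃, hU, hV⟩ := exists_params_of_mul_add_mul_eq hmain
  let P : Params d := ⟨W₁₁, W₁₂, W₁₃, U₄, U₅, U₆, U₇, U₈, U₁₁, U₁₂, U₂₁, U₃₁, U₃₂, U₃₃, U₄₁, U₄₂⟩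
  have eZ : K.U₃ P = Z := hZ P rfl rfl rfl rfl rfl rfl rfl rfl
  have eX : X = K.solX P Z := by
    rw [solX, show K.U₁ P Z = X from hX.symm, ← eq_add_of_left_right_solution h.eqX h.eqX']
  have eY : Y = K.solY P Z := by
    rw [solY, show K.U₂ P Z = Y from hY.symm, ← eq_add_of_left_right_solution h.eqY h.eqY']
  have eZ' : Z = K.solZ Z := eq_add_of_left_right_solution h.eqZ h.eqZ'
  have eR : K.rem P Z =
      K.T₁ - K.A₂₂ * X * K.B₂₂ - K.A₃₃ * Y * K.B₃₃ - K.A₄₄ * Z * K.B₄₄ := by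
    rw [rem, ← eX, ← eY, ← eZ']
  rw [← eR] at hU hV
  refine ⟨P, ?_, ?_, ?_, ?_, ?_⟩ <;> rw [eZ]
  · rw [solU, show K.freeU P Z = U from hU.symm]
    exact eq_pinv_mul_add h.eqU
  · rw [solV, show K.freeV P Z = V from hV.symm]
    exact eq_mul_pinv_add h.eqV
  · exact eX
  · exact eY
  · exact eZ'

theorem isSolution_of_projectorConditions (hK : K.ProjectorConditions) (P : Params d) :
    K.IsSolution (K.solU P (K.U₃ P)) (K.solV P (K.U₃ P)) (K.solX P (K.U₃ P)) (K.solY P (K.U₃ P))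
      (K.solZ (K.U₃ P)) := by
  have h₁₂ := U₃_spec hK P
  have h₃₄ := U₃'_spec hK P
  -- The first expression for `U₃` solves equations 1 and 2, the second solves 3 and 4; their
  -- equality yields all four.
  rw [← U₃_eq_U₃' hK] at h₃₄
  generalize K.U₃ P = u at h₁₂ h₃₄ ⊢
  obtain ⟨hX, hX'⟩ := left_right_solution hK.compatible.1 hK.RC₂ hK.DL₂ (K.U₁ P u)
    (X := K.solX P u) rfl
  obtain ⟨hY, hY'⟩ := left_right_solution hK.compatible.2.1 hK.RC₃ hK.DL₃ (K.U₂ P u)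
    (X := K.solY P u) rfl
  obtain ⟨hZ, hZ'⟩ := left_right_solution hK.compatible.2.2 hK.RC₄ hK.DL₄ u
    (X := K.solZ u) rfl
  have hT : K.A₁₂ * K.U₁ P u * K.B₂₁ + K.A₁₃ * K.U₂ P u * K.B₃₁ = K.T u :=
    two_term_solution (M := K.M₁) (N := K.N₁) (S := K.S₁) rfl rfl rfl
      (projR_M₁_mul_T_iff.2 h₁₂.1) (T_mul_projL_iff.2 h₃₄.2)
      (projR_A₁₂_mul_T_mul_projL_iff.2 h₁₂.2) (projR_A₁₃_mul_T_mul_projL_iff.2 h₃₄.1)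
      P.U₅ P.U₆ P.U₄ P.U₇ P.U₈ rfl rfl
  have eR : K.rem P u =
      K.T₁ - K.A₂₂ * K.U₁ P u * K.B₂₂ - K.A₃₃ * K.U₂ P u * K.B₃₃ - K.A₄₄ * u * K.B₄₄ := by
    simp only [rem, solX, solY, solZ, A₂₂, A₃₃, A₄₄, B₂₂, B₃₃, B₄₄, projL_mul_sol_mul_projR]
  -- The solvability condition for `U` and `V` is precisely the two-term equation `hT` already
  -- solved by `U₁` and `U₂`.
  have hR : projR K.A₁₁ * K.rem P u * projL K.B₁₁ = 0 := by
    have h0 : projR K.A₁₁ * K.rem P u * projL K.B₁₁ = K.T₂ - K.A₁₂ * K.U₁ P u * K.B₂₁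
        - K.A₁₃ * K.U₂ P u * K.B₃₁ - K.A₁₄ * u * K.B₄₁ := by
      rw [eR]
      simp only [T₂, A₁₂, A₁₃, A₁₄, B₂₁, B₃₁, B₄₁, Matrix.mul_sub, Matrix.sub_mul,
        Matrix.mul_assoc]
    rw [T] at hT
    rw [h0]
    linear_combination (norm := abel) -hT
  have hUV := mul_add_mul_eq_of_projR_mul_projL hR P.W₁₁ P.W₁₂ P.W₁₃
  have hU : K.A₁ * K.solU P u = K.C₁ := by
    rw [solU, Matrix.mul_add, mul_projL_assoc, add_zero,
      mul_pinv_mul_of_projR_mul_eq_zero hK.RC₁]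
  have hV : K.solV P u * K.B₁ = K.D₁ := by
    rw [solV, Matrix.add_mul, Matrix.mul_assoc, Matrix.mul_assoc, projR_mul, Matrix.mul_zero,
      add_zero, mul_pinv_mul_of_mul_projL_eq_zero hK.DL₁]
  have eU : K.A₁₁ * K.solU P u = K.A₁₁ * K.freeU P u := by
    rw [A₁₁, solU, Matrix.mul_add, Matrix.mul_assoc, projL_mul_pinv_assoc, Matrix.mul_zero,
      zero_add, Matrix.mul_assoc, Matrix.mul_assoc, ← Matrix.mul_assoc (projL _), projL_mul_projL]
  have eV : K.solV P u * K.B₁₁ = K.freeV P u * K.B₁₁ := by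
    rw [B₁₁, solV, Matrix.add_mul, Matrix.mul_assoc, pinv_mul_projR_assoc, Matrix.mul_zero,
      zero_add, Matrix.mul_assoc, ← Matrix.mul_assoc (projR _), projR_mul_projR]
  refine ⟨hU, hV, hX, hX', hY, hY', hZ, hZ', (main_equation_iff hU hV hX hX' hY hY' hZ hZ').2 ?_⟩
  rw [eU, eV]
  exact hUV

end Coeffs

/-! ### When the rank of a block matrix with a zero corner is additive -/

section LinearAlgebra

variable {R X Z C D : Type*} [DivisionRing R] [AddCommGroup X] [Module R X] [AddCommGroup Z]
  [Module R Z] [AddCommGroup C] [Module R C] [AddCommGroup D] [Module R D]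

/-- Projecting the range of the block map to `D` has image `range a`. The kernel of this projection
is a subspace `U` of `C` containing `range b`, so by rank-nullity additivity means `U = range b`;
and `U` consists of the vectors `m x + b z` with `a x = 0`. -/
theorem finrank_range_block_eq_iff [FiniteDimensional R C] [FiniteDimensional R D]
    (m : X →ₗ[R] C) (a : X →ₗ[R] D) (b : Z →ₗ[R] C) :
    Module.finrank R (LinearMap.range ((m.prod a).coprod (b.prod 0))) =
        Module.finrank R (LinearMap.range a) + Module.finrank R (LinearMap.range b) ↔
      ∀ x, a x = 0 → m x ∈ LinearMap.range b := by
  set w := (m.prod a).coprod (b.prod (0 : Z →ₗ[R] D)) with hw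
  have hwx : ∀ x z, w (x, z) = (m x + b z, a x) := fun x z => by simp [hw]
  set g := (LinearMap.snd R C D).domRestrict (LinearMap.range w) with hg
  have h1 := LinearMap.finrank_range_add_finrank_ker g
  have h2 : LinearMap.range g = LinearMap.range a := by
    ext y
    constructor
    · rintro ⟨⟨_, ⟨x, z⟩, rfl⟩, rfl⟩
      exact ⟨x, by simp [hg, hwx]⟩
    · rintro ⟨x, rfl⟩
      exact ⟨⟨w (x, 0), ⟨(x, 0), rfl⟩⟩, by simp [hg, hwx]⟩
  set U := (LinearMap.range w).comap (LinearMap.inl R C D) with hU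
  have h3 : Module.finrank R (LinearMap.ker g) = Module.finrank R U := by
    refine LinearEquiv.finrank_eq (LinearEquiv.ofBijective
      (((LinearMap.fst R C D).comp ((LinearMap.range w).subtype.comp
        (LinearMap.ker g).subtype)).codRestrict U ?_) ⟨?_, ?_⟩)
    · rintro ⟨⟨⟨u, v⟩, hv⟩, h⟩
      have hv0 : v = 0 := h
      subst hv0
      exact hv
    · rintro ⟨⟨⟨u, v⟩, hv⟩, h⟩ ⟨⟨⟨u', v'⟩, hv'⟩, h'⟩ he
      have hv0 : v = 0 := h
      have hv0' : v' = 0 := h'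
      have : u = u' := congrArg Subtype.val he
      subst hv0 hv0' this
      rfl
    · rintro ⟨u, hu⟩
      exact ⟨⟨⟨(u, 0), hu⟩, rfl⟩, rfl⟩
  have h4 : LinearMap.range b ≤ U := by
    rintro _ ⟨z, rfl⟩
    exact ⟨(0, z), by simp [hwx]⟩
  rw [← h1, h2, h3, add_right_inj]
  constructor
  · intro h x hx
    rw [Submodule.eq_of_le_of_finrank_eq h4 h.symm]
    exact ⟨(x, 0), by simp [hwx, hx]⟩
  · intro h
    suffices hUb : U = LinearMap.range b by rw [hUb]
    refine le_antisymm ?_ h4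
    rintro u ⟨⟨x, z⟩, hxz⟩
    rw [hwx] at hxz
    obtain ⟨h5, h6⟩ := Prod.ext_iff.1 hxz
    have h5' : m x + b z = u := h5
    rw [← h5']
    exact Submodule.add_mem _ (h x h6) ⟨z, rfl⟩

end LinearAlgebra

/-! ### Rank additivity for quaternion matrices -/

section Rank

variable {k l m n a b c e ι κ : Type*}

theorem qrank_eq_finrank_range [Fintype m] (A : Matrix m n ℍ[ℝ]) :
    qrank A = Module.finrank ℍ[ℝ] (LinearMap.range A.vecMulLinear) := by
  rw [qrank, range_vecMulLinear]

theorem qrank_submatrix (A : Matrix m n ℍ[ℝ]) (f : a ≃ m) (g : b ≃ n) :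
    qrank (A.submatrix f g) = qrank A := by
  rw [qrank, qrank]
  have h : Set.range (A.submatrix f g).row =
      LinearEquiv.funCongrLeft ℍ[ℝ] ℍ[ℝ] g '' Set.range A.row := by
    rw [← Set.range_comp, ← f.surjective.range_comp]
    rfl
  rw [h]
  have := Submodule.map_span (LinearEquiv.funCongrLeft ℍ[ℝ] ℍ[ℝ] g).toLinearMap (Set.range A.row)
  exact (congrArg (fun S : Submodule ℍ[ℝ] (b → ℍ[ℝ]) => Module.finrank ℍ[ℝ] S) this.symm).trans
    (LinearEquiv.finrank_map_eq _ _)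

variable [Fintype a] [Fintype b] [Fintype c] [Fintype e]

/-- Rank is the dimension of the row space, so the scalars act on the left and the relevant linear
map is `x ↦ x ᵥ* A`. -/
theorem qrank_fromBlocks_eq_iff (M : Matrix a c ℍ[ℝ]) (A : Matrix a e ℍ[ℝ])
    (B : Matrix b c ℍ[ℝ]) :
    qrank (fromBlocks M A B 0) = qrank A + qrank B ↔
      ∀ x, x ᵥ* A = 0 → ∃ z, z ᵥ* B = x ᵥ* M := by
  have h := finrank_range_block_eq_iff M.vecMulLinear A.vecMulLinear B.vecMulLinear
  rw [← qrank_eq_finrank_range, ← qrank_eq_finrank_range] at h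
  simp only [Matrix.vecMulLinear_apply, LinearMap.mem_range] at h
  refine Iff.trans (Eq.congr ?_ rfl) h
  rw [qrank_eq_finrank_range]
  set w := (M.vecMulLinear.prod A.vecMulLinear).coprod
    (B.vecMulLinear.prod (0 : (b → ℍ[ℝ]) →ₗ[ℍ[ℝ]] (e → ℍ[ℝ]))) with hw
  have h1 : (fromBlocks M A B 0).vecMulLinear =
      (LinearEquiv.sumArrowLequivProdArrow c e ℍ[ℝ] ℍ[ℝ]).symm.toLinearMap ∘ₗ w ∘ₗ
        (LinearEquiv.sumArrowLequivProdArrow a b ℍ[ℝ] ℍ[ℝ]).toLinearMap := by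
    refine LinearMap.ext fun x => ?_
    obtain ⟨⟨x, z⟩, rfl⟩ := (LinearEquiv.sumArrowLequivProdArrow a b ℍ[ℝ] ℍ[ℝ]).symm.surjective x
    have h2 : (LinearEquiv.sumArrowLequivProdArrow a b ℍ[ℝ] ℍ[ℝ]).symm (x, z) = Sum.elim x z := rfl
    have h3 (u : c → ℍ[ℝ]) (v : e → ℍ[ℝ]) :
        (LinearEquiv.sumArrowLequivProdArrow c e ℍ[ℝ] ℍ[ℝ]).symm (u, v) = Sum.elim u v := rfl
    simp [hw, h2, h3, Matrix.vecMul_fromBlocks]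
    rfl
  rw [h1, LinearMap.range_comp, LinearMap.range_comp_of_range_eq_top _ (LinearEquiv.range _)]
  exact LinearEquiv.finrank_map_eq _ _

/-- If `x A = 0` then `x M = (x Q) B`. The equivalences `f` and `g` bring the block matrix `W` into
the form with a zero corner. -/
theorem qrank_eq_add_of_eq {W : Matrix ι κ ℍ[ℝ]} {M : Matrix a c ℍ[ℝ]} {A : Matrix a e ℍ[ℝ]}
    {B : Matrix b c ℍ[ℝ]} (f : a ⊕ b ≃ ι) (g : c ⊕ e ≃ κ)
    (hW : W.submatrix f g = fromBlocks M A B 0) (P : Matrix e c ℍ[ℝ]) (Q : Matrix a b ℍ[ℝ])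
    (hM : A * P + Q * B = M) : qrank W = qrank A + qrank B := by
  rw [← qrank_submatrix W f g, hW, qrank_fromBlocks_eq_iff]
  intro x hx
  refine ⟨x ᵥ* Q, ?_⟩
  rw [← hM, Matrix.vecMul_add, ← Matrix.vecMul_vecMul, hx, Matrix.zero_vecMul, zero_add,
    Matrix.vecMul_vecMul]

/-- Each row of `X` kills `A`, so additivity puts each row of `X M` in the row space of `B`, which
`Y` annihilates. -/
theorem mul_mul_eq_zero_of_qrank {W : Matrix ι κ ℍ[ℝ]} {M : Matrix a c ℍ[ℝ]} {A : Matrix a e ℍ[ℝ]}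
    {B : Matrix b c ℍ[ℝ]} (f : a ⊕ b ≃ ι) (g : c ⊕ e ≃ κ)
    (hW : W.submatrix f g = fromBlocks M A B 0) (h : qrank W = qrank A + qrank B)
    {X : Matrix k a ℍ[ℝ]} {Y : Matrix c l ℍ[ℝ]} (hX : X * A = 0) (hY : B * Y = 0) :
    X * M * Y = 0 := by
  rw [← qrank_submatrix W f g, hW, qrank_fromBlocks_eq_iff] at h
  funext i
  have hx : X i ᵥ* A = 0 := by
    exact congrFun hX i
  obtain ⟨z, hz⟩ := h (X i) hx
  have h1 : (X * M * Y) i = (X i ᵥ* M) ᵥ* Y := rfl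
  rw [h1, ← hz, Matrix.vecMul_vecMul, hY, Matrix.vecMul_zero]
  rfl

theorem qrank_of_isEmpty_rows [IsEmpty m] (A : Matrix m n ℍ[ℝ]) : qrank A = 0 := by
  rw [qrank, Set.range_eq_empty, Submodule.span_empty, finrank_bot]

theorem qrank_of_isEmpty_cols [IsEmpty n] (A : Matrix m n ℍ[ℝ]) : qrank A = 0 :=
  Module.finrank_zero_of_subsingleton

/-- A single block row is the degenerate case in which `B` has no rows; the three lemmas that follow
use an empty block in the same way. -/
theorem qrank_fromCols_eq_of_mul_eq {C : Matrix a c ℍ[ℝ]} {A : Matrix a e ℍ[ℝ]}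
    {X : Matrix e c ℍ[ℝ]} (h : A * X = C) : qrank (C ◫ A) = qrank A := by
  have := qrank_eq_add_of_eq (W := C ◫ A) (M := C) (A := A) (B := (0 : Matrix Empty c ℍ[ℝ]))
    (Equiv.sumEmpty a Empty) (Equiv.refl _)
    (by ext (i | i) (j | j) <;> first | rfl | exact i.elim) X 0 (by simp [h])
  rwa [qrank_of_isEmpty_rows (m := Empty), add_zero] at this

theorem projR_mul_eq_zero_of_qrank [DecidableEq a] [DecidableEq c] {C : Matrix a c ℍ[ℝ]}
    {A : Matrix a e ℍ[ℝ]} (h : qrank (C ◫ A) = qrank A) : projR A * C = 0 := by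
  have := mul_mul_eq_zero_of_qrank (W := C ◫ A) (M := C) (A := A) (B := (0 : Matrix Empty c ℍ[ℝ]))
    (Equiv.sumEmpty a Empty) (Equiv.refl _)
    (by ext (i | i) (j | j) <;> first | rfl | exact i.elim)
    (by rwa [qrank_of_isEmpty_rows (m := Empty), add_zero]) (projR_mul A) (Y := (1 : Matrix c c ℍ[ℝ])) (by simp)
  rwa [Matrix.mul_one] at this

theorem qrank_fromRows_eq_of_mul_eq {D : Matrix a c ℍ[ℝ]} {B : Matrix b c ℍ[ℝ]}
    {X : Matrix a b ℍ[ℝ]} (h : X * B = D) : qrank (D ⊟ B) = qrank B := by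
  have := qrank_eq_add_of_eq (W := D ⊟ B) (M := D) (A := (0 : Matrix a Empty ℍ[ℝ])) (B := B)
    (Equiv.refl _) (Equiv.sumEmpty c Empty)
    (by ext (i | i) (j | j) <;> first | rfl | exact j.elim) 0 X (by simp [h])
  rwa [qrank_of_isEmpty_cols (n := Empty), zero_add] at this

theorem mul_projL_eq_zero_of_qrank [DecidableEq a] [DecidableEq c] {D : Matrix a c ℍ[ℝ]}
    {B : Matrix b c ℍ[ℝ]} (h : qrank (D ⊟ B) = qrank B) : D * projL B = 0 := by
  have := mul_mul_eq_zero_of_qrank (W := D ⊟ B) (M := D) (A := (0 : Matrix a Empty ℍ[ℝ])) (B := B)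
    (Equiv.refl _) (Equiv.sumEmpty c Empty)
    (by ext (i | i) (j | j) <;> first | rfl | exact j.elim)
    (by rwa [qrank_of_isEmpty_cols (n := Empty), zero_add]) (X := (1 : Matrix a a ℍ[ℝ])) (by simp) (mul_projL B)
  rwa [Matrix.one_mul] at this

theorem qrank_le_of_mul_mul_eq [Fintype m] [Fintype n] [DecidableEq m]
    [DecidableEq n] {A B : Matrix m n ℍ[ℝ]} (P : Matrix m m ℍ[ℝ]) (Q : Matrix n n ℍ[ℝ])
    (h : P * A * Q = B) : qrank B ≤ qrank A := by
  rw [qrank_eq_finrank_range, qrank_eq_finrank_range]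
  have h1 : LinearMap.range B.vecMulLinear ≤
      (LinearMap.range A.vecMulLinear).map Q.vecMulLinear := by
    rintro _ ⟨x, rfl⟩
    refine ⟨x ᵥ* P ᵥ* A, ⟨x ᵥ* P, rfl⟩, ?_⟩
    simp [← h, Matrix.vecMul_vecMul, Matrix.mul_assoc]
  exact (Submodule.finrank_mono h1).trans (Submodule.finrank_map_le _ _)

end Rank

/-! ### Block arithmetic and regrouping of block indices -/

section BlockArithmetic

variable {m m' n n' : Type*}

theorem fromRows_add_fromRows (A A' : Matrix m n ℍ[ℝ]) (B B' : Matrix m' n ℍ[ℝ]) :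
    (A ⊟ B) + (A' ⊟ B') = (A + A') ⊟ (B + B') := by
  ext (i | i) j : 2 <;> rfl

theorem fromCols_add_fromCols (A A' : Matrix m n ℍ[ℝ]) (B B' : Matrix m n' ℍ[ℝ]) :
    (A ◫ B) + (A' ◫ B') = (A + A') ◫ (B + B') := by
  ext i (j | j) : 2 <;> rfl

theorem fromRows_eq_zero {A : Matrix m n ℍ[ℝ]} {B : Matrix m' n ℍ[ℝ]} :
    A ⊟ B = 0 ↔ A = 0 ∧ B = 0 := by
  rw [← Matrix.fromRows_zero, Matrix.fromRows_ext_iff]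

theorem fromCols_eq_zero {A : Matrix m n ℍ[ℝ]} {B : Matrix m n' ℍ[ℝ]} :
    A ◫ B = 0 ↔ A = 0 ∧ B = 0 := by
  rw [← Matrix.fromCols_zero, Matrix.fromCols_ext_iff]

end BlockArithmetic

section SumEquivs

variable (a b c d e f : Type*)

/-- These equivalences gather the row or column blocks of the large matrices so that the zero blocks
form one corner. The constant blocks are grouped with the outer side, the coefficient blocks `A_i`,
`B_j` with the corner factors. -/
def sumEquivSplitFour : (a ⊕ b ⊕ c ⊕ d) ⊕ (e ⊕ f) ≃ a ⊕ b ⊕ c ⊕ d ⊕ e ⊕ f where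
  toFun
    | .inl (.inl x) => .inl x
    | .inl (.inr (.inl x)) => .inr (.inl x)
    | .inl (.inr (.inr (.inl x))) => .inr (.inr (.inl x))
    | .inl (.inr (.inr (.inr x))) => .inr (.inr (.inr (.inl x)))
    | .inr (.inl x) => .inr (.inr (.inr (.inr (.inl x))))
    | .inr (.inr x) => .inr (.inr (.inr (.inr (.inr x))))
  invFun
    | .inl x => .inl (.inl x)
    | .inr (.inl x) => .inl (.inr (.inl x))
    | .inr (.inr (.inl x)) => .inl (.inr (.inr (.inl x)))
    | .inr (.inr (.inr (.inl x))) => .inl (.inr (.inr (.inr x)))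
    | .inr (.inr (.inr (.inr (.inl x)))) => .inr (.inl x)
    | .inr (.inr (.inr (.inr (.inr x)))) => .inr (.inr x)
  left_inv := by rintro ((_ | _ | _ | _) | (_ | _)) <;> rfl
  right_inv := by rintro (_ | _ | _ | _ | _ | _) <;> rfl

def sumEquivMoveLastTwo : (a ⊕ e ⊕ f) ⊕ (b ⊕ c ⊕ d) ≃ a ⊕ b ⊕ c ⊕ d ⊕ e ⊕ f where
  toFun
    | .inl (.inl x) => .inl x
    | .inr (.inl x) => .inr (.inl x)
    | .inr (.inr (.inl x)) => .inr (.inr (.inl x))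
    | .inr (.inr (.inr x)) => .inr (.inr (.inr (.inl x)))
    | .inl (.inr (.inl x)) => .inr (.inr (.inr (.inr (.inl x))))
    | .inl (.inr (.inr x)) => .inr (.inr (.inr (.inr (.inr x))))
  invFun
    | .inl x => .inl (.inl x)
    | .inr (.inl x) => .inr (.inl x)
    | .inr (.inr (.inl x)) => .inr (.inr (.inl x))
    | .inr (.inr (.inr (.inl x))) => .inr (.inr (.inr x))
    | .inr (.inr (.inr (.inr (.inl x)))) => .inl (.inr (.inl x))
    | .inr (.inr (.inr (.inr (.inr x)))) => .inl (.inr (.inr x))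
  left_inv := by rintro ((_ | _ | _) | (_ | _ | _)) <;> rfl
  right_inv := by rintro (_ | _ | _ | _ | _ | _) <;> rfl

def sumEquivMoveLastThree : (a ⊕ d ⊕ e ⊕ f) ⊕ (b ⊕ c) ≃ a ⊕ b ⊕ c ⊕ d ⊕ e ⊕ f where
  toFun
    | .inl (.inl x) => .inl x
    | .inr (.inl x) => .inr (.inl x)
    | .inr (.inr x) => .inr (.inr (.inl x))
    | .inl (.inr (.inl x)) => .inr (.inr (.inr (.inl x)))
    | .inl (.inr (.inr (.inl x))) => .inr (.inr (.inr (.inr (.inl x))))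
    | .inl (.inr (.inr (.inr x))) => .inr (.inr (.inr (.inr (.inr x))))
  invFun
    | .inl x => .inl (.inl x)
    | .inr (.inl x) => .inr (.inl x)
    | .inr (.inr (.inl x)) => .inr (.inr x)
    | .inr (.inr (.inr (.inl x))) => .inl (.inr (.inl x))
    | .inr (.inr (.inr (.inr (.inl x)))) => .inl (.inr (.inr (.inl x)))
    | .inr (.inr (.inr (.inr (.inr x)))) => .inl (.inr (.inr (.inr x)))
  left_inv := by rintro ((_ | _ | _ | _) | (_ | _)) <;> rfl
  right_inv := by rintro (_ | _ | _ | _ | _ | _) <;> rfl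

def sumEquivMoveLastFour : (a ⊕ c ⊕ d ⊕ e ⊕ f) ⊕ b ≃ a ⊕ b ⊕ c ⊕ d ⊕ e ⊕ f where
  toFun
    | .inl (.inl x) => .inl x
    | .inr x => .inr (.inl x)
    | .inl (.inr (.inl x)) => .inr (.inr (.inl x))
    | .inl (.inr (.inr (.inl x))) => .inr (.inr (.inr (.inl x)))
    | .inl (.inr (.inr (.inr (.inl x)))) => .inr (.inr (.inr (.inr (.inl x))))
    | .inl (.inr (.inr (.inr (.inr x)))) => .inr (.inr (.inr (.inr (.inr x))))
  invFun
    | .inl x => .inl (.inl x)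
    | .inr (.inl x) => .inr x
    | .inr (.inr (.inl x)) => .inl (.inr (.inl x))
    | .inr (.inr (.inr (.inl x))) => .inl (.inr (.inr (.inl x)))
    | .inr (.inr (.inr (.inr (.inl x)))) => .inl (.inr (.inr (.inr (.inl x))))
    | .inr (.inr (.inr (.inr (.inr x)))) => .inl (.inr (.inr (.inr (.inr x))))
  left_inv := by rintro ((_ | _ | _ | _ | _) | _) <;> rfl
  right_inv := by rintro (_ | _ | _ | _ | _ | _) <;> rfl

def sumEquivMoveLastOne : (a ⊕ f) ⊕ (b ⊕ c ⊕ d ⊕ e) ≃ a ⊕ b ⊕ c ⊕ d ⊕ e ⊕ f where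
  toFun
    | .inl (.inl x) => .inl x
    | .inr (.inl x) => .inr (.inl x)
    | .inr (.inr (.inl x)) => .inr (.inr (.inl x))
    | .inr (.inr (.inr (.inl x))) => .inr (.inr (.inr (.inl x)))
    | .inr (.inr (.inr (.inr x))) => .inr (.inr (.inr (.inr (.inl x))))
    | .inl (.inr x) => .inr (.inr (.inr (.inr (.inr x))))
  invFun
    | .inl x => .inl (.inl x)
    | .inr (.inl x) => .inr (.inl x)
    | .inr (.inr (.inl x)) => .inr (.inr (.inl x))
    | .inr (.inr (.inr (.inl x))) => .inr (.inr (.inr (.inl x)))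
    | .inr (.inr (.inr (.inr (.inl x)))) => .inr (.inr (.inr (.inr x)))
    | .inr (.inr (.inr (.inr (.inr x)))) => .inl (.inr x)
  left_inv := by rintro ((_ | _) | (_ | _ | _ | _)) <;> rfl
  right_inv := by rintro (_ | _ | _ | _ | _ | _) <;> rfl

variable (g h i j k l : Type*)

def sumEquivTwelve : (a ⊕ d ⊕ h ⊕ i ⊕ j ⊕ k ⊕ l) ⊕ (b ⊕ c ⊕ e ⊕ f ⊕ g) ≃
    a ⊕ b ⊕ c ⊕ d ⊕ e ⊕ f ⊕ g ⊕ h ⊕ i ⊕ j ⊕ k ⊕ l where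
  toFun
    | .inl (.inl x) => .inl x
    | .inr (.inl x) => .inr (.inl x)
    | .inr (.inr (.inl x)) => .inr (.inr (.inl x))
    | .inl (.inr (.inl x)) => .inr (.inr (.inr (.inl x)))
    | .inr (.inr (.inr (.inl x))) => .inr (.inr (.inr (.inr (.inl x))))
    | .inr (.inr (.inr (.inr (.inl x)))) => .inr (.inr (.inr (.inr (.inr (.inl x)))))
    | .inr (.inr (.inr (.inr (.inr x)))) => .inr (.inr (.inr (.inr (.inr (.inr (.inl x))))))
    | .inl (.inr (.inr x)) => .inr (.inr (.inr (.inr (.inr (.inr (.inr x))))))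
  invFun
    | .inl x => .inl (.inl x)
    | .inr (.inl x) => .inr (.inl x)
    | .inr (.inr (.inl x)) => .inr (.inr (.inl x))
    | .inr (.inr (.inr (.inl x))) => .inl (.inr (.inl x))
    | .inr (.inr (.inr (.inr (.inl x)))) => .inr (.inr (.inr (.inl x)))
    | .inr (.inr (.inr (.inr (.inr (.inl x))))) => .inr (.inr (.inr (.inr (.inl x))))
    | .inr (.inr (.inr (.inr (.inr (.inr (.inl x)))))) => .inr (.inr (.inr (.inr (.inr x))))
    | .inr (.inr (.inr (.inr (.inr (.inr (.inr x)))))) => .inl (.inr (.inr x))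
  left_inv := by rintro ((_ | _ | _) | (_ | _ | _ | _ | _)) <;> rfl
  right_inv := by rintro (_ | _ | _ | _ | _ | _ | _ | _) <;> rfl

end SumEquivs

/-! ### The block shapes of the rank conditions -/

section RankShapes

variable {p q m₁ m₂ m₃ m₄ n₁ n₂ n₃ n₄ s₁ s₂ s₃ s₄ t₁ t₂ t₃ t₄ k l : Type*}
  [Fintype p] [Fintype q] [Fintype m₁] [Fintype m₂] [Fintype m₃] [Fintype m₄]
  [Fintype n₁] [Fintype n₂] [Fintype n₃] [Fintype n₄] [Fintype s₁] [Fintype s₂] [Fintype s₃]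
  [Fintype s₄] [Fintype t₁] [Fintype t₂] [Fintype t₃] [Fintype t₄]
  [DecidableEq n₁] [DecidableEq n₂] [DecidableEq n₃] [DecidableEq n₄]
  [DecidableEq s₁] [DecidableEq s₂] [DecidableEq s₃] [DecidableEq s₄]

variable {Cc : Matrix p q ℍ[ℝ]}
  {E₁ : Matrix p n₁ ℍ[ℝ]} {E₂ : Matrix p n₂ ℍ[ℝ]} {E₃ : Matrix p n₃ ℍ[ℝ]} {E₄ : Matrix p n₄ ℍ[ℝ]}
  {A₁ : Matrix m₁ n₁ ℍ[ℝ]} {A₂ : Matrix m₂ n₂ ℍ[ℝ]} {A₃ : Matrix m₃ n₃ ℍ[ℝ]}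
  {A₄ : Matrix m₄ n₄ ℍ[ℝ]} {C₁ : Matrix m₁ q ℍ[ℝ]} {C₂ : Matrix m₂ q ℍ[ℝ]}
  {C₃ : Matrix m₃ q ℍ[ℝ]} {C₄ : Matrix m₄ q ℍ[ℝ]} {F₁ : Matrix s₁ q ℍ[ℝ]}
  {F₂ : Matrix s₂ q ℍ[ℝ]} {F₃ : Matrix s₃ q ℍ[ℝ]} {F₄ : Matrix s₄ q ℍ[ℝ]}
  {B₁ : Matrix s₁ t₁ ℍ[ℝ]} {B₂ : Matrix s₂ t₂ ℍ[ℝ]} {B₃ : Matrix s₃ t₃ ℍ[ℝ]}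
  {B₄ : Matrix s₄ t₄ ℍ[ℝ]} {D₁ : Matrix p t₁ ℍ[ℝ]} {D₂ : Matrix p t₂ ℍ[ℝ]}
  {D₃ : Matrix p t₃ ℍ[ℝ]} {D₄ : Matrix p t₄ ℍ[ℝ]}

/-- In this section `C_i` (`i ≥ 2`) plays the role of `C_i F_i` and `D_j` (`j ≥ 2`) that of `E_j
D_j`; correspondingly `x_i` stands for the unknown times `F_i`, and `y_j` for `E_j` times the
unknown. Each unknown is put on the left as `x` or on the right as `y`, which gives `M = A P + Q B`.
-/
theorem qrank_three_left_two_right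
    {x₁ : Matrix n₁ q ℍ[ℝ]} {x₂ : Matrix n₂ q ℍ[ℝ]} {x₃ : Matrix n₃ q ℍ[ℝ]}
    {y₁ : Matrix p s₁ ℍ[ℝ]} {y₂ : Matrix p s₂ ℍ[ℝ]} (h₁ : A₁ * x₁ = C₁) (h₂ : A₂ * x₂ = C₂)
    (h₃ : A₃ * x₃ = C₃) (k₁ : y₁ * B₁ = D₁) (k₂ : y₂ * B₂ = D₂)
    (h : E₁ * x₁ + E₂ * x₂ + E₃ * x₃ + y₂ * F₂ + y₁ * F₁ = Cc) :
    qrank (Cc ◫ E₁ ◫ E₂ ◫ E₃ ◫ D₂ ◫ D₁ ⊟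
           C₁ ◫ A₁ ◫ 0 ◫ 0 ◫ 0 ◫ 0 ⊟
           C₂ ◫ 0 ◫ A₂ ◫ 0 ◫ 0 ◫ 0 ⊟
           C₃ ◫ 0 ◫ 0 ◫ A₃ ◫ 0 ◫ 0 ⊟
           F₂ ◫ 0 ◫ 0 ◫ 0 ◫ B₂ ◫ 0 ⊟
           F₁ ◫ 0 ◫ 0 ◫ 0 ◫ 0 ◫ B₁) =
    qrank (E₁ ◫ E₂ ◫ E₃ ⊟
           A₁ ◫ 0 ◫ 0 ⊟
           0 ◫ A₂ ◫ 0 ⊟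
           0 ◫ 0 ◫ A₃) +
    qrank (F₂ ◫ B₂ ◫ 0 ⊟
           F₁ ◫ 0 ◫ B₁) := by
  refine qrank_eq_add_of_eq
    (M := Cc ◫ D₂ ◫ D₁ ⊟ C₁ ◫ 0 ◫ 0 ⊟ C₂ ◫ 0 ◫ 0 ⊟ C₃ ◫ 0 ◫ 0)
    (sumEquivSplitFour _ _ _ _ _ _) (sumEquivMoveLastTwo _ _ _ _ _ _) ?_
    (x₁ ◫ 0 ◫ 0 ⊟ x₂ ◫ 0 ◫ 0 ⊟ x₃ ◫ 0 ◫ 0) (y₂ ◫ y₁ ⊟ 0) ?_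
  · ext ((_ | _ | _ | _) | (_ | _)) ((_ | _ | _) | (_ | _ | _)) : 2 <;> rfl
  · subst h₁ h₂ h₃ k₁ k₂ h
    simp only [Matrix.fromRows_mul, Matrix.fromCols_mul_fromRows, Matrix.mul_fromCols,
      fromRows_add_fromRows, fromCols_add_fromCols, Matrix.mul_zero, Matrix.zero_mul, add_zero,
      zero_add, add_assoc]

/-- `X` is padded by the blocks `-X E_i A_i†` so that it kills the left factor, and `Y` by `-B_j†
F_j Y` so that the right factor kills it. The padded product is the asserted expression. The other
shapes are treated alike. -/
theorem mul_mul_eq_zero_of_qrank_three_left_two_right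
    (h : qrank (Cc ◫ E₁ ◫ E₂ ◫ E₃ ◫ D₂ ◫ D₁ ⊟
                C₁ ◫ A₁ ◫ 0 ◫ 0 ◫ 0 ◫ 0 ⊟
                C₂ ◫ 0 ◫ A₂ ◫ 0 ◫ 0 ◫ 0 ⊟
                C₃ ◫ 0 ◫ 0 ◫ A₃ ◫ 0 ◫ 0 ⊟
                F₂ ◫ 0 ◫ 0 ◫ 0 ◫ B₂ ◫ 0 ⊟
                F₁ ◫ 0 ◫ 0 ◫ 0 ◫ 0 ◫ B₁) =
         qrank (E₁ ◫ E₂ ◫ E₃ ⊟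
                A₁ ◫ 0 ◫ 0 ⊟
                0 ◫ A₂ ◫ 0 ⊟
                0 ◫ 0 ◫ A₃) +
         qrank (F₂ ◫ B₂ ◫ 0 ⊟
                F₁ ◫ 0 ◫ B₁))
    {X : Matrix k p ℍ[ℝ]} {Y : Matrix q l ℍ[ℝ]} (h₁ : X * (E₁ * projL A₁) = 0)
    (h₂ : X * (E₂ * projL A₂) = 0) (h₃ : X * (E₃ * projL A₃) = 0) (k₁ : projR B₁ * F₁ * Y = 0)
    (k₂ : projR B₂ * F₂ * Y = 0) :
    X * (Cc - E₁ * (pinv A₁ * C₁) - E₂ * (pinv A₂ * C₂) - E₃ * (pinv A₃ * C₃)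
      - D₁ * pinv B₁ * F₁ - D₂ * pinv B₂ * F₂) * Y = 0 := by
  rw [← Matrix.mul_assoc] at h₁ h₂ h₃
  rw [Matrix.mul_assoc] at k₁ k₂
  have h₁' := mul_pinv_mul_of_mul_projL_eq_zero h₁
  have h₂' := mul_pinv_mul_of_mul_projL_eq_zero h₂
  have h₃' := mul_pinv_mul_of_mul_projL_eq_zero h₃
  have k₁' := mul_pinv_mul_of_projR_mul_eq_zero k₁
  have k₂' := mul_pinv_mul_of_projR_mul_eq_zero k₂
  have := mul_mul_eq_zero_of_qrank
    (M := Cc ◫ D₂ ◫ D₁ ⊟ C₁ ◫ 0 ◫ 0 ⊟ C₂ ◫ 0 ◫ 0 ⊟ C₃ ◫ 0 ◫ 0)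
    (sumEquivSplitFour _ _ _ _ _ _) (sumEquivMoveLastTwo _ _ _ _ _ _)
    (by ext ((_ | _ | _ | _) | (_ | _)) ((_ | _ | _) | (_ | _ | _)) : 2 <;> rfl)
    h
    (X := X ◫ (-(X * E₁ * pinv A₁)) ◫ (-(X * E₂ * pinv A₂)) ◫ (-(X * E₃ * pinv A₃)))
    (Y := Y ⊟ (-(pinv B₂ * (F₂ * Y))) ⊟ (-(pinv B₁ * (F₁ * Y))))
    (by
      simp only [Matrix.fromCols_mul_fromRows, Matrix.mul_fromCols, fromCols_add_fromCols,
        Matrix.fromCols_neg, fromCols_eq_zero, Matrix.mul_zero, Matrix.neg_mul, neg_zero,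
        Matrix.mul_assoc _ _ A₁, Matrix.mul_assoc _ _ A₂, Matrix.mul_assoc _ _ A₃, h₁', h₂', h₃',
        add_zero, zero_add, add_neg_cancel, and_self])
    (by
      simp only [Matrix.fromCols_mul_fromRows, Matrix.fromRows_mul, fromRows_eq_zero,
        Matrix.zero_mul, Matrix.mul_neg, neg_zero,
        k₁', k₂', add_zero, zero_add, add_neg_cancel, and_self])
  simp only [Matrix.fromCols_mul_fromRows, Matrix.mul_fromCols, fromCols_add_fromCols,
    Matrix.mul_zero, Matrix.neg_mul, Matrix.mul_neg, add_zero, neg_zero, Matrix.fromCols_neg,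
    Matrix.add_mul, Matrix.mul_assoc] at this
  simp only [Matrix.mul_sub, Matrix.sub_mul, Matrix.mul_assoc]
  linear_combination (norm := abel) this

theorem qrank_two_left_three_right
    {x₁ : Matrix n₁ q ℍ[ℝ]} {x₂ : Matrix n₂ q ℍ[ℝ]} {y₁ : Matrix p s₁ ℍ[ℝ]}
    {y₂ : Matrix p s₂ ℍ[ℝ]} {y₃ : Matrix p s₃ ℍ[ℝ]} (h₁ : A₁ * x₁ = C₁) (h₂ : A₂ * x₂ = C₂)
    (k₁ : y₁ * B₁ = D₁) (k₂ : y₂ * B₂ = D₂) (k₃ : y₃ * B₃ = D₃)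
    (h : E₂ * x₂ + E₁ * x₁ + y₂ * F₂ + y₃ * F₃ + y₁ * F₁ = Cc) :
    qrank (Cc ◫ E₂ ◫ E₁ ◫ D₂ ◫ D₃ ◫ D₁ ⊟
           F₂ ◫ 0 ◫ 0 ◫ B₂ ◫ 0 ◫ 0 ⊟
           F₃ ◫ 0 ◫ 0 ◫ 0 ◫ B₃ ◫ 0 ⊟
           F₁ ◫ 0 ◫ 0 ◫ 0 ◫ 0 ◫ B₁ ⊟
           C₂ ◫ A₂ ◫ 0 ◫ 0 ◫ 0 ◫ 0 ⊟
           C₁ ◫ 0 ◫ A₁ ◫ 0 ◫ 0 ◫ 0) =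
    qrank (F₂ ◫ B₂ ◫ 0 ◫ 0 ⊟
           F₃ ◫ 0 ◫ B₃ ◫ 0 ⊟
           F₁ ◫ 0 ◫ 0 ◫ B₁) +
    qrank (E₂ ◫ E₁ ⊟
           A₂ ◫ 0 ⊟
           0 ◫ A₁) := by
  rw [add_comm]
  refine qrank_eq_add_of_eq
    (M := Cc ◫ D₂ ◫ D₃ ◫ D₁ ⊟ C₂ ◫ 0 ◫ 0 ◫ 0 ⊟ C₁ ◫ 0 ◫ 0 ◫ 0)
    (sumEquivMoveLastTwo _ _ _ _ _ _) (sumEquivMoveLastThree _ _ _ _ _ _) ?_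
    (x₂ ◫ 0 ◫ 0 ◫ 0 ⊟ x₁ ◫ 0 ◫ 0 ◫ 0) (y₂ ◫ y₃ ◫ y₁ ⊟ 0) ?_
  · ext ((_ | _ | _) | (_ | _ | _)) ((_ | _ | _ | _) | (_ | _)) : 2 <;> rfl
  · subst h₁ h₂ k₁ k₂ k₃ h
    simp only [Matrix.fromRows_mul, Matrix.fromCols_mul_fromRows, Matrix.mul_fromCols,
      fromRows_add_fromRows, fromCols_add_fromCols, Matrix.mul_zero, Matrix.zero_mul, add_zero,
      zero_add, add_assoc]

theorem mul_mul_eq_zero_of_qrank_two_left_three_right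
    (h : qrank (Cc ◫ E₂ ◫ E₁ ◫ D₂ ◫ D₃ ◫ D₁ ⊟
                F₂ ◫ 0 ◫ 0 ◫ B₂ ◫ 0 ◫ 0 ⊟
                F₃ ◫ 0 ◫ 0 ◫ 0 ◫ B₃ ◫ 0 ⊟
                F₁ ◫ 0 ◫ 0 ◫ 0 ◫ 0 ◫ B₁ ⊟
                C₂ ◫ A₂ ◫ 0 ◫ 0 ◫ 0 ◫ 0 ⊟
                C₁ ◫ 0 ◫ A₁ ◫ 0 ◫ 0 ◫ 0) =
         qrank (F₂ ◫ B₂ ◫ 0 ◫ 0 ⊟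
                F₃ ◫ 0 ◫ B₃ ◫ 0 ⊟
                F₁ ◫ 0 ◫ 0 ◫ B₁) +
         qrank (E₂ ◫ E₁ ⊟
                A₂ ◫ 0 ⊟
                0 ◫ A₁))
    {X : Matrix k p ℍ[ℝ]} {Y : Matrix q l ℍ[ℝ]} (h₁ : X * (E₁ * projL A₁) = 0)
    (h₂ : X * (E₂ * projL A₂) = 0) (k₁ : projR B₁ * F₁ * Y = 0) (k₂ : projR B₂ * F₂ * Y = 0)
    (k₃ : projR B₃ * F₃ * Y = 0) :
    X * (Cc - E₁ * (pinv A₁ * C₁) - E₂ * (pinv A₂ * C₂)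
      - D₁ * pinv B₁ * F₁ - D₂ * pinv B₂ * F₂ - D₃ * pinv B₃ * F₃) * Y = 0 := by
  rw [← Matrix.mul_assoc] at h₁ h₂
  rw [Matrix.mul_assoc] at k₁ k₂ k₃
  have h₁' := mul_pinv_mul_of_mul_projL_eq_zero h₁
  have h₂' := mul_pinv_mul_of_mul_projL_eq_zero h₂
  have k₁' := mul_pinv_mul_of_projR_mul_eq_zero k₁
  have k₂' := mul_pinv_mul_of_projR_mul_eq_zero k₂
  have k₃' := mul_pinv_mul_of_projR_mul_eq_zero k₃
  have := mul_mul_eq_zero_of_qrank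
    (M := Cc ◫ D₂ ◫ D₃ ◫ D₁ ⊟ C₂ ◫ 0 ◫ 0 ◫ 0 ⊟ C₁ ◫ 0 ◫ 0 ◫ 0)
    (sumEquivMoveLastTwo _ _ _ _ _ _) (sumEquivMoveLastThree _ _ _ _ _ _)
    (by ext ((_ | _ | _) | (_ | _ | _)) ((_ | _ | _ | _) | (_ | _)) : 2 <;> rfl)
    (h.trans (add_comm _ _))
    (X := X ◫ (-(X * E₂ * pinv A₂)) ◫ (-(X * E₁ * pinv A₁)))
    (Y := Y ⊟ (-(pinv B₂ * (F₂ * Y))) ⊟ (-(pinv B₃ * (F₃ * Y))) ⊟ (-(pinv B₁ * (F₁ * Y))))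
    (by
      simp only [Matrix.fromCols_mul_fromRows, Matrix.mul_fromCols, fromCols_add_fromCols,
        Matrix.fromCols_neg, fromCols_eq_zero, Matrix.mul_zero, Matrix.neg_mul, neg_zero,
        Matrix.mul_assoc _ _ A₁, Matrix.mul_assoc _ _ A₂, h₁', h₂', add_zero, zero_add,
        add_neg_cancel, and_self])
    (by
      simp only [Matrix.fromCols_mul_fromRows, Matrix.fromRows_mul, fromRows_eq_zero,
        Matrix.zero_mul, Matrix.mul_neg, neg_zero,
        k₁', k₂', k₃', add_zero, zero_add, add_neg_cancel, and_self])
  simp only [Matrix.fromCols_mul_fromRows, Matrix.mul_fromCols, fromCols_add_fromCols,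
    Matrix.mul_zero, Matrix.neg_mul, Matrix.mul_neg, add_zero, neg_zero, Matrix.fromCols_neg,
    Matrix.add_mul, Matrix.mul_assoc] at this
  simp only [Matrix.mul_sub, Matrix.sub_mul, Matrix.mul_assoc]
  linear_combination (norm := abel) this

theorem qrank_four_left_one_right
    {x₁ : Matrix n₁ q ℍ[ℝ]} {x₂ : Matrix n₂ q ℍ[ℝ]} {x₃ : Matrix n₃ q ℍ[ℝ]}
    {x₄ : Matrix n₄ q ℍ[ℝ]} {y₁ : Matrix p s₁ ℍ[ℝ]} (h₁ : A₁ * x₁ = C₁) (h₂ : A₂ * x₂ = C₂)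
    (h₃ : A₃ * x₃ = C₃) (h₄ : A₄ * x₄ = C₄) (k₁ : y₁ * B₁ = D₁)
    (h : E₁ * x₁ + E₂ * x₂ + E₃ * x₃ + E₄ * x₄ + y₁ * F₁ = Cc) :
    qrank (Cc ◫ E₁ ◫ E₂ ◫ E₃ ◫ E₄ ◫ D₁ ⊟
           F₁ ◫ 0 ◫ 0 ◫ 0 ◫ 0 ◫ B₁ ⊟
           C₁ ◫ A₁ ◫ 0 ◫ 0 ◫ 0 ◫ 0 ⊟
           C₂ ◫ 0 ◫ A₂ ◫ 0 ◫ 0 ◫ 0 ⊟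
           C₃ ◫ 0 ◫ 0 ◫ A₃ ◫ 0 ◫ 0 ⊟
           C₄ ◫ 0 ◫ 0 ◫ 0 ◫ A₄ ◫ 0) =
    qrank (E₁ ◫ E₂ ◫ E₃ ◫ E₄ ⊟
           A₁ ◫ 0 ◫ 0 ◫ 0 ⊟
           0 ◫ A₂ ◫ 0 ◫ 0 ⊟
           0 ◫ 0 ◫ A₃ ◫ 0 ⊟
           0 ◫ 0 ◫ 0 ◫ A₄) +
    qrank (F₁ ◫ B₁) := by
  refine qrank_eq_add_of_eq
    (M := Cc ◫ D₁ ⊟ C₁ ◫ 0 ⊟ C₂ ◫ 0 ⊟ C₃ ◫ 0 ⊟ C₄ ◫ 0)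
    (sumEquivMoveLastFour _ _ _ _ _ _) (sumEquivMoveLastOne _ _ _ _ _ _) ?_
    (x₁ ◫ 0 ⊟ x₂ ◫ 0 ⊟ x₃ ◫ 0 ⊟ x₄ ◫ 0) (y₁ ⊟ 0) ?_
  · ext ((_ | _ | _ | _ | _) | _) ((_ | _) | (_ | _ | _ | _)) : 2 <;> rfl
  · subst h₁ h₂ h₃ h₄ k₁ h
    -- The right factor is a single block row here, so the product could be expanded by columns as
    -- well; expanding by rows first matches the other summand.
    rw [Matrix.fromRows_mul y₁]
    simp only [Matrix.fromRows_mul, Matrix.fromCols_mul_fromRows, Matrix.mul_fromCols,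
      fromRows_add_fromRows, fromCols_add_fromCols, Matrix.mul_zero, Matrix.zero_mul, add_zero,
      zero_add, add_assoc]

theorem mul_mul_eq_zero_of_qrank_four_left_one_right
    (h : qrank (Cc ◫ E₁ ◫ E₂ ◫ E₃ ◫ E₄ ◫ D₁ ⊟
                F₁ ◫ 0 ◫ 0 ◫ 0 ◫ 0 ◫ B₁ ⊟
                C₁ ◫ A₁ ◫ 0 ◫ 0 ◫ 0 ◫ 0 ⊟
                C₂ ◫ 0 ◫ A₂ ◫ 0 ◫ 0 ◫ 0 ⊟
                C₃ ◫ 0 ◫ 0 ◫ A₃ ◫ 0 ◫ 0 ⊟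
                C₄ ◫ 0 ◫ 0 ◫ 0 ◫ A₄ ◫ 0) =
         qrank (E₁ ◫ E₂ ◫ E₃ ◫ E₄ ⊟
                A₁ ◫ 0 ◫ 0 ◫ 0 ⊟
                0 ◫ A₂ ◫ 0 ◫ 0 ⊟
                0 ◫ 0 ◫ A₃ ◫ 0 ⊟
                0 ◫ 0 ◫ 0 ◫ A₄) +
         qrank (F₁ ◫ B₁))
    {X : Matrix k p ℍ[ℝ]} {Y : Matrix q l ℍ[ℝ]} (h₁ : X * (E₁ * projL A₁) = 0)
    (h₂ : X * (E₂ * projL A₂) = 0) (h₃ : X * (E₃ * projL A₃) = 0) (h₄ : X * (E₄ * projL A₄) = 0)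
    (k₁ : projR B₁ * F₁ * Y = 0) :
    X * (Cc - E₁ * (pinv A₁ * C₁) - E₂ * (pinv A₂ * C₂) - E₃ * (pinv A₃ * C₃) - E₄ * (pinv A₄ * C₄)
      - D₁ * pinv B₁ * F₁) * Y = 0 := by
  rw [← Matrix.mul_assoc] at h₁ h₂ h₃ h₄
  rw [Matrix.mul_assoc] at k₁
  have h₁' := mul_pinv_mul_of_mul_projL_eq_zero h₁
  have h₂' := mul_pinv_mul_of_mul_projL_eq_zero h₂
  have h₃' := mul_pinv_mul_of_mul_projL_eq_zero h₃
  have h₄' := mul_pinv_mul_of_mul_projL_eq_zero h₄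
  have k₁' := mul_pinv_mul_of_projR_mul_eq_zero k₁
  have := mul_mul_eq_zero_of_qrank
    (M := Cc ◫ D₁ ⊟ C₁ ◫ 0 ⊟ C₂ ◫ 0 ⊟ C₃ ◫ 0 ⊟ C₄ ◫ 0)
    (sumEquivMoveLastFour _ _ _ _ _ _) (sumEquivMoveLastOne _ _ _ _ _ _)
    (by ext ((_ | _ | _ | _ | _) | _) ((_ | _) | (_ | _ | _ | _)) : 2 <;> rfl)
    h
    (X := X ◫ (-(X * E₁ * pinv A₁)) ◫ (-(X * E₂ * pinv A₂)) ◫ (-(X * E₃ * pinv A₃)) ◫ (-(X * E₄ *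
      pinv A₄)))
    (Y := Y ⊟ (-(pinv B₁ * (F₁ * Y))))
    (by
      simp only [Matrix.fromCols_mul_fromRows, Matrix.mul_fromCols, fromCols_add_fromCols,
        Matrix.fromCols_neg, fromCols_eq_zero, Matrix.mul_zero, Matrix.neg_mul, neg_zero,
        Matrix.mul_assoc _ _ A₁, Matrix.mul_assoc _ _ A₂, Matrix.mul_assoc _ _ A₃,
        Matrix.mul_assoc _ _ A₄, h₁', h₂', h₃', h₄', add_zero, zero_add, add_neg_cancel,
        and_self])
    (by simp only [Matrix.fromCols_mul_fromRows, Matrix.mul_neg, k₁', add_neg_cancel])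
  simp only [Matrix.fromCols_mul_fromRows, Matrix.mul_fromCols, fromCols_add_fromCols,
    Matrix.mul_zero, Matrix.neg_mul, Matrix.mul_neg, add_zero, neg_zero, Matrix.fromCols_neg,
    Matrix.add_mul, Matrix.mul_assoc] at this
  simp only [Matrix.mul_sub, Matrix.sub_mul, Matrix.mul_assoc]
  linear_combination (norm := abel) this

theorem qrank_one_left_four_right
    {x₁ : Matrix n₁ q ℍ[ℝ]} {y₁ : Matrix p s₁ ℍ[ℝ]} {y₂ : Matrix p s₂ ℍ[ℝ]}
    {y₃ : Matrix p s₃ ℍ[ℝ]} {y₄ : Matrix p s₄ ℍ[ℝ]} (h₁ : A₁ * x₁ = C₁) (k₁ : y₁ * B₁ = D₁)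
    (k₂ : y₂ * B₂ = D₂) (k₃ : y₃ * B₃ = D₃) (k₄ : y₄ * B₄ = D₄)
    (h : E₁ * x₁ + y₄ * F₄ + y₂ * F₂ + y₃ * F₃ + y₁ * F₁ = Cc) :
    qrank (Cc ◫ E₁ ◫ D₄ ◫ D₂ ◫ D₃ ◫ D₁ ⊟
           F₄ ◫ 0 ◫ B₄ ◫ 0 ◫ 0 ◫ 0 ⊟
           F₂ ◫ 0 ◫ 0 ◫ B₂ ◫ 0 ◫ 0 ⊟
           F₃ ◫ 0 ◫ 0 ◫ 0 ◫ B₃ ◫ 0 ⊟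
           F₁ ◫ 0 ◫ 0 ◫ 0 ◫ 0 ◫ B₁ ⊟
           C₁ ◫ A₁ ◫ 0 ◫ 0 ◫ 0 ◫ 0) =
    qrank (F₄ ◫ B₄ ◫ 0 ◫ 0 ◫ 0 ⊟
           F₂ ◫ 0 ◫ B₂ ◫ 0 ◫ 0 ⊟
           F₃ ◫ 0 ◫ 0 ◫ B₃ ◫ 0 ⊟
           F₁ ◫ 0 ◫ 0 ◫ 0 ◫ B₁) +
    qrank (E₁ ⊟
           A₁) := by
  rw [add_comm]
  refine qrank_eq_add_of_eq
    (M := Cc ◫ D₄ ◫ D₂ ◫ D₃ ◫ D₁ ⊟ C₁ ◫ 0 ◫ 0 ◫ 0 ◫ 0)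
    (sumEquivMoveLastOne _ _ _ _ _ _) (sumEquivMoveLastFour _ _ _ _ _ _) ?_
    (x₁ ◫ 0 ◫ 0 ◫ 0 ◫ 0) (y₄ ◫ y₂ ◫ y₃ ◫ y₁ ⊟ 0) ?_
  · ext ((_ | _) | (_ | _ | _ | _)) ((_ | _ | _ | _ | _) | _) : 2 <;> rfl
  · subst h₁ k₁ k₂ k₃ k₄ h
    rw [Matrix.fromRows_mul E₁]
    simp only [Matrix.fromRows_mul, Matrix.fromCols_mul_fromRows, Matrix.mul_fromCols,
      fromRows_add_fromRows, fromCols_add_fromCols, Matrix.mul_zero, Matrix.zero_mul, add_zero,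
      zero_add, add_assoc]

theorem mul_mul_eq_zero_of_qrank_one_left_four_right
    (h : qrank (Cc ◫ E₁ ◫ D₄ ◫ D₂ ◫ D₃ ◫ D₁ ⊟
                F₄ ◫ 0 ◫ B₄ ◫ 0 ◫ 0 ◫ 0 ⊟
                F₂ ◫ 0 ◫ 0 ◫ B₂ ◫ 0 ◫ 0 ⊟
                F₃ ◫ 0 ◫ 0 ◫ 0 ◫ B₃ ◫ 0 ⊟
                F₁ ◫ 0 ◫ 0 ◫ 0 ◫ 0 ◫ B₁ ⊟
                C₁ ◫ A₁ ◫ 0 ◫ 0 ◫ 0 ◫ 0) =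
         qrank (F₄ ◫ B₄ ◫ 0 ◫ 0 ◫ 0 ⊟
                F₂ ◫ 0 ◫ B₂ ◫ 0 ◫ 0 ⊟
                F₃ ◫ 0 ◫ 0 ◫ B₃ ◫ 0 ⊟
                F₁ ◫ 0 ◫ 0 ◫ 0 ◫ B₁) +
         qrank (E₁ ⊟
                A₁))
    {X : Matrix k p ℍ[ℝ]} {Y : Matrix q l ℍ[ℝ]} (h₁ : X * (E₁ * projL A₁) = 0)
    (k₁ : projR B₁ * F₁ * Y = 0) (k₂ : projR B₂ * F₂ * Y = 0) (k₃ : projR B₃ * F₃ * Y = 0)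
    (k₄ : projR B₄ * F₄ * Y = 0) :
    X * (Cc - E₁ * (pinv A₁ * C₁)
      - D₁ * pinv B₁ * F₁ - D₂ * pinv B₂ * F₂ - D₃ * pinv B₃ * F₃ - D₄ * pinv B₄ * F₄) * Y = 0 := by
  rw [← Matrix.mul_assoc] at h₁
  rw [Matrix.mul_assoc] at k₁ k₂ k₃ k₄
  have h₁' := mul_pinv_mul_of_mul_projL_eq_zero h₁
  have k₁' := mul_pinv_mul_of_projR_mul_eq_zero k₁
  have k₂' := mul_pinv_mul_of_projR_mul_eq_zero k₂
  have k₃' := mul_pinv_mul_of_projR_mul_eq_zero k₃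
  have k₄' := mul_pinv_mul_of_projR_mul_eq_zero k₄
  have := mul_mul_eq_zero_of_qrank
    (M := Cc ◫ D₄ ◫ D₂ ◫ D₃ ◫ D₁ ⊟ C₁ ◫ 0 ◫ 0 ◫ 0 ◫ 0)
    (sumEquivMoveLastOne _ _ _ _ _ _) (sumEquivMoveLastFour _ _ _ _ _ _)
    (by ext ((_ | _) | (_ | _ | _ | _)) ((_ | _ | _ | _ | _) | _) : 2 <;> rfl)
    (h.trans (add_comm _ _))
    (X := X ◫ (-(X * E₁ * pinv A₁)))
    (Y := Y ⊟ (-(pinv B₄ * (F₄ * Y))) ⊟ (-(pinv B₂ * (F₂ * Y))) ⊟ (-(pinv B₃ * (F₃ * Y))) ⊟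
      (-(pinv B₁ * (F₁ * Y))))
    (by
      simp only [Matrix.fromCols_mul_fromRows, Matrix.neg_mul, Matrix.mul_assoc _ _ A₁, h₁',
        add_neg_cancel])
    (by
      simp only [Matrix.fromCols_mul_fromRows, Matrix.fromRows_mul, fromRows_eq_zero,
        Matrix.zero_mul, Matrix.mul_neg, neg_zero,
        k₁', k₂', k₃', k₄', add_zero, zero_add, add_neg_cancel, and_self])
  simp only [Matrix.fromCols_mul_fromRows, Matrix.mul_fromCols, fromCols_add_fromCols,
    Matrix.mul_zero, Matrix.neg_mul, Matrix.mul_neg, add_zero, neg_zero, Matrix.fromCols_neg,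
    Matrix.add_mul, Matrix.mul_assoc] at this
  simp only [Matrix.mul_sub, Matrix.sub_mul, Matrix.mul_assoc]
  linear_combination (norm := abel) this

/-- Multiplying by diagonal sign matrices changes the sign of `G` alone. It is needed because the
large matrix contains `-F₄` while the smaller one is stated with `F₄`. -/
theorem qrank_neg_block_le (G : Matrix s₄ q ℍ[ℝ]) :
    qrank (F₃ ◫ 0    ◫ B₃ ◫ 0  ◫ 0  ◫ 0  ◫ 0 ⊟
           F₁ ◫ 0    ◫ 0  ◫ B₁ ◫ 0  ◫ 0  ◫ 0 ⊟
           0  ◫ F₂   ◫ 0  ◫ 0  ◫ B₂ ◫ 0  ◫ 0 ⊟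
           0  ◫ F₁   ◫ 0  ◫ 0  ◫ 0  ◫ B₁ ◫ 0 ⊟
           F₄ ◫ (-G) ◫ 0  ◫ 0  ◫ 0  ◫ 0  ◫ B₄) ≤
    qrank (F₃ ◫ 0    ◫ B₃ ◫ 0  ◫ 0  ◫ 0  ◫ 0 ⊟
           F₁ ◫ 0    ◫ 0  ◫ B₁ ◫ 0  ◫ 0  ◫ 0 ⊟
           0  ◫ F₂   ◫ 0  ◫ 0  ◫ B₂ ◫ 0  ◫ 0 ⊟
           0  ◫ F₁   ◫ 0  ◫ 0  ◫ 0  ◫ B₁ ◫ 0 ⊟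
           F₄ ◫ G ◫ 0  ◫ 0  ◫ 0  ◫ 0  ◫ B₄) := by
  classical
  -- The second copy changes sign in rows and columns alike, so its own blocks are unaffected; the
  -- shared last row does not change sign.
  let P : s₃ ⊕ s₁ ⊕ s₂ ⊕ s₁ ⊕ s₄ → ℍ[ℝ] :=
    Sum.elim 1 (Sum.elim 1 (Sum.elim (-1) (Sum.elim (-1) 1)))
  let Q : q ⊕ q ⊕ t₃ ⊕ t₁ ⊕ t₂ ⊕ t₁ ⊕ t₄ → ℍ[ℝ] :=
    Sum.elim 1 (Sum.elim (-1) (Sum.elim 1 (Sum.elim 1 (Sum.elim (-1) (Sum.elim (-1) 1)))))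
  refine qrank_le_of_mul_mul_eq (diagonal P) (diagonal Q) ?_
  ext i j : 1
  rw [Matrix.mul_diagonal, Matrix.diagonal_mul]
  rcases i with _ | _ | _ | _ | _ <;> rcases j with _ | _ | _ | _ | _ | _ | _ <;>
    simp only [P, Q, Matrix.fromRows_apply_inl, Matrix.fromRows_apply_inr,
      Matrix.fromCols_apply_inl, Matrix.fromCols_apply_inr, Sum.elim_inl, Sum.elim_inr,
      Pi.one_apply, Pi.neg_apply, Matrix.neg_apply, Matrix.zero_apply, mul_zero, mul_one,
      one_mul, mul_neg, neg_mul, neg_neg, neg_zero]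

theorem qrank_neg_block :
    qrank (F₃ ◫ 0    ◫ B₃ ◫ 0  ◫ 0  ◫ 0  ◫ 0 ⊟
           F₁ ◫ 0    ◫ 0  ◫ B₁ ◫ 0  ◫ 0  ◫ 0 ⊟
           0  ◫ F₂   ◫ 0  ◫ 0  ◫ B₂ ◫ 0  ◫ 0 ⊟
           0  ◫ F₁   ◫ 0  ◫ 0  ◫ 0  ◫ B₁ ◫ 0 ⊟
           F₄ ◫ (-F₄) ◫ 0  ◫ 0  ◫ 0  ◫ 0  ◫ B₄) =
    qrank (F₃ ◫ 0    ◫ B₃ ◫ 0  ◫ 0  ◫ 0  ◫ 0 ⊟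
           F₁ ◫ 0    ◫ 0  ◫ B₁ ◫ 0  ◫ 0  ◫ 0 ⊟
           0  ◫ F₂   ◫ 0  ◫ 0  ◫ B₂ ◫ 0  ◫ 0 ⊟
           0  ◫ F₁   ◫ 0  ◫ 0  ◫ 0  ◫ B₁ ◫ 0 ⊟
           F₄ ◫ F₄ ◫ 0  ◫ 0  ◫ 0  ◫ 0  ◫ B₄) := by
  refine le_antisymm (qrank_neg_block_le F₄) ?_
  simpa only [neg_neg] using qrank_neg_block_le (-F₄)

/-- Two copies of the main equation share the fourth unknown: the first copy puts it on the right,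
the second on the left. The off-diagonal block vanishes because `E₄ x₄ = y₄ F₄`. -/
theorem qrank_double {x₁ : Matrix n₁ q ℍ[ℝ]} {x₂ : Matrix n₂ q ℍ[ℝ]} {x₃ : Matrix n₃ q ℍ[ℝ]}
    {x₄ : Matrix n₄ q ℍ[ℝ]} {y₁ : Matrix p s₁ ℍ[ℝ]} {y₂ : Matrix p s₂ ℍ[ℝ]}
    {y₃ : Matrix p s₃ ℍ[ℝ]} {y₄ : Matrix p s₄ ℍ[ℝ]} (h₁ : A₁ * x₁ = C₁) (h₂ : A₂ * x₂ = C₂)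
    (h₃ : A₃ * x₃ = C₃) (h₄ : A₄ * x₄ = C₄) (k₁ : y₁ * B₁ = D₁) (k₂ : y₂ * B₂ = D₂)
    (k₃ : y₃ * B₃ = D₃) (k₄ : y₄ * B₄ = D₄) (h₄₄ : E₄ * x₄ = y₄ * F₄)
    (ha : E₂ * x₂ + E₁ * x₁ + y₃ * F₃ + y₁ * F₁ + y₄ * F₄ = Cc)
    (hb : E₃ * x₃ + E₁ * x₁ + y₂ * F₂ + y₁ * F₁ + y₄ * F₄ = Cc) :
    qrank (Cc ◫ E₂ ◫ E₁ ◫ 0  ◫ 0  ◫ 0  ◫ E₄ ◫ D₃ ◫ D₁ ◫ 0  ◫ 0  ◫ D₄ ⊟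
           F₃ ◫ 0  ◫ 0  ◫ 0  ◫ 0  ◫ 0  ◫ 0  ◫ B₃ ◫ 0  ◫ 0  ◫ 0  ◫ 0 ⊟
           F₁ ◫ 0  ◫ 0  ◫ 0  ◫ 0  ◫ 0  ◫ 0  ◫ 0  ◫ B₁ ◫ 0  ◫ 0  ◫ 0 ⊟
           0  ◫ 0  ◫ 0  ◫ Cc ◫ E₃ ◫ E₁ ◫ E₄ ◫ 0  ◫ 0  ◫ D₂ ◫ D₁ ◫ 0 ⊟
           0  ◫ 0  ◫ 0  ◫ F₂ ◫ 0  ◫ 0  ◫ 0  ◫ 0  ◫ 0  ◫ B₂ ◫ 0  ◫ 0 ⊟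
           0  ◫ 0  ◫ 0  ◫ F₁ ◫ 0  ◫ 0  ◫ 0  ◫ 0  ◫ 0  ◫ 0  ◫ B₁ ◫ 0 ⊟
           F₄ ◫ 0  ◫ 0  ◫ (-F₄) ◫ 0  ◫ 0  ◫ 0  ◫ 0  ◫ 0  ◫ 0  ◫ 0  ◫ B₄ ⊟
           C₂ ◫ A₂ ◫ 0  ◫ 0  ◫ 0  ◫ 0  ◫ 0  ◫ 0  ◫ 0  ◫ 0  ◫ 0  ◫ 0 ⊟
           C₁ ◫ 0  ◫ A₁ ◫ 0  ◫ 0  ◫ 0  ◫ 0  ◫ 0  ◫ 0  ◫ 0  ◫ 0  ◫ 0 ⊟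
           0  ◫ 0  ◫ 0  ◫ C₃ ◫ A₃ ◫ 0  ◫ 0  ◫ 0  ◫ 0  ◫ 0  ◫ 0  ◫ 0 ⊟
           0  ◫ 0  ◫ 0  ◫ C₁ ◫ 0  ◫ A₁ ◫ 0  ◫ 0  ◫ 0  ◫ 0  ◫ 0  ◫ 0 ⊟
           0  ◫ 0  ◫ 0  ◫ C₄ ◫ 0  ◫ 0  ◫ A₄ ◫ 0  ◫ 0  ◫ 0  ◫ 0  ◫ 0) =
    qrank (F₃ ◫ 0  ◫ B₃ ◫ 0  ◫ 0  ◫ 0  ◫ 0 ⊟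
           F₁ ◫ 0  ◫ 0  ◫ B₁ ◫ 0  ◫ 0  ◫ 0 ⊟
           0  ◫ F₂ ◫ 0  ◫ 0  ◫ B₂ ◫ 0  ◫ 0 ⊟
           0  ◫ F₁ ◫ 0  ◫ 0  ◫ 0  ◫ B₁ ◫ 0 ⊟
           F₄ ◫ F₄ ◫ 0  ◫ 0  ◫ 0  ◫ 0  ◫ B₄) +
    qrank (E₂ ◫ E₁ ◫ 0  ◫ 0  ◫ E₄ ⊟
           0  ◫ 0  ◫ E₃ ◫ E₁ ◫ E₄ ⊟
           A₂ ◫ 0  ◫ 0  ◫ 0  ◫ 0 ⊟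
           0  ◫ A₁ ◫ 0  ◫ 0  ◫ 0 ⊟
           0  ◫ 0  ◫ A₃ ◫ 0  ◫ 0 ⊟
           0  ◫ 0  ◫ 0  ◫ A₁ ◫ 0 ⊟
           0  ◫ 0  ◫ 0  ◫ 0  ◫ A₄) := by
  rw [add_comm, ← qrank_neg_block]
  refine qrank_eq_add_of_eq
    (M := Cc ◫ 0  ◫ D₃ ◫ D₁ ◫ 0  ◫ 0  ◫ D₄ ⊟
          0  ◫ Cc ◫ 0  ◫ 0  ◫ D₂ ◫ D₁ ◫ 0 ⊟
          C₂ ◫ 0  ◫ 0  ◫ 0  ◫ 0  ◫ 0  ◫ 0 ⊟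
          C₁ ◫ 0  ◫ 0  ◫ 0  ◫ 0  ◫ 0  ◫ 0 ⊟
          0  ◫ C₃ ◫ 0  ◫ 0  ◫ 0  ◫ 0  ◫ 0 ⊟
          0  ◫ C₁ ◫ 0  ◫ 0  ◫ 0  ◫ 0  ◫ 0 ⊟
          0  ◫ C₄ ◫ 0  ◫ 0  ◫ 0  ◫ 0  ◫ 0)
    (sumEquivTwelve _ _ _ _ _ _ _ _ _ _ _ _) (sumEquivTwelve _ _ _ _ _ _ _ _ _ _ _ _) ?_
    (x₂ ◫ 0  ◫ 0 ◫ 0 ◫ 0 ◫ 0 ◫ 0 ⊟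
     x₁ ◫ 0  ◫ 0 ◫ 0 ◫ 0 ◫ 0 ◫ 0 ⊟
     0  ◫ x₃ ◫ 0 ◫ 0 ◫ 0 ◫ 0 ◫ 0 ⊟
     0  ◫ x₁ ◫ 0 ◫ 0 ◫ 0 ◫ 0 ◫ 0 ⊟
     0  ◫ x₄ ◫ 0 ◫ 0 ◫ 0 ◫ 0 ◫ 0)
    (y₃ ◫ y₁ ◫ 0 ◫ 0 ◫ y₄ ⊟ 0 ◫ 0 ◫ y₂ ◫ y₁ ◫ 0 ⊟ 0) ?_
  · ext ((_ | _ | _ | _ | _ | _ | _) | (_ | _ | _ | _ | _))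
      ((_ | _ | _ | _ | _ | _ | _) | (_ | _ | _ | _ | _)) : 2 <;> rfl
  · have hb' : E₃ * x₃ + (E₁ * x₁ + (y₄ * F₄ + (y₂ * F₂ + y₁ * F₁))) = Cc := by
      rw [← hb]; abel
    have ha' : E₂ * x₂ + (E₁ * x₁ + (y₃ * F₃ + (y₁ * F₁ + y₄ * F₄))) = Cc := by
      rw [← ha]; abel
    simp only [Matrix.fromRows_mul, Matrix.fromCols_mul_fromRows, Matrix.mul_fromCols,
      fromRows_add_fromRows, fromCols_add_fromCols, Matrix.mul_zero, Matrix.zero_mul, add_zero,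
      zero_add, add_assoc, Matrix.mul_neg, h₁, h₂, h₃, h₄, k₁, k₂, k₃, k₄, h₄₄, ha', hb',
      add_neg_cancel]

/-- Sharing the fourth unknown weakens the annihilation hypotheses: only `X + X'` must kill `E₄
L_{A₄}`, and only `Y - Y'` must be killed by `R_{B₄} F₄`. -/
theorem mul_mul_add_mul_mul_eq_zero_of_qrank_double
    (h : qrank (Cc ◫ E₂ ◫ E₁ ◫ 0  ◫ 0  ◫ 0  ◫ E₄ ◫ D₃ ◫ D₁ ◫ 0  ◫ 0  ◫ D₄ ⊟
                F₃ ◫ 0  ◫ 0  ◫ 0  ◫ 0  ◫ 0  ◫ 0  ◫ B₃ ◫ 0  ◫ 0  ◫ 0  ◫ 0 ⊟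
                F₁ ◫ 0  ◫ 0  ◫ 0  ◫ 0  ◫ 0  ◫ 0  ◫ 0  ◫ B₁ ◫ 0  ◫ 0  ◫ 0 ⊟
                0  ◫ 0  ◫ 0  ◫ Cc ◫ E₃ ◫ E₁ ◫ E₄ ◫ 0  ◫ 0  ◫ D₂ ◫ D₁ ◫ 0 ⊟
                0  ◫ 0  ◫ 0  ◫ F₂ ◫ 0  ◫ 0  ◫ 0  ◫ 0  ◫ 0  ◫ B₂ ◫ 0  ◫ 0 ⊟
                0  ◫ 0  ◫ 0  ◫ F₁ ◫ 0  ◫ 0  ◫ 0  ◫ 0  ◫ 0  ◫ 0  ◫ B₁ ◫ 0 ⊟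
                F₄ ◫ 0  ◫ 0  ◫ (-F₄) ◫ 0  ◫ 0  ◫ 0  ◫ 0  ◫ 0  ◫ 0  ◫ 0  ◫ B₄ ⊟
                C₂ ◫ A₂ ◫ 0  ◫ 0  ◫ 0  ◫ 0  ◫ 0  ◫ 0  ◫ 0  ◫ 0  ◫ 0  ◫ 0 ⊟
                C₁ ◫ 0  ◫ A₁ ◫ 0  ◫ 0  ◫ 0  ◫ 0  ◫ 0  ◫ 0  ◫ 0  ◫ 0  ◫ 0 ⊟
                0  ◫ 0  ◫ 0  ◫ C₃ ◫ A₃ ◫ 0  ◫ 0  ◫ 0  ◫ 0  ◫ 0  ◫ 0  ◫ 0 ⊟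
                0  ◫ 0  ◫ 0  ◫ C₁ ◫ 0  ◫ A₁ ◫ 0  ◫ 0  ◫ 0  ◫ 0  ◫ 0  ◫ 0 ⊟
                0  ◫ 0  ◫ 0  ◫ C₄ ◫ 0  ◫ 0  ◫ A₄ ◫ 0  ◫ 0  ◫ 0  ◫ 0  ◫ 0) =
         qrank (F₃ ◫ 0  ◫ B₃ ◫ 0  ◫ 0  ◫ 0  ◫ 0 ⊟
                F₁ ◫ 0  ◫ 0  ◫ B₁ ◫ 0  ◫ 0  ◫ 0 ⊟
                0  ◫ F₂ ◫ 0  ◫ 0  ◫ B₂ ◫ 0  ◫ 0 ⊟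
                0  ◫ F₁ ◫ 0  ◫ 0  ◫ 0  ◫ B₁ ◫ 0 ⊟
                F₄ ◫ F₄ ◫ 0  ◫ 0  ◫ 0  ◫ 0  ◫ B₄) +
         qrank (E₂ ◫ E₁ ◫ 0  ◫ 0  ◫ E₄ ⊟
                0  ◫ 0  ◫ E₃ ◫ E₁ ◫ E₄ ⊟
                A₂ ◫ 0  ◫ 0  ◫ 0  ◫ 0 ⊟
                0  ◫ A₁ ◫ 0  ◫ 0  ◫ 0 ⊟
                0  ◫ 0  ◫ A₃ ◫ 0  ◫ 0 ⊟
                0  ◫ 0  ◫ 0  ◫ A₁ ◫ 0 ⊟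
                0  ◫ 0  ◫ 0  ◫ 0  ◫ A₄))
    {X X' : Matrix k p ℍ[ℝ]} {Y Y' : Matrix q l ℍ[ℝ]} (h₁ : X * (E₁ * projL A₁) = 0)
    (h₂ : X * (E₂ * projL A₂) = 0) (h₁' : X' * (E₁ * projL A₁) = 0)
    (h₃ : X' * (E₃ * projL A₃) = 0) (h₄ : (X + X') * (E₄ * projL A₄) = 0)
    (k₁ : projR B₁ * F₁ * Y = 0) (k₃ : projR B₃ * F₃ * Y = 0) (k₁' : projR B₁ * F₁ * Y' = 0)
    (k₂ : projR B₂ * F₂ * Y' = 0) (k₄ : projR B₄ * F₄ * (Y - Y') = 0) :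
    X * (Cc - E₁ * (pinv A₁ * C₁) - E₂ * (pinv A₂ * C₂) - D₃ * pinv B₃ * F₃
        - D₁ * pinv B₁ * F₁) * Y
      + X' * (Cc - E₁ * (pinv A₁ * C₁) - E₃ * (pinv A₃ * C₃) - D₂ * pinv B₂ * F₂
        - D₁ * pinv B₁ * F₁) * Y'
      - X * (D₄ * pinv B₄ * F₄) * (Y - Y') - (X + X') * (E₄ * (pinv A₄ * C₄)) * Y' = 0 := by
  rw [← Matrix.mul_assoc] at h₁ h₂ h₁' h₃ h₄
  rw [Matrix.mul_assoc] at k₁ k₂ k₁' k₃ k₄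
  replace h₁ := mul_pinv_mul_of_mul_projL_eq_zero h₁
  replace h₂ := mul_pinv_mul_of_mul_projL_eq_zero h₂
  replace h₁' := mul_pinv_mul_of_mul_projL_eq_zero h₁'
  replace h₃ := mul_pinv_mul_of_mul_projL_eq_zero h₃
  replace h₄ := mul_pinv_mul_of_mul_projL_eq_zero h₄
  replace k₁ := mul_pinv_mul_of_projR_mul_eq_zero k₁
  replace k₂ := mul_pinv_mul_of_projR_mul_eq_zero k₂
  replace k₁' := mul_pinv_mul_of_projR_mul_eq_zero k₁'
  replace k₃ := mul_pinv_mul_of_projR_mul_eq_zero k₃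
  replace k₄ := mul_pinv_mul_of_projR_mul_eq_zero k₄
  rw [add_comm, ← qrank_neg_block] at h
  have := mul_mul_eq_zero_of_qrank
    (M := Cc ◫ 0  ◫ D₃ ◫ D₁ ◫ 0  ◫ 0  ◫ D₄ ⊟
          0  ◫ Cc ◫ 0  ◫ 0  ◫ D₂ ◫ D₁ ◫ 0 ⊟
          C₂ ◫ 0  ◫ 0  ◫ 0  ◫ 0  ◫ 0  ◫ 0 ⊟
          C₁ ◫ 0  ◫ 0  ◫ 0  ◫ 0  ◫ 0  ◫ 0 ⊟
          0  ◫ C₃ ◫ 0  ◫ 0  ◫ 0  ◫ 0  ◫ 0 ⊟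
          0  ◫ C₁ ◫ 0  ◫ 0  ◫ 0  ◫ 0  ◫ 0 ⊟
          0  ◫ C₄ ◫ 0  ◫ 0  ◫ 0  ◫ 0  ◫ 0)
    (sumEquivTwelve _ _ _ _ _ _ _ _ _ _ _ _) (sumEquivTwelve _ _ _ _ _ _ _ _ _ _ _ _)
    (by
      ext ((_ | _ | _ | _ | _ | _ | _) | (_ | _ | _ | _ | _))
        ((_ | _ | _ | _ | _ | _ | _) | (_ | _ | _ | _ | _)) : 2 <;> rfl) h
    (X := X ◫ X' ◫ (-(X * E₂ * pinv A₂)) ◫ (-(X * E₁ * pinv A₁)) ◫ (-(X' * E₃ * pinv A₃)) ◫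
      (-(X' * E₁ * pinv A₁)) ◫ (-((X + X') * E₄ * pinv A₄)))
    (Y := Y ⊟ Y' ⊟ (-(pinv B₃ * (F₃ * Y))) ⊟ (-(pinv B₁ * (F₁ * Y))) ⊟ (-(pinv B₂ * (F₂ * Y'))) ⊟
      (-(pinv B₁ * (F₁ * Y'))) ⊟ (-(pinv B₄ * (F₄ * (Y - Y')))))
    (by
      have h₄₄ : X * E₄ + (X' * E₄ + -((X + X') * E₄)) = 0 := by
        rw [Matrix.add_mul]; abel
      simp only [Matrix.fromCols_mul_fromRows, Matrix.mul_fromCols, fromCols_add_fromCols,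
        Matrix.fromCols_neg, fromCols_eq_zero, Matrix.mul_zero, Matrix.neg_mul, neg_zero,
        Matrix.mul_assoc _ _ A₁, Matrix.mul_assoc _ _ A₂, Matrix.mul_assoc _ _ A₃,
        Matrix.mul_assoc _ _ A₄, h₁, h₂, h₁', h₃, h₄, add_zero, zero_add, add_neg_cancel, h₄₄,
        and_self])
    (by
      have k₄₄ : F₄ * Y + (-(F₄ * Y') + -(F₄ * (Y - Y'))) = 0 := by
        rw [Matrix.mul_sub]; abel
      simp only [Matrix.fromCols_mul_fromRows, Matrix.fromRows_mul, fromRows_eq_zero,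
        Matrix.zero_mul, Matrix.mul_neg, Matrix.neg_mul, neg_zero, k₁, k₂, k₁', k₃, k₄, add_zero,
        zero_add, add_neg_cancel, k₄₄, and_self])
  simp only [Matrix.fromCols_mul_fromRows, Matrix.mul_fromCols, fromCols_add_fromCols,
    Matrix.mul_zero, Matrix.neg_mul, Matrix.mul_neg, add_zero, zero_add, neg_zero,
    Matrix.fromCols_neg, Matrix.add_mul, Matrix.mul_assoc] at this
  simp only [Matrix.mul_sub, Matrix.sub_mul, Matrix.add_mul, Matrix.mul_assoc] at this ⊢
  linear_combination (norm := abel) this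

end RankShapes

/-! ### From solutions to rank conditions and on to projector conditions -/

namespace Coeffs

variable {d : Sizes} {K : Coeffs d}

theorem IsSolution.compatible {U V X Y Z} (h : K.IsSolution U V X Y Z) : K.Compatible := by
  refine ⟨?_, ?_, ?_⟩
  · rw [← h.eqX', ← Matrix.mul_assoc, h.eqX]
  · rw [← h.eqY', ← Matrix.mul_assoc, h.eqY]
  · rw [← h.eqZ', ← Matrix.mul_assoc, h.eqZ]

theorem IsSolution.rankConditions {U V X Y Z} (h : K.IsSolution U V X Y Z) :
    K.RankConditions := by
  have h₂ : K.A₂ * (X * K.F₂) = K.C₂ * K.F₂ := by rw [← Matrix.mul_assoc, h.eqX]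
  have h₃ : K.A₃ * (Y * K.F₃) = K.C₃ * K.F₃ := by rw [← Matrix.mul_assoc, h.eqY]
  have h₄ : K.A₄ * (Z * K.F₄) = K.C₄ * K.F₄ := by rw [← Matrix.mul_assoc, h.eqZ]
  have k₂ : K.E₂ * X * K.B₂ = K.E₂ * K.D₂ := by rw [Matrix.mul_assoc, h.eqX']
  have k₃ : K.E₃ * Y * K.B₃ = K.E₃ * K.D₃ := by rw [Matrix.mul_assoc, h.eqY']
  have k₄ : K.E₄ * Z * K.B₄ = K.E₄ * K.D₄ := by rw [Matrix.mul_assoc, h.eqZ']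
  have e := h.eqMain
  refine ⟨h.compatible, qrank_fromCols_eq_of_mul_eq h.eqU, qrank_fromCols_eq_of_mul_eq h.eqX,
    qrank_fromCols_eq_of_mul_eq h.eqY, qrank_fromCols_eq_of_mul_eq h.eqZ,
    qrank_fromRows_eq_of_mul_eq h.eqV, qrank_fromRows_eq_of_mul_eq h.eqX',
    qrank_fromRows_eq_of_mul_eq h.eqY', qrank_fromRows_eq_of_mul_eq h.eqZ',
    qrank_four_left_one_right h.eqU h₂ h₃ h₄ h.eqV ?_,
    qrank_three_left_two_right h.eqU h₂ h₄ h.eqV k₃ ?_,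
    qrank_three_left_two_right h.eqU h₃ h₄ h.eqV k₂ ?_,
    qrank_two_left_three_right h.eqU h₄ h.eqV k₂ k₃ ?_,
    qrank_three_left_two_right h.eqU h₂ h₃ h.eqV k₄ ?_,
    qrank_two_left_three_right h.eqU h₂ h.eqV k₃ k₄ ?_,
    qrank_two_left_three_right h.eqU h₃ h.eqV k₂ k₄ ?_,
    qrank_one_left_four_right h.eqU h.eqV k₂ k₃ k₄ ?_,
    qrank_double h.eqU h₂ h₃ h₄ h.eqV k₂ k₃ k₄ (Matrix.mul_assoc _ _ _).symm ?_ ?_⟩ <;>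
  · rw [← e]
    try simp only [← Matrix.mul_assoc]
    abel

section Annihilation

variable {k l : Type*} {X : Matrix k (Fin d.p) ℍ[ℝ]} {Y : Matrix (Fin d.q) l ℍ[ℝ]}

/-- When `X` kills `E L_A`, the particular solution in `T₁` reduces to `A† C F`, the form in which
it occurs in the rank lemmas. -/
theorem mul_particular_mul_of_left {p m n s t q : Type*} [Fintype p] [Fintype m] [Fintype n]
    [Fintype s] [Fintype t] [Fintype q] [DecidableEq n] {X : Matrix k p ℍ[ℝ]} {E : Matrix p n ℍ[ℝ]}
    {A : Matrix m n ℍ[ℝ]} (h : X * (E * projL A) = 0) (B : Matrix s t ℍ[ℝ]) (C : Matrix m s ℍ[ℝ])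
    (D : Matrix n t ℍ[ℝ]) (F : Matrix s q ℍ[ℝ]) (Y : Matrix q l ℍ[ℝ]) :
    X * (E * (pinv A * C + projL A * D * pinv B) * F) * Y =
      X * (E * (pinv A * (C * F))) * Y := by
  have h' (W : Matrix n q ℍ[ℝ]) : X * (E * (projL A * W)) = 0 := by
    rw [← Matrix.mul_assoc E, ← Matrix.mul_assoc, h, Matrix.zero_mul]
  simp only [Matrix.mul_add, Matrix.add_mul, Matrix.mul_assoc E, Matrix.mul_assoc (projL A),
    Matrix.mul_assoc (pinv A), h', add_zero]

/-- Here `F Y = B (B† F Y)`, and the particular solution times `B` agrees with `D` on this factor by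
the compatibility `A D = C B`. -/
theorem mul_particular_mul_of_right {p m n s t q : Type*} [Fintype p] [Fintype m] [Fintype n]
    [Fintype s] [Fintype t] [Fintype q] [DecidableEq n] [DecidableEq s] {A : Matrix m n ℍ[ℝ]}
    {B : Matrix s t ℍ[ℝ]} {C : Matrix m s ℍ[ℝ]} {D : Matrix n t ℍ[ℝ]} (h : A * D = C * B)
    {F : Matrix s q ℍ[ℝ]} {Y : Matrix q l ℍ[ℝ]} (hY : projR B * F * Y = 0) (X : Matrix k p ℍ[ℝ])
    (E : Matrix p n ℍ[ℝ]) :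
    X * (E * (pinv A * C + projL A * D * pinv B) * F) * Y =
      X * (E * D * pinv B * F) * Y := by
  rw [Matrix.mul_assoc] at hY
  have h1 : (pinv A * C + projL A * D * pinv B) * (F * Y) = D * (pinv B * (F * Y)) := by
    rw [← mul_pinv_mul_of_projR_mul_eq_zero hY]
    simp only [Matrix.add_mul, Matrix.mul_assoc, mul_mul_assoc_of_eq h.symm, pinv_mul_pinv_assoc,
      projL, Matrix.sub_mul, Matrix.one_mul]
    abel
  simp only [Matrix.mul_assoc] at h1 ⊢
  rw [h1]

theorem mul_T₁_mul (X : Matrix k (Fin d.p) ℍ[ℝ]) (Y : Matrix (Fin d.q) l ℍ[ℝ]) :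
    X * K.T₁ * Y = X * K.Cc * Y - X * (K.E₁ * pinv K.A₁ * K.C₁) * Y
      - X * (K.D₁ * pinv K.B₁ * K.F₁) * Y
      - (X * (K.E₂ * (pinv K.A₂ * K.C₂ + projL K.A₂ * K.D₂ * pinv K.B₂) * K.F₂) * Y
        + X * (K.E₃ * (pinv K.A₃ * K.C₃ + projL K.A₃ * K.D₃ * pinv K.B₃) * K.F₃) * Y
        + X * (K.E₄ * (pinv K.A₄ * K.C₄ + projL K.A₄ * K.D₄ * pinv K.B₄) * K.F₄) * Y) := by
  simp only [T₁, Matrix.mul_sub X, Matrix.mul_add X, Matrix.sub_mul _ _ Y, Matrix.add_mul _ _ Y]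

/-- This and the next seven lemmas cover all ways of annihilating each of the three terms of `X`,
`Y`, `Z` either from the left or from the right; the suffix lists the indices annihilated from the
left, with `main` for all three. -/
theorem RankConditions.mul_T₁_mul_eq_zero_main (hK : K.RankConditions)
    (h₁ : X * K.A₁₁ = 0) (h₂ : X * K.A₂₂ = 0) (h₃ : X * K.A₃₃ = 0) (h₄ : X * K.A₄₄ = 0)
    (k₁ : K.B₁₁ * Y = 0) :
    X * K.T₁ * Y = 0 := by
  have := mul_mul_eq_zero_of_qrank_four_left_one_right hK.rank_main h₁ h₂ h₃ h₄ k₁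
  rw [mul_T₁_mul, mul_particular_mul_of_left h₂, mul_particular_mul_of_left h₃,
    mul_particular_mul_of_left h₄]
  simp only [Matrix.mul_sub, Matrix.sub_mul, Matrix.mul_assoc] at this ⊢
  linear_combination (norm := abel) this

theorem RankConditions.mul_T₁_mul_eq_zero_24 (hK : K.RankConditions)
    (h₁ : X * K.A₁₁ = 0) (h₂ : X * K.A₂₂ = 0) (h₄ : X * K.A₄₄ = 0)
    (k₁ : K.B₁₁ * Y = 0) (k₃ : K.B₃₃ * Y = 0) :
    X * K.T₁ * Y = 0 := by
  have := mul_mul_eq_zero_of_qrank_three_left_two_right hK.rank_24 h₁ h₂ h₄ k₁ k₃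
  rw [mul_T₁_mul, mul_particular_mul_of_left h₂, mul_particular_mul_of_left h₄,
    mul_particular_mul_of_right hK.compatible.2.1 k₃]
  simp only [Matrix.mul_sub, Matrix.sub_mul, Matrix.mul_assoc] at this ⊢
  linear_combination (norm := abel) this

theorem RankConditions.mul_T₁_mul_eq_zero_34 (hK : K.RankConditions)
    (h₁ : X * K.A₁₁ = 0) (h₃ : X * K.A₃₃ = 0) (h₄ : X * K.A₄₄ = 0)
    (k₁ : K.B₁₁ * Y = 0) (k₂ : K.B₂₂ * Y = 0) :
    X * K.T₁ * Y = 0 := by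
  have := mul_mul_eq_zero_of_qrank_three_left_two_right hK.rank_34 h₁ h₃ h₄ k₁ k₂
  rw [mul_T₁_mul, mul_particular_mul_of_left h₃, mul_particular_mul_of_left h₄,
    mul_particular_mul_of_right hK.compatible.1 k₂]
  simp only [Matrix.mul_sub, Matrix.sub_mul, Matrix.mul_assoc] at this ⊢
  linear_combination (norm := abel) this

theorem RankConditions.mul_T₁_mul_eq_zero_23 (hK : K.RankConditions)
    (h₁ : X * K.A₁₁ = 0) (h₂ : X * K.A₂₂ = 0) (h₃ : X * K.A₃₃ = 0)
    (k₁ : K.B₁₁ * Y = 0) (k₄ : K.B₄₄ * Y = 0) :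
    X * K.T₁ * Y = 0 := by
  have := mul_mul_eq_zero_of_qrank_three_left_two_right hK.rank_23 h₁ h₂ h₃ k₁ k₄
  rw [mul_T₁_mul, mul_particular_mul_of_left h₂, mul_particular_mul_of_left h₃,
    mul_particular_mul_of_right hK.compatible.2.2 k₄]
  simp only [Matrix.mul_sub, Matrix.sub_mul, Matrix.mul_assoc] at this ⊢
  linear_combination (norm := abel) this

theorem RankConditions.mul_T₁_mul_eq_zero_4 (hK : K.RankConditions)
    (h₁ : X * K.A₁₁ = 0) (h₄ : X * K.A₄₄ = 0)
    (k₁ : K.B₁₁ * Y = 0) (k₂ : K.B₂₂ * Y = 0) (k₃ : K.B₃₃ * Y = 0) :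
    X * K.T₁ * Y = 0 := by
  have := mul_mul_eq_zero_of_qrank_two_left_three_right hK.rank_4 h₁ h₄ k₁ k₂ k₃
  rw [mul_T₁_mul, mul_particular_mul_of_left h₄, mul_particular_mul_of_right hK.compatible.1 k₂,
    mul_particular_mul_of_right hK.compatible.2.1 k₃]
  simp only [Matrix.mul_sub, Matrix.sub_mul, Matrix.mul_assoc] at this ⊢
  linear_combination (norm := abel) this

theorem RankConditions.mul_T₁_mul_eq_zero_2 (hK : K.RankConditions)
    (h₁ : X * K.A₁₁ = 0) (h₂ : X * K.A₂₂ = 0)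
    (k₁ : K.B₁₁ * Y = 0) (k₃ : K.B₃₃ * Y = 0) (k₄ : K.B₄₄ * Y = 0) :
    X * K.T₁ * Y = 0 := by
  have := mul_mul_eq_zero_of_qrank_two_left_three_right hK.rank_2 h₁ h₂ k₁ k₃ k₄
  rw [mul_T₁_mul, mul_particular_mul_of_left h₂,
    mul_particular_mul_of_right hK.compatible.2.1 k₃,
    mul_particular_mul_of_right hK.compatible.2.2 k₄]
  simp only [Matrix.mul_sub, Matrix.sub_mul, Matrix.mul_assoc] at this ⊢
  linear_combination (norm := abel) this

theorem RankConditions.mul_T₁_mul_eq_zero_3 (hK : K.RankConditions)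
    (h₁ : X * K.A₁₁ = 0) (h₃ : X * K.A₃₃ = 0)
    (k₁ : K.B₁₁ * Y = 0) (k₂ : K.B₂₂ * Y = 0) (k₄ : K.B₄₄ * Y = 0) :
    X * K.T₁ * Y = 0 := by
  have := mul_mul_eq_zero_of_qrank_two_left_three_right hK.rank_3 h₁ h₃ k₁ k₂ k₄
  rw [mul_T₁_mul, mul_particular_mul_of_left h₃, mul_particular_mul_of_right hK.compatible.1 k₂,
    mul_particular_mul_of_right hK.compatible.2.2 k₄]
  simp only [Matrix.mul_sub, Matrix.sub_mul, Matrix.mul_assoc] at this ⊢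
  linear_combination (norm := abel) this

theorem RankConditions.mul_T₁_mul_eq_zero_none (hK : K.RankConditions)
    (h₁ : X * K.A₁₁ = 0)
    (k₁ : K.B₁₁ * Y = 0) (k₂ : K.B₂₂ * Y = 0) (k₃ : K.B₃₃ * Y = 0) (k₄ : K.B₄₄ * Y = 0) :
    X * K.T₁ * Y = 0 := by
  have := mul_mul_eq_zero_of_qrank_one_left_four_right hK.rank_none h₁ k₁ k₂ k₃ k₄
  rw [mul_T₁_mul, mul_particular_mul_of_right hK.compatible.1 k₂,
    mul_particular_mul_of_right hK.compatible.2.1 k₃,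
    mul_particular_mul_of_right hK.compatible.2.2 k₄]
  simp only [Matrix.mul_sub, Matrix.sub_mul, Matrix.mul_assoc] at this ⊢
  linear_combination (norm := abel) this

theorem RankConditions.mul_T₁_mul_add_mul_T₁_mul_eq_zero (hK : K.RankConditions)
    {X' : Matrix k (Fin d.p) ℍ[ℝ]} {Y' : Matrix (Fin d.q) l ℍ[ℝ]}
    (h₁ : X * K.A₁₁ = 0) (h₂ : X * K.A₂₂ = 0) (h₁' : X' * K.A₁₁ = 0) (h₃ : X' * K.A₃₃ = 0)
    (h₄ : (X + X') * K.A₄₄ = 0) (k₁ : K.B₁₁ * Y = 0) (k₃ : K.B₃₃ * Y = 0)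
    (k₁' : K.B₁₁ * Y' = 0) (k₂ : K.B₂₂ * Y' = 0) (k₄ : K.B₄₄ * (Y - Y') = 0) :
    X * K.T₁ * Y + X' * K.T₁ * Y' = 0 := by
  have := mul_mul_add_mul_mul_eq_zero_of_qrank_double hK.rank_double h₁ h₂ h₁' h₃ h₄ k₁ k₃ k₁' k₂ k₄
  have e₁ := mul_particular_mul_of_right hK.compatible.2.2 k₄ X K.E₄
  have e₂ := mul_particular_mul_of_left h₄ K.B₄ K.C₄ K.D₄ K.F₄ Y'
  rw [mul_T₁_mul, mul_T₁_mul, mul_particular_mul_of_left h₂, mul_particular_mul_of_left h₃,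
    mul_particular_mul_of_right hK.compatible.2.1 k₃,
    mul_particular_mul_of_right hK.compatible.1 k₂]
  -- The contribution of the fourth unknown is regrouped as `X R Y + X' R Y' = X R (Y - Y') + (X +
  -- X') R Y'`, and `e₁`, `e₂` evaluate the two summands.
  generalize K.E₄ * (pinv K.A₄ * K.C₄ + projL K.A₄ * K.D₄ * pinv K.B₄) * K.F₄ = R at e₁ e₂ ⊢
  simp only [Matrix.mul_sub, Matrix.sub_mul, Matrix.add_mul, Matrix.mul_assoc] at this e₁ e₂ ⊢
  linear_combination (norm := abel) this - e₁ - e₂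

end Annihilation

/-- The factorizations of `X` through `G₂` and `G₃`, and of `Y` through `H₂` and `H₃`, express `X
F₃₃ Y` and `X F₄₄ Y` as products with `T₁` in the middle, and the doubled rank condition shows that
they agree. -/
theorem RankConditions.mul_F_mul_eq_zero (hK : K.RankConditions)
    (h₃₃ : K.G₂ * K.F₃₃ * K.H₂ = K.L₂) (h₄₄ : K.G₃ * K.F₄₄ * K.H₃ = K.L₃) {k l : Type*}
    {X : Matrix k (Fin d.n₄) ℍ[ℝ]} {Y : Matrix (Fin d.s₄) l ℍ[ℝ]} (h₂ : X * projL K.G₂ = 0)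
    (h₃ : X * projL K.G₃ = 0) (k₂ : projR K.H₂ * Y = 0) (k₃ : projR K.H₃ * Y = 0) :
    X * K.F * Y = 0 := by
  have a₂ := mul_pinv_mul_of_mul_projL_eq_zero h₂
  have a₃ := mul_pinv_mul_of_mul_projL_eq_zero h₃
  have b₂ := mul_pinv_mul_of_projR_mul_eq_zero k₂
  have b₃ := mul_pinv_mul_of_projR_mul_eq_zero k₃
  have e₃₃ : X * K.F₃₃ * Y = X * pinv K.G₂ * K.L₂ * (pinv K.H₂ * Y) := by
    rw [← h₃₃]
    conv_lhs => rw [← a₂, ← b₂]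
    simp only [Matrix.mul_assoc]
  have e₄₄ : X * K.F₄₄ * Y = X * pinv K.G₃ * K.L₃ * (pinv K.H₃ * Y) := by
    rw [← h₄₄]
    conv_lhs => rw [← a₃, ← b₃]
    simp only [Matrix.mul_assoc]
  have a₂' : X * pinv K.G₂ * projR K.A₁₂ * projR K.A₁₁ * K.A₄₄ = X := by
    rw [Matrix.mul_assoc _ _ K.A₄₄, ← A₁₄, Matrix.mul_assoc _ _ K.A₁₄, ← G₂, Matrix.mul_assoc, a₂]
  have a₃' : X * pinv K.G₃ * projR K.A₁₃ * projR K.A₁₁ * K.A₄₄ = X := by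
    rw [Matrix.mul_assoc _ _ K.A₄₄, ← A₁₄, Matrix.mul_assoc _ _ K.A₁₄, ← G₃, Matrix.mul_assoc, a₃]
  have b₂' : K.B₄₄ * (projL K.B₁₁ * (projL K.B₃₁ * (pinv K.H₂ * Y))) = Y := by
    rw [← Matrix.mul_assoc K.B₄₄, ← B₄₁, ← Matrix.mul_assoc K.B₄₁, ← H₂, b₂]
  have b₃' : K.B₄₄ * (projL K.B₁₁ * (projL K.B₂₁ * (pinv K.H₃ * Y))) = Y := by
    rw [← Matrix.mul_assoc K.B₄₄, ← B₄₁, ← Matrix.mul_assoc K.B₄₁, ← H₃, b₃]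
  -- By `a₂'` and `a₃'` both left factors carry `A₄₄` to `X`, and by `b₂'` and `b₃'` both right
  -- factors are carried to `Y` by `B₄₄`. With the minus sign on `X'`, this is exactly the coupling
  -- required of the fourth unknown.
  have key := hK.mul_T₁_mul_add_mul_T₁_mul_eq_zero
    (X := X * pinv K.G₂ * projR K.A₁₂ * projR K.A₁₁)
    (X' := -(X * pinv K.G₃ * projR K.A₁₃ * projR K.A₁₁))
    (Y := projL K.B₁₁ * (projL K.B₃₁ * (pinv K.H₂ * Y)))
    (Y' := projL K.B₁₁ * (projL K.B₂₁ * (pinv K.H₃ * Y)))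
    (by rw [Matrix.mul_assoc, projR_mul, Matrix.mul_zero])
    (by rw [Matrix.mul_assoc _ _ K.A₂₂, ← A₁₂, Matrix.mul_assoc, projR_mul, Matrix.mul_zero])
    (by rw [Matrix.neg_mul, Matrix.mul_assoc, projR_mul, Matrix.mul_zero, neg_zero])
    (by rw [Matrix.neg_mul, Matrix.mul_assoc _ _ K.A₃₃, ← A₁₃, Matrix.mul_assoc, projR_mul,
          Matrix.mul_zero, neg_zero])
    (by rw [Matrix.add_mul, Matrix.neg_mul, a₂', a₃', add_neg_cancel])
    (mul_projL_assoc _ _)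
    (by rw [← Matrix.mul_assoc K.B₃₃, ← B₃₁, mul_projL_assoc])
    (mul_projL_assoc _ _)
    (by rw [← Matrix.mul_assoc K.B₂₂, ← B₂₁, mul_projL_assoc])
    (by rw [Matrix.mul_sub, b₂', b₃', sub_self])
  rw [F, Matrix.mul_sub, Matrix.sub_mul, e₃₃, e₄₄, L₂, L₃, T₂]
  simp only [Matrix.neg_mul, Matrix.mul_assoc] at key ⊢
  linear_combination (norm := abel) -key

/-- Each projector condition is of the form `W T₂ W' = 0` with `W` and `W'` annihilating the
appropriate coefficients. The rank equalities correspond as follows: `main` and `23` to index 1,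
`24` and `2` to index 2, `34` and `3` to index 3, `4` and `none` to index 4, and the doubled one to
the final condition. -/
theorem RankConditions.projectorConditions (hK : K.RankConditions) : K.ProjectorConditions := by
  have a₁ (W : Matrix (Fin d.p) (Fin d.p) ℍ[ℝ]) : W * projR K.A₁₁ * K.A₁₁ = 0 := by
    rw [Matrix.mul_assoc, projR_mul, Matrix.mul_zero]
  have a₂ {W : Matrix (Fin d.p) (Fin d.p) ℍ[ℝ]} (h : W * K.A₁₂ = 0) :
      W * projR K.A₁₁ * K.A₂₂ = 0 := by
    rw [Matrix.mul_assoc, ← A₁₂, h]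
  have a₃ {W : Matrix (Fin d.p) (Fin d.p) ℍ[ℝ]} (h : W * K.A₁₃ = 0) :
      W * projR K.A₁₁ * K.A₃₃ = 0 := by
    rw [Matrix.mul_assoc, ← A₁₃, h]
  have a₄ {W : Matrix (Fin d.p) (Fin d.p) ℍ[ℝ]} (h : W * K.A₁₄ = 0) :
      W * projR K.A₁₁ * K.A₄₄ = 0 := by
    rw [Matrix.mul_assoc, ← A₁₄, h]
  have b₁ (W : Matrix (Fin d.q) (Fin d.q) ℍ[ℝ]) : K.B₁₁ * (projL K.B₁₁ * W) = 0 :=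
    mul_projL_assoc _ _
  have b₂ {W : Matrix (Fin d.q) (Fin d.q) ℍ[ℝ]} (h : K.B₂₁ * W = 0) :
      K.B₂₂ * (projL K.B₁₁ * W) = 0 := by
    rw [← Matrix.mul_assoc, ← B₂₁, h]
  have b₃ {W : Matrix (Fin d.q) (Fin d.q) ℍ[ℝ]} (h : K.B₃₁ * W = 0) :
      K.B₃₃ * (projL K.B₁₁ * W) = 0 := by
    rw [← Matrix.mul_assoc, ← B₃₁, h]
  have b₄ {W : Matrix (Fin d.q) (Fin d.q) ℍ[ℝ]} (h : K.B₄₁ * W = 0) :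
      K.B₄₄ * (projL K.B₁₁ * W) = 0 := by
    rw [← Matrix.mul_assoc, ← B₄₁, h]
  have c (W : Matrix (Fin d.p) (Fin d.p) ℍ[ℝ]) (W' : Matrix (Fin d.q) (Fin d.q) ℍ[ℝ])
      (h : W * projR K.A₁₁ * K.T₁ * (projL K.B₁₁ * W') = 0) : W * K.T₂ * W' = 0 := by
    simpa only [T₂, Matrix.mul_assoc] using h
  have g₁₂ : K.G * K.A₁₂ = 0 := by rw [G, Matrix.mul_assoc, projR_mul, Matrix.mul_zero]
  have RL₁ : projR K.G₁ * K.L₁ = 0 := by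
    have := c (projR K.G₁ * K.G) 1 (hK.mul_T₁_mul_eq_zero_main (a₁ _)
      (a₂ (by rw [Matrix.mul_assoc, g₁₂, Matrix.mul_zero]))
      (a₃ (by rw [Matrix.mul_assoc, G_mul_A₁₃, Matrix.mul_zero]))
      (a₄ (by rw [Matrix.mul_assoc, ← G₁, projR_mul])) (b₁ _))
    rwa [Matrix.mul_one, Matrix.mul_assoc] at this
  have LL₁ : K.L₁ * projL K.H₁ = 0 :=
    c _ _ (hK.mul_T₁_mul_eq_zero_23 (a₁ _) (a₂ g₁₂) (a₃ G_mul_A₁₃) (b₁ _) (b₄ (mul_projL _)))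
  have RL₂ : projR K.G₂ * K.L₂ = 0 := by
    have := c (projR K.G₂ * projR K.A₁₂) (projL K.B₃₁) (hK.mul_T₁_mul_eq_zero_24 (a₁ _)
      (a₂ (by rw [Matrix.mul_assoc, projR_mul, Matrix.mul_zero]))
      (a₄ (by rw [Matrix.mul_assoc, ← G₂, projR_mul])) (b₁ _) (b₃ (mul_projL _)))
    simpa only [L₂, Matrix.mul_assoc] using this
  have LL₂ : K.L₂ * projL K.H₂ = 0 := by
    have := c (projR K.A₁₂) (projL K.B₃₁ * projL K.H₂) (hK.mul_T₁_mul_eq_zero_2 (a₁ _)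
      (a₂ (projR_mul _)) (b₁ _) (b₃ (mul_projL_assoc _ _))
      (b₄ (by rw [← Matrix.mul_assoc, ← H₂, mul_projL])))
    simpa only [L₂, Matrix.mul_assoc] using this
  have RL₃ : projR K.G₃ * K.L₃ = 0 := by
    have := c (projR K.G₃ * projR K.A₁₃) (projL K.B₂₁) (hK.mul_T₁_mul_eq_zero_34 (a₁ _)
      (a₃ (by rw [Matrix.mul_assoc, projR_mul, Matrix.mul_zero]))
      (a₄ (by rw [Matrix.mul_assoc, ← G₃, projR_mul])) (b₁ _) (b₂ (mul_projL _)))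
    simpa only [L₃, Matrix.mul_assoc] using this
  have LL₃ : K.L₃ * projL K.H₃ = 0 := by
    have := c (projR K.A₁₃) (projL K.B₂₁ * projL K.H₃) (hK.mul_T₁_mul_eq_zero_3 (a₁ _)
      (a₃ (projR_mul _)) (b₁ _) (b₂ (mul_projL_assoc _ _))
      (b₄ (by rw [← Matrix.mul_assoc, ← H₃, mul_projL])))
    simpa only [L₃, Matrix.mul_assoc] using this
  have hB₂₁ : K.B₂₁ * K.H = 0 := mul_projL_assoc _ _
  have RL₄ : projR K.G₄ * K.L₄ = 0 := by
    have := c (projR K.G₄) K.H (hK.mul_T₁_mul_eq_zero_4 (a₁ _) (a₄ (projR_mul _)) (b₁ _)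
      (b₂ hB₂₁) (b₃ B₃₁_mul_H))
    rwa [Matrix.mul_assoc] at this
  have LL₄ : K.L₄ * projL K.H₄ = 0 := by
    have := c 1 (K.H * projL K.H₄) (hK.mul_T₁_mul_eq_zero_none (a₁ _) (b₁ _)
      (b₂ (by rw [← Matrix.mul_assoc, hB₂₁, Matrix.zero_mul]))
      (b₃ (by rw [← Matrix.mul_assoc, B₃₁_mul_H, Matrix.zero_mul]))
      (b₄ (by rw [← Matrix.mul_assoc, ← H₄, mul_projL])))
    rwa [Matrix.one_mul, ← Matrix.mul_assoc] at this
  refine ⟨hK.compatible, projR_mul_eq_zero_of_qrank hK.rank_CA₁,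
    projR_mul_eq_zero_of_qrank hK.rank_CA₂, projR_mul_eq_zero_of_qrank hK.rank_CA₃,
    projR_mul_eq_zero_of_qrank hK.rank_CA₄, mul_projL_eq_zero_of_qrank hK.rank_DB₁,
    mul_projL_eq_zero_of_qrank hK.rank_DB₂, mul_projL_eq_zero_of_qrank hK.rank_DB₃,
    mul_projL_eq_zero_of_qrank hK.rank_DB₄, RL₁, RL₂, RL₃, RL₄, LL₁, LL₂, LL₃, LL₄, ?_⟩
  -- Killing `C₁₁` from the left means killing `L_{G₂}` and `L_{G₄}`; the extra factor `R_{E₂₂}`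
  -- also kills `L_{G₃}`. Dually, `L_{D₁₁} L_{E₃₃}` is killed by `R_{H₃}` and `R_{H₂}`.
  have hC₁₁ : projR K.E₂₂ * projR K.C₁₁ * K.C₁₁ = 0 := by
    rw [Matrix.mul_assoc, projR_mul, Matrix.mul_zero]
  have hD₁₁ : K.D₁₁ * (projL K.D₁₁ * projL K.E₃₃) = 0 := mul_projL_assoc _ _
  have := hK.mul_F_mul_eq_zero (F₃₃_spec RL₁ RL₂ LL₁ LL₂).2 (F₄₄_spec RL₃ RL₄ LL₃ LL₄).1
    (mul_projL_of_mul_C₁₁ hC₁₁).1 (by rw [Matrix.mul_assoc, ← C₃₃, ← E₂₂, projR_mul])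
    (by rw [← Matrix.mul_assoc, ← D₂₂, ← E₃₃, mul_projL]) (projR_mul_of_D₁₁_mul hD₁₁).2
  simpa only [E, Matrix.mul_assoc] using this

end Coeffs

/-! ### The theorem -/

theorem theorem3p1 {d : Sizes} (K : Coeffs d) :
    [K.Solvable, K.ProjectorConditions, K.RankConditions].TFAE ∧
    (K.Solvable →
      (∀ P : Params d, K.U₃ P = K.U₃' P) ∧
      (∀ U V X Y Z, K.IsSolution U V X Y Z ↔ ∃ P : Params d, K.IsGiven P (K.U₃ P) U V X Y Z) ∧
      (∀ U V X Y Z, K.IsSolution U V X Y Z ↔ ∃ P : Params d, K.IsGiven P (K.U₃' P) U V X Y Z)) := by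
  have h₁₃ : K.Solvable → K.RankConditions := by
    rintro ⟨U, V, X, Y, Z, h⟩
    exact h.rankConditions
  refine ⟨?_, fun hS => ?_⟩
  · tfae_have 1 → 3 := h₁₃
    tfae_have 3 → 2 := Coeffs.RankConditions.projectorConditions
    -- Every choice of parameters gives a solution; all of them are taken to be zero.
    tfae_have 2 → 1 := fun hK =>
      ⟨_, _, _, _, _, Coeffs.isSolution_of_projectorConditions hK
        ⟨0, 0, 0, 0, 0, 0, 0, 0, 0, 0, 0, 0, 0, 0, 0, 0⟩⟩
    tfae_finish
  · have hK := (h₁₃ hS).projectorConditions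
    have hiff (U V X Y Z) :
        K.IsSolution U V X Y Z ↔ ∃ P : Params d, K.IsGiven P (K.U₃ P) U V X Y Z := by
      refine ⟨fun h => h.exists_params hK, ?_⟩
      rintro ⟨P, rfl, rfl, rfl, rfl, rfl⟩
      exact Coeffs.isSolution_of_projectorConditions hK P
    have hU₃ := Coeffs.U₃_eq_U₃' hK
    exact ⟨hU₃, hiff, by simpa only [← hU₃] using hiff⟩
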